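/- Let $\mathcal A$ be a separable $C^*$-algebra with multiplier algebra $M(\mathcal A)$, and let $T$ be a locally compact metric space with a Radon measure $\mu$. Every $\varphi\in\mathcal A^*$ is extended to $M(\mathcal A)$ by strict continuity. A field $(b_t)_{t\in T}$ in $M(\mathcal A)$ is weak* measurable if $t\mapsto\varphi(b_t)$ is $\mu$-measurable for each $\varphi\in\mathcal A^*$; it is integrable, with integral $\int_T b_t\,d\mu(t)=b\in M(\mathcal A)$, if moreover each $t\mapsto\varphi(b_t)$ is integrable and $\varphi(b)=\int_T\varphi(b_t)\,d\mu(t)$ for each $\varphi\in\mathcal A^*$. An abelian $n$-tuple is an $n$-tuple of mutually commuting self-adjoint elements. If $\underline x$ is such a tuple and $f$ is a real function that is continuous on its joint spectrum, $f(\underline x)\in M(\mathcal A)$ is the element given by the Gelfand transform of the unital $C^*$-algebra generated by $\underline x$. Let $I_1,\dots,I_n\subset\mathbb R$ be intervals and $\underline I=I_1\times\cdots\times I_n$. Let $\underline x_t=(x_{1t},\dots,x_{nt})$, $t\in T$, be abelian $n$-tuples in $\mathcal A$ such that $\mathrm{sp}(x_{it})\subset I_i$ (spectra in $M(\mathcal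 A)$), $\sup_{i,t}\|x_{it}\|<\infty$, and each $(x_{it})_{t\in T}$ is weak* measurable. Let $(a_t)_{t\in T}$ be a unital column field in $M(\mathcal A)$, i.e. a weak* measurable field such that $(a_t^*a_t)$ is integrable with $\int_T a_t^*a_t\,d\mu(t)=1$. Then each field $(a_t^*x_{it}a_t)$ is integrable. Assume that the integrals $y_i=\int_T a_t^*x_{it}a_t\,d\mu(t)$ belong to $\mathcal A$ and form an abelian $n$-tuple $\underline y$. Then $\mathrm{sp}(y_i)\subset I_i$ for each $i$. Let $f:\underline I\to\mathbb R$ be continuous and convex. If $\sup_t\|f(\underline x_t)\|<\infty$ (which is automatic when the $I_i$ are closed), then the field $(a_t^*f(\underline x_t)a_t)$ is integrable. Whenever this field is integrable, the following hold. 1. For every positive functional $\varphi$ on $\mathcal A$ such that $\varphi(xy_i)=\varphi(y_ix)$ for all $x\in\mathcal A$ and all $i$, $$\varphi\Big(f\Big(\int_T a_t^*\underline x_ta_t\,d\mu(t)\Big)\Big)\le\varphi\Big(\int_T a_t^*f(\underline x_t)a_t\,d\mu(t)\Big),\qquad\text{where } f\Big(\int_T a_t^*\underline x_ta_t\,d\mu(t)\Big)=f(\underline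 y).$$ 2. If $f\ge 0$, the same inequality holds in $[0,\infty]$ for every additive, positively homogeneous function $\varphi:\mathcal A_+\to[0,\infty]$ that is lower semicontinuous and finite on the positive part of the minimal dense (Pedersen) ideal $K(\mathcal A)$, provided that $\varphi(xy_i)=\varphi(y_ix)$ for all $x\in K(\mathcal A)$ and all $i$, with $\varphi$ extended linearly to $K(\mathcal A)$. Here $\varphi(m)=\sup\{\varphi(c): c\in\mathcal A_+,\ c\le m\}$ for $m\in M(\mathcal A)_+$. -/

import Mathlib

open MeasureTheory Filter Topology
open scoped ENNReal ComplexOrder ComplexStarModule MultiplierAlgebra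

namespace TraceJensen

noncomputable section

/-! ### Multipliers and functionals -/

section Functionals

variable {A : Type*} [NonUnitalCStarAlgebra A] [PartialOrder A] [StarOrderedRing A]

/-- The canonical (strictly continuous) extension of a bounded functional `φ` on `A` to the
multiplier algebra `M(A)`: `φ(m) = lim φ(m e)` as `e` runs through the increasing approximate
unit of `A`.  (`m.fst e` is the product `m e ∈ A`.) -/
def extend (φ : A →L[ℂ] ℂ) (m : 𝓜(ℂ, A)) : ℂ :=
  limUnder (CStarAlgebra.approximateUnit A) (fun e : A => φ (m.fst e))

/-- `φ` is a positive functional. -/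
def IsPositiveFunctional (φ : A →L[ℂ] ℂ) : Prop :=
  ∀ z : A, 0 ≤ z → 0 ≤ φ z

/-- The centralizer of a bounded functional. -/
def centralizer (φ : A →L[ℂ] ℂ) : Set A :=
  {y | ∀ z : A, φ (z * y) = φ (y * z)}

end Functionals

/-! ### Measurable fields of multipliers and their integrals -/

section Fields

variable {A : Type*} [NonUnitalCStarAlgebra A] [PartialOrder A] [StarOrderedRing A]
variable {T : Type*} [MeasurableSpace T]

/-- Weak* measurability of a field `(b t)` in `M(A)`: every `t ↦ φ (b t)`, `φ ∈ A*`, is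
`μ`-measurable. -/
def WeakStarMeasurable (μ : Measure T) (b : T → 𝓜(ℂ, A)) : Prop :=
  ∀ φ : A →L[ℂ] ℂ, AEStronglyMeasurable (fun t => extend φ (b t)) μ

/-- `z ∈ M(A)` is the weak* integral of the field `b`. -/
def IsFieldIntegral (μ : Measure T) (b : T → 𝓜(ℂ, A)) (z : 𝓜(ℂ, A)) : Prop :=
  WeakStarMeasurable μ b ∧
    ∀ φ : A →L[ℂ] ℂ, Integrable (fun t => extend φ (b t)) μ ∧
      extend φ z = ∫ t, extend φ (b t) ∂μ

/-- The field `b` is integrable: it has a weak* integral in `M(A)`. -/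
def FieldIntegrable (μ : Measure T) (b : T → 𝓜(ℂ, A)) : Prop :=
  ∃ z, IsFieldIntegral μ b z

open Classical in
/-- The integral `∫ b t dμ(t) ∈ M(A)` of an integrable field (`0` if `b` is not integrable). -/
def fieldIntegral (μ : Measure T) (b : T → 𝓜(ℂ, A)) : 𝓜(ℂ, A) :=
  if h : FieldIntegrable μ b then h.choose else 0

/-- Unital column fields: `(a_t)` is weak* measurable, and `∫ a_t^* a_t dμ(t) = 1`. -/
def IsUnitalColumnField (μ : Measure T) (a : T → 𝓜(ℂ, A)) : Prop :=
  WeakStarMeasurable μ a ∧ IsFieldIntegral μ (fun t => star (a t) * a t) 1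

end Fields

/-! ### Functional calculus for abelian tuples -/

section Calculus

/-- An abelian `n`-tuple: self-adjoint, mutually commuting elements. -/
def IsAbelianTuple {B : Type*} [Mul B] [Star B] {n : ℕ} (x : Fin n → B) : Prop :=
  (∀ i, IsSelfAdjoint (x i)) ∧ ∀ i j, Commute (x i) (x j)

variable {B : Type*} [CStarAlgebra B] {n : ℕ}

/-- The unital C*-subalgebra generated by a tuple. -/
def generated (x : Fin n → B) : StarSubalgebra ℂ B :=
  (StarAlgebra.adjoin ℂ (Set.range x)).topologicalClosure

theorem mem_generated (x : Fin n → B) (i : Fin n) : x i ∈ generated x :=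
  StarSubalgebra.le_topologicalClosure _
    (StarAlgebra.subset_adjoin ℂ (Set.range x) (Set.mem_range_self i))

/-- The point `(χ(x₁), …, χ(xₙ))` of the joint spectrum defined by a character `χ`. -/
def jointPoint (x : Fin n → B) (χ : WeakDual.characterSpace ℂ (generated x)) : Fin n → ℝ :=
  fun i => (χ ⟨x i, mem_generated x i⟩).re

/-- `z` is the element of the C*-algebra generated by `x` whose Gelfand transform is `f` on the
joint spectrum. -/
def IsCalculus (x : Fin n → B) (f : (Fin n → ℝ) → ℝ) (z : generated x) : Prop :=
  ∀ χ : WeakDual.characterSpace ℂ (generated x), χ z = (f (jointPoint x χ) : ℂ)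

open Classical in
/-- The element `f(x₁, …, xₙ)` for an abelian tuple `x` and a function `f` that is continuous on
the joint spectrum of `x` (`0` if there is no such element). -/
def calculus (x : Fin n → B) (f : (Fin n → ℝ) → ℝ) : B :=
  if h : ∃ z : generated x, IsCalculus x f z then (h.choose : B) else 0

end Calculus

/-! ### The minimal dense ideal and unbounded functionals -/

section Unbounded

variable {A : Type*} [NonUnitalCStarAlgebra A] [PartialOrder A] [StarOrderedRing A]

variable (A) in
/-- The positive part of the minimal dense (Pedersen) ideal: the positive elements dominated by
a finite sum of elements `u k ≥ 0` that have a local unit `e k ≥ 0` in `A`. -/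
def pedersenCone : Set A :=
  {x | 0 ≤ x ∧ ∃ (m : ℕ) (u e : Fin m → A),
    (∀ k, 0 ≤ u k ∧ 0 ≤ e k ∧ u k = u k * e k) ∧ x ≤ ∑ k, u k}

variable (A) in
/-- The minimal dense ideal `K(A)`. -/
def pedersenIdeal : Submodule ℂ A :=
  Submodule.span ℂ (pedersenCone A)

/-- Possibly unbounded positive functionals `A₊ → [0, ∞]` that are lower semicontinuous on `A₊`
and finite on the minimal dense ideal.  Only the values of `φ` on `A₊` matter. -/
structure IsCStarIntegral (φ : A → ℝ≥0∞) : Prop where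
  map_add : ∀ x y : A, 0 ≤ x → 0 ≤ y → φ (x + y) = φ x + φ y
  map_smul : ∀ (r : ℝ) (x : A), 0 ≤ r → 0 ≤ x → φ (r • x) = ENNReal.ofReal r * φ x
  lsc : LowerSemicontinuousOn φ {x | 0 ≤ x}
  finite : ∀ x ∈ pedersenIdeal A, 0 ≤ x → φ x < ∞

/-- The linear extension of `φ` to `K(A)`: the value at `z = p - q + i (r - s)`, where `p`, `q`
and `r`, `s` are the positive and negative parts of the real and imaginary parts of `z`. -/
def onIdeal (φ : A → ℝ≥0∞) (z : A) : ℂ :=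
  (((φ ((ℜ z : A)⁺)).toReal - (φ ((ℜ z : A)⁻)).toReal : ℝ) : ℂ) +
    (((φ ((ℑ z : A)⁺)).toReal - (φ ((ℑ z : A)⁻)).toReal : ℝ) : ℂ) * Complex.I

/-- The centralizer of an unbounded functional. -/
def unboundedCentralizer (φ : A → ℝ≥0∞) : Set A :=
  {y | ∀ z ∈ pedersenIdeal A, onIdeal φ (z * y) = onIdeal φ (y * z)}

/-- The canonical extension of `φ` to the positive part of `M(A)`:
`φ(m) = sup {φ(c) | c ∈ A₊, c ≤ m}`, where `c ≤ m` in `M(A)` means `m - c = d^* d` for some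
`d ∈ M(A)`. -/
def unboundedExtend (φ : A → ℝ≥0∞) (m : 𝓜(ℂ, A)) : ℝ≥0∞ :=
  ⨆ c ∈ {c : A | 0 ≤ c ∧ ∃ d : 𝓜(ℂ, A), m - (c : 𝓜(ℂ, A)) = star d * d}, φ c

end Unbounded

end

end TraceJensen

/-!
# Jensen's inequality for integrals against unital column fields

The theorem compares two elements of `M(A)`, namely `f(y)` with `y = ∫ a* x a`, and `F = ∫ a* f(x)
a`. In the operator order `F` dominates `ℓ(y)` for each affine minorant `ℓ` of `f`, since `∫ a*
ℓ(x) a = ℓ(y)` (`IsUnitalColumnField.affineValue_le`).  A continuous convex function, on a box that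
need not be closed, is the supremum of its affine minorants (`exists_affine_minorant`), but `F`
need not commute with `y`, so this does not give `f(y) ≤ F`.  What makes the inequality true under
`φ` is that `φ` is a trace relative to the commutative algebra generated by `y`: with a partition
of unity `∑ g_k = 1` in that algebra, chosen such that `f ≤ ℓ_k + ε` on the support of `g_k`, one
has `φ(F) = ∑ φ(g_k^{1/2} F g_k^{1/2}) ≥ ∑ φ(ℓ_k(y) g_k) ≥ φ(f(y)) - ε φ(1)`.  This is
`apply_calculus_le`, and it settles the case of bounded functionals, which extend to `M(A)` as
positive functionals with the same centralizing property (`extend_nonneg`, `extend_mul_comm`).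

**Integrals.**  In a separable C*-algebra weak* measurability of a field of multipliers amounts to
strong measurability of `t ↦ b_t d` for all `d ∈ A` (Pettis), so products and continuous functions
of measurable fields are measurable.  The integral `∫ a* c a` of a bounded field is built as the
multiplier `d ↦ ∫ a* c a d` (`IsUnitalColumnField.fieldIntegrable`): over sets of finite measure on
which `a` is bounded these are Bochner integrals in `A`, and they form a Cauchy sequence by the
Cauchy–Schwarz inequality for the `A`-valued inner product `∫ u* v`, because `∫ (a d)* (a d)`
increases to `d* d` in norm.  The spectrum of `y_i` stays inside the interval `I_i`, even at an
endpoint that `I_i` omits, because a state whose value at `y_i` is such an endpoint would have to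
vanish at almost all `a* a`, whose integral is `1` (`IsUnitalColumnField.spectrum_subset`).

**Unbounded functionals.**  On the Pedersen ideal an unbounded `φ` is a linear functional.  For a
self-adjoint `h` there, `h⁺` and `h⁻` may lie outside the ideal, but their squares do not, and this
suffices for `φ(h⁺)`, `φ(h⁻)` to be finite (`IsCStarIntegral.weight_lt_top_of_sq_mem`).  The Baire
category theorem bounds `φ(m* X m)` by a multiple of `‖m‖²` for `X` in the ideal
(`IsCStarIntegral.exists_weight_conj_le`).  So `m ↦ φ(X m)` is continuous on `M(A)`, and the trace
property passes from the `y_i` to the C*-algebra that they generate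
(`IsCStarIntegral.linearWeight_mul_comm`).  Two consequences carry the proof.  For `r = r*` in that
algebra and in the ideal, `φ(r · r)` is a bounded functional to which the first part applies,
giving `φ(r f(y) r) ≤ φ(r F r)`.  If `r₀² + r₁² = 1`, then `φ(r₀ b r₀) + φ(r₁ b r₁) ≤ φ(b)` for `b
∈ A₊`, with equality for `b` in the ideal.

Functions of `y` that vanish near `0` lie in the ideal (`calculus_mem_cone`), so only the point `0`
of the joint spectrum is problematic.  Either `f` is small near `0`, and a `c ∈ A₊` with `c ≤ f(y)`
is the norm limit of its cut-offs away from `0` (`IsCStarIntegral.weight_le_of_eventually_lt`); or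
`f(0) > 0`, and near `0` a single affine minorant dominates `t f` for a given `t < 1`, so that
there the inequality holds in the operator order (`IsCStarIntegral.weight_smul_le_of_pos`).
Finally `φ(F)` is a supremum over elements of `A` below `F`, and the elements `F^{1/2} v² F^{1/2}`,
for `v` in an approximate unit, are sufficient: if `c ≤ w* w`, then `φ(c) ≤ lim inf φ(w* v² w)`
(`IsCStarIntegral.eventually_lt_weight_conj_sq`).
-/

namespace TraceJensen

/-! ### The multiplier algebra as an ordered C*-algebra -/

section Multiplier

variable {A : Type*} [NonUnitalCStarAlgebra A]

noncomputable instance : PartialOrder 𝓜(ℂ, A) := CStarAlgebra.spectralOrder _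

instance : StarOrderedRing 𝓜(ℂ, A) := CStarAlgebra.spectralOrderedRing _

theorem coe_add (x y : A) : ((x + y : A) : 𝓜(ℂ, A)) = x + y :=
  map_add (DoubleCentralizer.coeHom (𝕜 := ℂ) (A := A)) x y

theorem coe_sub (x y : A) : ((x - y : A) : 𝓜(ℂ, A)) = x - y :=
  map_sub (DoubleCentralizer.coeHom (𝕜 := ℂ) (A := A)) x y

theorem coe_smul (r : ℂ) (x : A) : ((r • x : A) : 𝓜(ℂ, A)) = r • (x : 𝓜(ℂ, A)) :=
  map_smul (DoubleCentralizer.coeHom (𝕜 := ℂ) (A := A)) r x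

theorem coe_zero : ((0 : A) : 𝓜(ℂ, A)) = 0 :=
  map_zero (DoubleCentralizer.coeHom (𝕜 := ℂ) (A := A))

theorem coe_mul (x y : A) : ((x * y : A) : 𝓜(ℂ, A)) = x * y :=
  map_mul (DoubleCentralizer.coeHom (𝕜 := ℂ) (A := A)) x y

theorem coe_star (x : A) : ((star x : A) : 𝓜(ℂ, A)) = star (x : 𝓜(ℂ, A)) :=
  map_star (DoubleCentralizer.coeHom (𝕜 := ℂ) (A := A)) x

theorem norm_coe (x : A) : ‖(x : 𝓜(ℂ, A))‖ = ‖x‖ := by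
  rw [← DoubleCentralizer.norm_fst, DoubleCentralizer.coe_fst,
    ContinuousLinearMap.opNorm_mul_apply]

theorem continuous_coe : Continuous fun x : A => (x : 𝓜(ℂ, A)) :=
  (AddMonoidHomClass.isometry_of_norm (DoubleCentralizer.coeHom (𝕜 := ℂ) (A := A))
    norm_coe).continuous

theorem coe_injective : Function.Injective fun x : A => (x : 𝓜(ℂ, A)) :=
  (AddMonoidHomClass.isometry_of_norm (DoubleCentralizer.coeHom (𝕜 := ℂ) (A := A))
    norm_coe).injective

theorem eq_of_forall_mul_eq {x y : A} (h : ∀ z : A, z * x = z * y) : x = y := by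
  rw [← sub_eq_zero, ← CStarRing.star_mul_self_eq_zero_iff, mul_sub, h, sub_self]

theorem fst_mul (m : 𝓜(ℂ, A)) (x y : A) : m.fst (x * y) = m.fst x * y :=
  eq_of_forall_mul_eq fun z => by
    rw [← m.central, ← mul_assoc, m.central, mul_assoc]

/-- `A` is a left ideal of `M(A)`. -/
theorem mul_coe (m : 𝓜(ℂ, A)) (x : A) : m * (x : 𝓜(ℂ, A)) = (m.fst x : A) := by
  ext y
  · simp [fst_mul]
  · simp [m.central]

/-- `A` is a right ideal of `M(A)`. -/
theorem coe_mul_eq (x : A) (m : 𝓜(ℂ, A)) : (x : 𝓜(ℂ, A)) * m = (m.snd x : A) := by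
  have := congrArg star (mul_coe (star m) (star x))
  rw [star_mul, star_star, coe_star, star_star] at this
  rw [this, ← coe_star, DoubleCentralizer.star_fst, star_star, star_star]

theorem mul_fst_apply (m k : 𝓜(ℂ, A)) (x : A) : (m * k).fst x = m.fst (k.fst x) := by
  rw [DoubleCentralizer.mul_fst]; rfl

theorem star_fst_mul (m : 𝓜(ℂ, A)) (x y : A) :
    star (m.fst x) * y = star x * (star m).fst y := by
  apply coe_injective
  simp only [coe_mul, coe_star, ← mul_coe, star_mul, mul_assoc]

theorem norm_fst_apply_le (m : 𝓜(ℂ, A)) (x : A) : ‖m.fst x‖ ≤ ‖m‖ * ‖x‖ := by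
  rw [← DoubleCentralizer.norm_fst]; exact m.fst.le_opNorm x

theorem ext_fst {m k : 𝓜(ℂ, A)} (h : ∀ x : A, m.fst x = k.fst x) : m = k := by
  have : (m - k).fst = 0 := by
    ext x; simp [h]
  rw [← sub_eq_zero, ← norm_eq_zero, ← DoubleCentralizer.norm_fst, this, norm_zero]

end Multiplier

section OrderedMultiplier

variable {A : Type*} [NonUnitalCStarAlgebra A] [PartialOrder A] [StarOrderedRing A]

theorem coe_nonneg {x : A} (hx : 0 ≤ x) : 0 ≤ (x : 𝓜(ℂ, A)) := by
  obtain ⟨y, rfl⟩ := CStarAlgebra.nonneg_iff_eq_star_mul_self.mp hx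
  rw [coe_mul, coe_star]
  exact star_mul_self_nonneg _

theorem coe_mono {x y : A} (h : x ≤ y) : (x : 𝓜(ℂ, A)) ≤ y := by
  rw [← sub_nonneg, ← coe_sub]
  exact coe_nonneg (sub_nonneg.mpr h)

/-- The order of `A` is induced by the order of `M(A)`: if `x ≥ 0` in `M(A)`, then the negative
part `x⁻` satisfies `x⁻ x x⁻ = -(x⁻)³`, and this is both positive and negative. -/
theorem nonneg_of_coe_nonneg {x : A} (hx : 0 ≤ (x : 𝓜(ℂ, A))) : 0 ≤ x := by
  have hsa : IsSelfAdjoint x := by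
    apply coe_injective
    simp only [coe_star]
    exact (IsSelfAdjoint.of_nonneg hx).star_eq
  rw [← CFC.negPart_eq_zero_iff x]
  set n := x⁻ with hn
  have hn0 : 0 ≤ n := CFC.negPart_nonneg x
  have hns : star n = n := (IsSelfAdjoint.of_nonneg hn0).star_eq
  have h1 : n * x * n = -(n * n * n) := by
    conv_lhs => rw [← CFC.posPart_sub_negPart x]
    rw [mul_sub, CFC.negPart_mul_posPart, zero_sub, neg_mul]
  obtain ⟨k, hk⟩ := CStarAlgebra.nonneg_iff_eq_star_mul_self.mp hx
  have h2 : n * x * n = star (k.fst n) * k.fst n := by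
    apply coe_injective
    simp only [coe_mul, coe_star, ← mul_coe, star_mul, hk]
    rw [← coe_star, hns]
    simp only [mul_assoc]
  have h3 : n * n * n = 0 := by
    apply le_antisymm
    · rw [← neg_nonneg, ← h1, h2]
      exact star_mul_self_nonneg _
    · simpa [hns] using star_left_conjugate_nonneg hn0 n
  have h4 : star (n * n) * (n * n) = 0 := by
    rw [star_mul, hns, ← mul_assoc, h3, zero_mul]
  rw [CStarRing.star_mul_self_eq_zero_iff] at h4
  rwa [← CStarRing.star_mul_self_eq_zero_iff, hns]

theorem coe_nonneg_iff {x : A} : 0 ≤ (x : 𝓜(ℂ, A)) ↔ 0 ≤ x :=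
  ⟨nonneg_of_coe_nonneg, coe_nonneg⟩

theorem coe_le_coe_iff {x y : A} : (x : 𝓜(ℂ, A)) ≤ y ↔ x ≤ y := by
  rw [← sub_nonneg, ← coe_sub, coe_nonneg_iff, sub_nonneg]

end OrderedMultiplier

/-! ### States -/

section States

variable {B : Type*} [CStarAlgebra B]

/-- A contractive unital functional is real on self-adjoint elements: otherwise `ψ (b + i s)` grows
too fast as the real number `s` varies. -/
theorem im_eq_zero_of_contractive {ψ : B →L[ℂ] ℂ} (h1 : ψ 1 = 1) (hψ : ‖ψ‖ ≤ 1) {b : B}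
    (hb : IsSelfAdjoint b) : (ψ b).im = 0 := by
  have key : ∀ s : ℝ, ((ψ b).im + s) ^ 2 ≤ ‖b‖ ^ 2 + s ^ 2 := by
    intro s
    set z : B := b + (s * Complex.I : ℂ) • (1 : B) with hz
    have hzz : star z * z = b * b + ((s ^ 2 : ℝ) : ℂ) • (1 : B) := by
      simp only [hz, star_add, hb.star_eq, star_smul, star_one, Complex.star_def, map_mul,
        Complex.conj_ofReal, Complex.conj_I, add_mul, mul_add, smul_mul_assoc, mul_smul_comm,
        one_mul, mul_one]
      have : (s * -Complex.I) * (s * Complex.I) = ((s ^ 2 : ℝ) : ℂ) := by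
        push_cast
        linear_combination (-(s : ℂ) ^ 2) * Complex.I_sq
      rw [smul_add, smul_smul, mul_comm _ (s * -Complex.I : ℂ), this]
      simp only [mul_neg, neg_smul]
      abel
    have hn : ‖z‖ ^ 2 ≤ ‖b‖ ^ 2 + s ^ 2 := by
      rw [sq, ← CStarRing.norm_star_mul_self, hzz]
      refine (norm_add_le _ _).trans (add_le_add ?_ ?_)
      · rw [sq]; exact norm_mul_le _ _
      · rcases subsingleton_or_nontrivial B with hB | hB
        · rw [Subsingleton.elim (((s ^ 2 : ℝ) : ℂ) • (1 : B)) 0, norm_zero]; positivity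
        · rw [norm_smul, CStarRing.norm_one, mul_one, Complex.norm_real, Real.norm_eq_abs,
            abs_of_nonneg (sq_nonneg s)]
    have hψz : ‖ψ z‖ ≤ ‖z‖ := (ψ.le_opNorm z).trans (mul_le_of_le_one_left (norm_nonneg _) hψ)
    have him : (ψ z).im = (ψ b).im + s := by simp [hz, h1]
    rw [← him]
    calc (ψ z).im ^ 2 = |(ψ z).im| ^ 2 := (sq_abs _).symm
      _ ≤ ‖ψ z‖ ^ 2 := by gcongr; exact Complex.abs_im_le_norm _
      _ ≤ ‖z‖ ^ 2 := by gcongr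
      _ ≤ _ := hn
  by_contra h
  have := key (((‖b‖ ^ 2 + 1) / (2 * (ψ b).im)))
  have h2 : 2 * (ψ b).im * ((‖b‖ ^ 2 + 1) / (2 * (ψ b).im)) = ‖b‖ ^ 2 + 1 := by
    field_simp
  nlinarith [sq_nonneg (ψ b).im]

/-- A contractive unital functional is positive, since `‖b‖ - b` has norm at most `‖b‖`. -/
theorem nonneg_of_contractive [PartialOrder B] [StarOrderedRing B] {ψ : B →L[ℂ] ℂ}
    (h1 : ψ 1 = 1) (hψ : ‖ψ‖ ≤ 1) {b : B} (hb : 0 ≤ b) : 0 ≤ ψ b := by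
  have him := im_eq_zero_of_contractive h1 hψ (IsSelfAdjoint.of_nonneg hb)
  rw [Complex.nonneg_iff]
  refine ⟨?_, him.symm⟩
  have hle : ‖((‖b‖ : ℝ) : ℂ) • (1 : B) - b‖ ≤ ‖b‖ := by
    have hs : ((‖b‖ : ℝ) : ℂ) • (1 : B) = algebraMap ℝ B ‖b‖ := by
      rw [Algebra.algebraMap_eq_smul_one, Complex.coe_smul]
    have h0 : (0 : B) ≤ algebraMap ℝ B ‖b‖ - b :=
      sub_nonneg.mpr (IsSelfAdjoint.of_nonneg hb).le_algebraMap_norm_self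
    rw [hs, CStarAlgebra.norm_le_iff_le_algebraMap _ (norm_nonneg b) h0]
    simpa using hb
  have h2 : ‖ψ (((‖b‖ : ℝ) : ℂ) • (1 : B) - b)‖ ≤ ‖b‖ :=
    (ψ.le_opNorm _).trans ((mul_le_of_le_one_left (norm_nonneg _) hψ).trans hle)
  rw [map_sub, map_smul, h1, smul_eq_mul, mul_one] at h2
  have h3 := (Complex.re_le_norm _).trans h2
  simp only [Complex.sub_re, Complex.ofReal_re] at h3
  linarith

/-- Every spectral value of a self-adjoint element is the value of a state: extend a character of
the generated C*-algebra by the Hahn–Banach theorem. -/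
theorem exists_state_apply_eq {b : B} (hb : IsSelfAdjoint b) {s : ℝ} (hs : s ∈ spectrum ℝ b) :
    ∃ ψ : B →L[ℂ] ℂ, ψ 1 = 1 ∧ ‖ψ‖ ≤ 1 ∧ ψ b = s := by
  have hsn : IsStarNormal b := hb.isStarNormal
  have hB : Nontrivial B := by
    by_contra h
    rw [not_nontrivial_iff_subsingleton] at h
    rw [spectrum.of_subsingleton] at hs
    exact hs
  let S := StarAlgebra.elemental ℂ b
  have hS : NormOneClass S := ⟨(CStarRing.norm_one : ‖(1 : B)‖ = 1)⟩
  let b' : S := ⟨b, StarAlgebra.elemental.self_mem ℂ b⟩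
  have hs' : (s : ℂ) ∈ spectrum ℂ b' := by
    rw [StarSubalgebra.spectrum_eq (hS := StarAlgebra.elemental.isClosed ℂ b)]
    exact spectrum.algebraMap_mem ℂ hs
  obtain ⟨χ, hχ⟩ := WeakDual.CharacterSpace.mem_spectrum_iff_exists.mp hs'
  let ρ : S →L[ℂ] ℂ := LinearMap.mkContinuous
    { toFun := χ, map_add' := map_add χ, map_smul' := map_smul χ } 1 (fun z => by
      rw [one_mul]; exact AlgHom.norm_apply_le_self (WeakDual.CharacterSpace.toAlgHom χ) z)
  obtain ⟨ψ, h1, h2⟩ := exists_extension_norm_eq (Subalgebra.toSubmodule S.toSubalgebra) ρ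
  refine ⟨ψ, ?_, ?_, ?_⟩
  · have := h1 (1 : S)
    exact this.trans (map_one χ)
  · rw [h2]
    exact LinearMap.mkContinuous_norm_le _ zero_le_one _
  · exact (h1 b').trans hχ

end States

/-! ### Strict extension of functionals -/

section Functionals

variable {A : Type*} [NonUnitalCStarAlgebra A]

/-- The functional `x ↦ φ (c x d)`. -/
noncomputable def conjFunctional (φ : A →L[ℂ] ℂ) (c d : A) : A →L[ℂ] ℂ :=
  φ.comp ((ContinuousLinearMap.mul ℂ A c).comp ((ContinuousLinearMap.mul ℂ A).flip d))

theorem conjFunctional_apply (φ : A →L[ℂ] ℂ) (c d x : A) :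
    conjFunctional φ c d x = φ (c * (x * d)) := rfl

/-- The functional `x ↦ φ (x d)`. -/
noncomputable def rightFunctional (φ : A →L[ℂ] ℂ) (d : A) : A →L[ℂ] ℂ :=
  φ.comp ((ContinuousLinearMap.mul ℂ A).flip d)

theorem rightFunctional_apply (φ : A →L[ℂ] ℂ) (d x : A) :
    rightFunctional φ d x = φ (x * d) := rfl

/-- The functional `x ↦ conj (φ (x*))`. -/
noncomputable def starFunctional (φ : A →L[ℂ] ℂ) : A →L[ℂ] ℂ :=
  LinearMap.mkContinuous
    { toFun := fun x => star (φ (star x))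
      map_add' := fun x y => by simp
      map_smul' := fun r x => by simp } ‖φ‖ (fun x => by
        simpa using φ.le_opNorm (star x))

theorem starFunctional_apply (φ : A →L[ℂ] ℂ) (x : A) :
    starFunctional φ x = star (φ (star x)) := rfl

end Functionals

section Extension

variable {A : Type*} [NonUnitalCStarAlgebra A] [PartialOrder A] [StarOrderedRing A]

/-- The row `(x e^{1/2}, y (1 - e)^{1/2})` times the contractive column
`(e^{1/2}, (1 - e)^{1/2})`. -/
theorem norm_mul_add_sub_mul_sq_le {e : A} (he : 0 ≤ e) (he1 : ‖e‖ ≤ 1) (x y : A) :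
    ‖x * e + (y - y * e)‖ ^ 2 ≤ ‖x‖ ^ 2 + ‖y‖ ^ 2 := by
  set E : 𝓜(ℂ, A) := (e : 𝓜(ℂ, A)) with hE
  set X : 𝓜(ℂ, A) := (x : 𝓜(ℂ, A)) with hX
  set Y : 𝓜(ℂ, A) := (y : 𝓜(ℂ, A)) with hY
  have hE0 : 0 ≤ E := coe_nonneg he
  have hEs : star E = E := (IsSelfAdjoint.of_nonneg hE0).star_eq
  have hEn : ‖E‖ ≤ 1 := by rwa [hE, norm_coe]
  have hE1 : E ≤ 1 := (CStarAlgebra.norm_le_one_iff_of_nonneg E hE0).mp hEn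
  have hF0 : 0 ≤ 1 - E := sub_nonneg.mpr hE1
  have hFn : ‖1 - E‖ ≤ 1 :=
    (CStarAlgebra.norm_le_one_iff_of_nonneg _ hF0).mpr (sub_le_self 1 hE0)
  have hEF : 0 ≤ E - E * E := by
    have h : 0 ≤ (1 - E) * E * (1 - E) + E * (1 - E) * E :=
      add_nonneg (conjugate_nonneg_of_nonneg hE0 hF0) (conjugate_nonneg_of_nonneg hF0 hE0)
    have : (1 - E) * E * (1 - E) + E * (1 - E) * E = E - E * E := by noncomm_ring
    rwa [this] at h
  set w : 𝓜(ℂ, A) := X * E + (Y - Y * E) with hw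
  have hwle : w * star w ≤ X * E * star X + Y * (1 - E) * star Y := by
    rw [← sub_nonneg]
    have : X * E * star X + Y * (1 - E) * star Y - w * star w
        = (X - Y) * (E - E * E) * star (X - Y) := by
      simp only [hw, star_add, star_sub, star_mul, hEs]
      noncomm_ring
    rw [this]
    exact star_right_conjugate_nonneg hEF _
  have hwn : ‖x * e + (y - y * e)‖ = ‖w‖ := by
    rw [← norm_coe]
    simp only [coe_add, coe_sub, coe_mul, hw, hX, hY, hE]
  rw [hwn, sq, ← CStarRing.norm_self_mul_star]
  refine (CStarAlgebra.norm_le_norm_of_nonneg_of_le (mul_star_self_nonneg w) hwle).trans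
    ((norm_add_le _ _).trans (add_le_add ?_ ?_))
  · calc ‖X * E * star X‖ ≤ ‖X‖ * ‖E‖ * ‖star X‖ := norm_mul₃_le
      _ ≤ ‖X‖ * 1 * ‖X‖ := by rw [norm_star]; gcongr
      _ = ‖x‖ ^ 2 := by rw [hX, norm_coe]; ring
  · calc ‖Y * (1 - E) * star Y‖ ≤ ‖Y‖ * ‖1 - E‖ * ‖star Y‖ := norm_mul₃_le
      _ ≤ ‖Y‖ * 1 * ‖Y‖ := by rw [norm_star]; gcongr
      _ = ‖y‖ ^ 2 := by rw [hY, norm_coe]; ring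

theorem exists_norm_one_mul_eq_norm (c : ℂ) : ∃ u : ℂ, ‖u‖ = 1 ∧ u * c = ‖c‖ := by
  rcases eq_or_ne c 0 with rfl | hc
  · exact ⟨1, by simp⟩
  · refine ⟨star c / ‖c‖, ?_, ?_⟩
    · rw [norm_div, norm_star, Complex.norm_real, norm_norm, div_self (norm_ne_zero_iff.mpr hc)]
    · have h : (‖c‖ : ℂ) ≠ 0 := by exact_mod_cast norm_ne_zero_iff.mpr hc
      rw [div_mul_eq_mul_div, div_eq_iff h, Complex.star_def, Complex.conj_mul']
      ring

/-- Along an approximate unit, `φ (· e)` tends to `φ` in norm.  If `φ` almost attains its norm at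
`x` in the unit ball, then it almost attains it at `x e`, and `x e + t (y - y e)` has norm at most
`(1 + t²)^{1/2}`, so that `φ (y - y e)` has to be small, uniformly for `y` in the unit ball. -/
theorem eventually_norm_apply_mul_sub_le {l : Filter A} (hl : l.IsIncreasingApproximateUnit)
    (φ : A →L[ℂ] ℂ) {ε : ℝ} (hε : 0 < ε) :
    ∀ᶠ e in l, ∀ x : A, ‖φ (x * e) - φ x‖ ≤ ε * ‖x‖ := by
  set N := ‖φ‖ with hN
  have hN0 : 0 ≤ N := norm_nonneg φ
  set t := ε / (N + 1) with ht
  have ht0 : 0 < t := by positivity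
  set δ := t * ε / 2 with hδ
  have hδ0 : 0 < δ := by positivity
  obtain ⟨x₀, hx₀, hx₀φ⟩ : ∃ x₀ : A, ‖x₀‖ ≤ 1 ∧ N - δ < (φ x₀).re := by
    rcases lt_or_ge (N - δ) 0 with h | h
    · exact ⟨0, by simp, by simpa using h⟩
    · obtain ⟨x, hx1, hx2⟩ := φ.exists_lt_apply_of_lt_opNorm (r := N - δ) (by linarith)
      obtain ⟨u, hu, huc⟩ := exists_norm_one_mul_eq_norm (φ x)
      refine ⟨u • x, by rw [norm_smul, hu, one_mul]; exact hx1.le, ?_⟩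
      rw [map_smul, smul_eq_mul, huc, Complex.ofReal_re]
      exact hx2
  have hev : ∀ᶠ e in l, N - δ < (φ (x₀ * e)).re :=
    (((Complex.continuous_re.comp φ.continuous).tendsto x₀).comp
      (hl.tendsto_mul_left x₀)).eventually (lt_mem_nhds hx₀φ)
  filter_upwards [hev, hl.eventually_nonneg, hl.eventually_norm] with e he he0 he1
  have key : ∀ y : A, ‖y‖ ≤ 1 → ‖φ (y - y * e)‖ ≤ ε := by
    intro y hy
    obtain ⟨u, hu, huc⟩ := exists_norm_one_mul_eq_norm (φ (y - y * e))
    set z : A := ((t : ℂ) * u) • y with hz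
    have hzn : ‖z‖ ≤ t := by
      rw [hz, norm_smul, norm_mul, hu, mul_one, Complex.norm_real, Real.norm_eq_abs,
        abs_of_pos ht0]
      exact mul_le_of_le_one_right ht0.le hy
    have h1 := norm_mul_add_sub_mul_sq_le he0 he1 x₀ z
    have hzφ : φ (z - z * e) = ((t * ‖φ (y - y * e)‖ : ℝ) : ℂ) := by
      have : z - z * e = ((t : ℂ) * u) • (y - y * e) := by
        rw [hz, smul_mul_assoc, smul_sub]
      rw [this, map_smul, smul_eq_mul, mul_assoc, huc]
      push_cast; ring
    have h2 : N - δ + t * ‖φ (y - y * e)‖ ≤ N * ‖x₀ * e + (z - z * e)‖ := by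
      refine le_trans ?_ (φ.le_opNorm _)
      refine le_trans ?_ (Complex.re_le_norm _)
      rw [map_add, hzφ, Complex.add_re, Complex.ofReal_re]
      linarith
    have h3 : ‖x₀ * e + (z - z * e)‖ ≤ 1 + t ^ 2 / 2 := by
      have h4 : ‖x₀ * e + (z - z * e)‖ ^ 2 ≤ 1 + t ^ 2 := by
        refine h1.trans (add_le_add ?_ ?_)
        · exact pow_le_one₀ (norm_nonneg _) hx₀
        · gcongr
      nlinarith [norm_nonneg (x₀ * e + (z - z * e)), sq_nonneg (‖x₀ * e + (z - z * e)‖ - 1)]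
    have h5 : t * ‖φ (y - y * e)‖ ≤ N * t ^ 2 / 2 + δ := by
      nlinarith [mul_le_mul_of_nonneg_left h3 hN0]
    have h6 : N * t ≤ ε := by
      rw [ht, mul_div_assoc', div_le_iff₀ (by positivity)]
      nlinarith
    have h7 : t * ‖φ (y - y * e)‖ ≤ t * ε := by
      rw [hδ] at h5
      nlinarith
    exact le_of_mul_le_mul_left h7 ht0
  intro x
  rcases eq_or_ne x 0 with rfl | hx
  · simp
  have hxn : (‖x‖ : ℂ) ≠ 0 := by exact_mod_cast norm_ne_zero_iff.mpr hx
  have h := key (((‖x‖ : ℂ)⁻¹) • x) (by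
    rw [norm_smul, norm_inv, Complex.norm_real, norm_norm,
      inv_mul_cancel₀ (norm_ne_zero_iff.mpr hx)])
  rw [smul_mul_assoc, ← smul_sub, map_smul, norm_smul, norm_inv, Complex.norm_real, norm_norm,
    inv_mul_le_iff₀ (norm_pos_iff.mpr hx), map_sub, norm_sub_rev] at h
  linarith

theorem tendsto_extend_approximateUnit (φ : A →L[ℂ] ℂ) (m : 𝓜(ℂ, A)) :
    Tendsto (fun e : A => φ (m.fst e)) (CStarAlgebra.approximateUnit A) (𝓝 (extend φ m)) := by
  set l := CStarAlgebra.approximateUnit A with hldef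
  have hl : l.IsIncreasingApproximateUnit := CStarAlgebra.increasingApproximateUnit A
  have : l.NeBot := hl.neBot
  have hC : Cauchy (map (fun e : A => φ (m.fst e)) l) := by
    rw [Metric.cauchy_iff]
    refine ⟨inferInstance, fun ε hε => ?_⟩
    set δ := ε / (4 * (‖m‖ + 1)) with hδ
    have hδ0 : 0 < δ := by positivity
    obtain ⟨e₀, he₀⟩ := (eventually_norm_apply_mul_sub_le hl φ hδ0).exists
    have h1 : ∀ᶠ e in l, dist (φ (m.fst (e * e₀))) (φ (m.fst e₀)) < ε / 4 :=
      Metric.tendsto_nhds.mp (((φ.comp m.fst).continuous.tendsto e₀).comp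
        (hl.tendsto_mul_right e₀)) _ (by positivity)
    have h2 : ∀ᶠ e in l, dist (φ (m.fst e)) (φ (m.fst e₀)) < ε / 2 := by
      filter_upwards [h1, hl.eventually_norm] with e he hen
      have h3 := he₀ (m.fst e)
      rw [← fst_mul, ← dist_eq_norm, dist_comm] at h3
      have h4 : δ * ‖m.fst e‖ ≤ ε / 4 := by
        calc δ * ‖m.fst e‖ ≤ δ * (‖m‖ + 1) := by
              gcongr
              have := norm_fst_apply_le m e
              nlinarith [norm_nonneg m, norm_nonneg e]
          _ = ε / 4 := by rw [hδ]; field_simp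
      have := dist_triangle (φ (m.fst e)) (φ (m.fst (e * e₀))) (φ (m.fst e₀))
      linarith
    refine ⟨_, image_mem_map h2, ?_⟩
    rintro _ ⟨e, he, rfl⟩ _ ⟨e', he', rfl⟩
    have := dist_triangle_right (φ (m.fst e)) (φ (m.fst e')) (φ (m.fst e₀))
    simp only [Set.mem_ofPred_eq] at he he'
    linarith
  exact tendsto_nhds_limUnder (cauchy_map_iff_exists_tendsto.mp hC)

/-- The strict extension may be computed along any approximate unit. -/
theorem tendsto_extend {l : Filter A} (hl : l.IsIncreasingApproximateUnit)
    (φ : A →L[ℂ] ℂ) (m : 𝓜(ℂ, A)) :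
    Tendsto (fun e : A => φ (m.fst e)) l (𝓝 (extend φ m)) := by
  rw [Metric.tendsto_nhds]
  intro ε hε
  set δ := ε / (2 * (‖m‖ + 1)) with hδ
  have hδ0 : 0 < δ := by positivity
  have hl' := CStarAlgebra.increasingApproximateUnit A
  have := hl'.neBot
  filter_upwards [eventually_norm_apply_mul_sub_le hl φ hδ0] with e he
  have h1 : Tendsto (fun e' => dist (φ (m.fst (e' * e))) (φ (m.fst e')))
      (CStarAlgebra.approximateUnit A) (𝓝 (dist (φ (m.fst e)) (extend φ m))) :=
    (((φ.comp m.fst).continuous.tendsto e).comp (hl'.tendsto_mul_right e)).dist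
      (tendsto_extend_approximateUnit φ m)
  have h2 : ∀ᶠ e' in CStarAlgebra.approximateUnit A,
      dist (φ (m.fst (e' * e))) (φ (m.fst e')) ≤ ε / 2 := by
    filter_upwards [hl'.eventually_norm] with e' hen
    rw [fst_mul, dist_eq_norm]
    refine (he (m.fst e')).trans ?_
    calc δ * ‖m.fst e'‖ ≤ δ * (‖m‖ + 1) := by
          gcongr
          have := norm_fst_apply_le m e'
          nlinarith [norm_nonneg m, norm_nonneg e']
      _ = ε / 2 := by rw [hδ]; field_simp
  have := le_of_tendsto h1 h2
  linarith

theorem extend_eq_of_tendsto {l : Filter A} (hl : l.IsIncreasingApproximateUnit)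
    {φ : A →L[ℂ] ℂ} {m : 𝓜(ℂ, A)} {c : ℂ}
    (h : Tendsto (fun e : A => φ (m.fst e)) l (𝓝 c)) : extend φ m = c :=
  have := hl.neBot
  tendsto_nhds_unique (tendsto_extend hl φ m) h

theorem extend_coe (φ : A →L[ℂ] ℂ) (x : A) : extend φ (x : 𝓜(ℂ, A)) = φ x := by
  have hl := CStarAlgebra.increasingApproximateUnit A
  exact extend_eq_of_tendsto hl ((φ.continuous.tendsto x).comp (hl.tendsto_mul_left x))

theorem extend_add (φ : A →L[ℂ] ℂ) (m k : 𝓜(ℂ, A)) :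
    extend φ (m + k) = extend φ m + extend φ k := by
  refine extend_eq_of_tendsto (CStarAlgebra.increasingApproximateUnit A) ?_
  simpa using (tendsto_extend_approximateUnit φ m).add (tendsto_extend_approximateUnit φ k)

theorem extend_smul (φ : A →L[ℂ] ℂ) (r : ℂ) (m : 𝓜(ℂ, A)) :
    extend φ (r • m) = r * extend φ m := by
  refine extend_eq_of_tendsto (CStarAlgebra.increasingApproximateUnit A) ?_
  simpa using (tendsto_extend_approximateUnit φ m).const_mul r

theorem norm_extend_le (φ : A →L[ℂ] ℂ) (m : 𝓜(ℂ, A)) : ‖extend φ m‖ ≤ ‖φ‖ * ‖m‖ := by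
  have hl := CStarAlgebra.increasingApproximateUnit A
  have := hl.neBot
  refine le_of_tendsto (tendsto_extend_approximateUnit φ m).norm ?_
  filter_upwards [hl.eventually_norm] with e he
  refine (φ.le_opNorm _).trans ?_
  gcongr
  exact (norm_fst_apply_le m e).trans (mul_le_of_le_one_right (norm_nonneg m) he)

/-- The strict extension of a bounded functional on `A`, as a bounded functional on `M(A)`. -/
noncomputable def extendCLM (φ : A →L[ℂ] ℂ) : 𝓜(ℂ, A) →L[ℂ] ℂ :=
  LinearMap.mkContinuous
    { toFun := extend φ, map_add' := extend_add φ, map_smul' := extend_smul φ } ‖φ‖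
    (norm_extend_le φ)

theorem extend_sub (φ : A →L[ℂ] ℂ) (m k : 𝓜(ℂ, A)) :
    extend φ (m - k) = extend φ m - extend φ k := map_sub (extendCLM φ) m k

theorem extend_conjFunctional (φ : A →L[ℂ] ℂ) (c d : A) (m : 𝓜(ℂ, A)) :
    extend (conjFunctional φ c d) m = φ (c * m.fst d) := by
  have hl := CStarAlgebra.increasingApproximateUnit A
  refine extend_eq_of_tendsto hl ?_
  simp only [conjFunctional_apply, ← fst_mul]
  exact ((φ.continuous.comp ((continuous_const_mul c).comp m.fst.continuous)).tendsto d).comp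
    (hl.tendsto_mul_right d)

theorem extend_rightFunctional (φ : A →L[ℂ] ℂ) (d : A) (m : 𝓜(ℂ, A)) :
    extend (rightFunctional φ d) m = φ (m.fst d) := by
  have hl := CStarAlgebra.increasingApproximateUnit A
  refine extend_eq_of_tendsto hl ?_
  simp only [rightFunctional_apply, ← fst_mul]
  exact ((φ.continuous.comp m.fst.continuous).tendsto d).comp (hl.tendsto_mul_right d)

theorem eventually_norm_apply_mul_left_sub_le {l : Filter A} (hl : l.IsIncreasingApproximateUnit)
    (φ : A →L[ℂ] ℂ) {ε : ℝ} (hε : 0 < ε) :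
    ∀ᶠ e in l, ∀ x : A, ‖φ (e * x) - φ x‖ ≤ ε * ‖x‖ := by
  filter_upwards [eventually_norm_apply_mul_sub_le hl (starFunctional φ) hε,
    hl.eventually_star_eq] with e he hes x
  have := he (star x)
  rwa [starFunctional_apply, starFunctional_apply, star_mul, star_star, hes, ← star_sub,
    norm_star, norm_star] at this

/-- The extended functional is also the limit of the two-sided truncations. -/
theorem tendsto_extend_conj {l : Filter A} (hl : l.IsIncreasingApproximateUnit)
    (φ : A →L[ℂ] ℂ) (m : 𝓜(ℂ, A)) :
    Tendsto (fun e : A => φ (e * m.fst e)) l (𝓝 (extend φ m)) := by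
  rw [Metric.tendsto_nhds]
  intro ε hε
  set δ := ε / (2 * (‖m‖ + 1)) with hδ
  have hδ0 : 0 < δ := by positivity
  filter_upwards [eventually_norm_apply_mul_left_sub_le hl φ hδ0, hl.eventually_norm,
    Metric.tendsto_nhds.mp (tendsto_extend hl φ m) (ε / 2) (by positivity)] with e he hen h1
  have h2 : dist (φ (e * m.fst e)) (φ (m.fst e)) ≤ ε / 2 := by
    rw [dist_eq_norm]
    refine (he _).trans ?_
    calc δ * ‖m.fst e‖ ≤ δ * (‖m‖ + 1) := by
          gcongr
          have := norm_fst_apply_le m e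
          nlinarith [norm_nonneg m, norm_nonneg e]
      _ = ε / 2 := by rw [hδ]; field_simp
  have := dist_triangle (φ (e * m.fst e)) (φ (m.fst e)) (extend φ m)
  linarith

theorem extend_star (φ : A →L[ℂ] ℂ) (m : 𝓜(ℂ, A)) :
    extend φ (star m) = star (extend (starFunctional φ) m) := by
  have hl := CStarAlgebra.increasingApproximateUnit A
  have := hl.neBot
  refine tendsto_nhds_unique (tendsto_extend_conj hl φ (star m))
    (((continuous_star.tendsto _).comp (tendsto_extend_conj hl (starFunctional φ) m)).congr' ?_)
  filter_upwards [hl.eventually_star_eq] with e he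
  simp only [Function.comp_apply, starFunctional_apply, star_star, star_mul, he]
  rw [star_fst_mul, he]

/-- The extension of a positive functional is positive. -/
theorem extend_nonneg {φ : A →L[ℂ] ℂ} (hφ : IsPositiveFunctional φ) {m : 𝓜(ℂ, A)}
    (hm : 0 ≤ m) : 0 ≤ extend φ m := by
  obtain ⟨k, rfl⟩ := CStarAlgebra.nonneg_iff_eq_star_mul_self.mp hm
  have hl := CStarAlgebra.increasingApproximateUnit A
  have := hl.neBot
  refine ge_of_tendsto (tendsto_extend_conj hl φ _) ?_
  filter_upwards [hl.eventually_star_eq] with e he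
  have : e * (star k * k).fst e = star (k.fst e) * k.fst e := by
    rw [star_fst_mul, he, mul_fst_apply]
  rw [this]
  exact hφ _ (star_mul_self_nonneg _)

theorem extend_mono {φ : A →L[ℂ] ℂ} (hφ : IsPositiveFunctional φ) {m k : 𝓜(ℂ, A)}
    (h : m ≤ k) : extend φ m ≤ extend φ k := by
  rw [← sub_nonneg, ← extend_sub]
  exact extend_nonneg hφ (sub_nonneg.mpr h)

theorem extend_mul_comm {φ : A →L[ℂ] ℂ} {y : A} (hy : y ∈ centralizer φ) (m : 𝓜(ℂ, A)) :
    extend φ (m * y) = extend φ (y * m) := by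
  have hl := CStarAlgebra.increasingApproximateUnit A
  have := hl.neBot
  rw [mul_coe, extend_coe]
  refine (extend_eq_of_tendsto hl ?_).symm
  have h : Tendsto (fun e : A => φ (m.fst (e * y))) (CStarAlgebra.approximateUnit A)
      (𝓝 (φ (m.fst y))) :=
    ((φ.comp m.fst).continuous.tendsto y).comp (hl.tendsto_mul_right y)
  refine h.congr fun e => ?_
  rw [fst_mul, hy, mul_fst_apply]
  rfl

/-- Bounded functionals on `A` separate the points of `M(A)`. -/
theorem eq_of_forall_extend_eq {m k : 𝓜(ℂ, A)}
    (h : ∀ φ : A →L[ℂ] ℂ, extend φ m = extend φ k) : m = k := by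
  refine ext_fst fun x => ?_
  by_contra hne
  obtain ⟨φ, hφ⟩ := SeparatingDual.exists_separating_of_ne (R := ℂ) hne
  exact hφ (by rw [← extend_rightFunctional, h, extend_rightFunctional])

/-- Positive functionals on `A` detect the positive elements of `A`. -/
theorem exists_positive_apply_ne_zero {p : A} (hp : 0 ≤ p) (hp0 : p ≠ 0) :
    ∃ φ : A →L[ℂ] ℂ, IsPositiveFunctional φ ∧ φ p ≠ 0 := by
  have hP : 0 ≤ (p : 𝓜(ℂ, A)) := coe_nonneg hp
  have hpn : ‖(p : 𝓜(ℂ, A))‖ ≠ 0 := by rw [norm_coe]; exact norm_ne_zero_iff.mpr hp0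
  have : Nontrivial 𝓜(ℂ, A) := ⟨⟨_, 0, norm_ne_zero_iff.mp hpn⟩⟩
  obtain ⟨ψ, h1, h2, h3⟩ := exists_state_apply_eq (IsSelfAdjoint.of_nonneg hP)
    (CStarAlgebra.norm_mem_spectrum_of_nonneg hP)
  let κ : A →L[ℂ] 𝓜(ℂ, A) :=
    ⟨(DoubleCentralizer.coeHom (𝕜 := ℂ) (A := A) : A →ₗ[ℂ] 𝓜(ℂ, A)), continuous_coe⟩
  refine ⟨ψ.comp κ, fun z hz => nonneg_of_contractive h1 h2 (coe_nonneg hz), ?_⟩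
  change ψ (p : 𝓜(ℂ, A)) ≠ 0
  rw [h3]
  exact_mod_cast hpn

theorem isPositiveFunctional_conj {φ : A →L[ℂ] ℂ} (hφ : IsPositiveFunctional φ) (w : A) :
    IsPositiveFunctional (conjFunctional φ (star w) w) := fun z hz => by
  rw [conjFunctional_apply, ← mul_assoc]
  exact hφ _ (star_left_conjugate_nonneg hz w)

/-- Otherwise some positive functional `φ` is nonzero at `(v⁻)³ = -v⁻ v v⁻`, and then the positive
functional `φ (v⁻ · v⁻)` is negative at `v`. -/
theorem nonneg_of_forall_positive {v : A} (hv : IsSelfAdjoint v)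
    (h : ∀ φ : A →L[ℂ] ℂ, IsPositiveFunctional φ → 0 ≤ φ v) : 0 ≤ v := by
  rw [← CFC.negPart_eq_zero_iff v]
  obtain ⟨n, hn⟩ : ∃ n, n = v⁻ := ⟨_, rfl⟩
  rw [← hn]
  by_contra hp
  have hn0 : 0 ≤ n := hn ▸ CFC.negPart_nonneg v
  have hns : star n = n := (IsSelfAdjoint.of_nonneg hn0).star_eq
  have h1 : n * (v * n) = -(star n * n * n) := by
    have : v * n = -(n * n) := by
      conv_lhs => rw [← CFC.posPart_sub_negPart v]
      rw [hn, sub_mul, CFC.posPart_mul_negPart, zero_sub]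
    rw [this, hns, mul_neg, mul_assoc]
  have hpos : 0 ≤ star n * n * n := star_left_conjugate_nonneg hn0 n
  have hne : star n * n * n ≠ 0 := by
    intro h0
    rw [hns] at h0
    have h4 : star (n * n) * (n * n) = 0 := by
      rw [star_mul, hns, ← mul_assoc, h0, zero_mul]
    rw [CStarRing.star_mul_self_eq_zero_iff] at h4
    apply hp
    rwa [← CStarRing.star_mul_self_eq_zero_iff, hns]
  obtain ⟨φ, hφ, hφp⟩ := exists_positive_apply_ne_zero hpos hne
  have h2 := h _ (isPositiveFunctional_conj hφ n)
  rw [conjFunctional_apply, hns, h1, map_neg, neg_nonneg] at h2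
  exact hφp (le_antisymm h2 (hφ _ hpos))

theorem apply_star_of_positive {φ : A →L[ℂ] ℂ} (hφ : IsPositiveFunctional φ) (x : A) :
    φ (star x) = star (φ x) := by
  have hsa : ∀ v : A, IsSelfAdjoint v → star (φ v) = φ v := by
    intro v hv
    rw [← CFC.posPart_sub_negPart v, map_sub, star_sub,
      (IsSelfAdjoint.of_nonneg (hφ _ (CFC.posPart_nonneg v))).star_eq,
      (IsSelfAdjoint.of_nonneg (hφ _ (CFC.negPart_nonneg v))).star_eq]
  have h1 := hsa _ (ℜ x).2
  have h2 := hsa _ (ℑ x).2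
  have h3 : star x = (ℜ x : A) - Complex.I • (ℑ x : A) := by
    conv_lhs => rw [← realPart_add_I_smul_imaginaryPart x]
    rw [star_add, star_smul, (ℜ x).2.star_eq, (ℑ x).2.star_eq, Complex.star_def, Complex.conj_I,
      neg_smul, sub_eq_add_neg]
  conv_rhs => rw [← realPart_add_I_smul_imaginaryPart x]
  rw [h3, map_sub, map_add, map_smul, star_add, h1, smul_eq_mul, star_mul', h2, Complex.star_def,
    Complex.conj_I]
  ring

theorem extend_star_of_positive {φ : A →L[ℂ] ℂ} (hφ : IsPositiveFunctional φ) (m : 𝓜(ℂ, A)) :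
    extend φ (star m) = star (extend φ m) := by
  rw [extend_star]
  congr 2
  ext x
  rw [starFunctional_apply, apply_star_of_positive hφ, star_star]

/-- A self-adjoint multiplier is positive if all `d* m d`, `d ∈ A`, are positive. -/
theorem nonneg_of_forall_star_mul_nonneg {m : 𝓜(ℂ, A)} (hm : IsSelfAdjoint m)
    (h : ∀ d : A, 0 ≤ star d * m.fst d) : 0 ≤ m := by
  rw [← CFC.negPart_eq_zero_iff m]
  obtain ⟨n, hn⟩ : ∃ n, n = m⁻ := ⟨_, rfl⟩
  rw [← hn]
  have hn0 : 0 ≤ n := hn ▸ CFC.negPart_nonneg m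
  have hns : star n = n := (IsSelfAdjoint.of_nonneg hn0).star_eq
  have hmn : m * n = -(n * n) := by
    conv_lhs => rw [← CFC.posPart_sub_negPart m]
    rw [hn, sub_mul, CFC.posPart_mul_negPart, zero_sub]
  obtain ⟨k, hk⟩ := CStarAlgebra.nonneg_iff_eq_star_mul_self.mp hn0
  have h1 : k * n = 0 := by
    refine ext_fst fun x => ?_
    have h2 := h (n.fst x)
    have h3 : star (n.fst x) * m.fst (n.fst x)
        = -(star ((k * n).fst x) * (k * n).fst x) := by
      apply coe_injective
      have : ((-(star ((k * n).fst x) * (k * n).fst x) : A) : 𝓜(ℂ, A))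
          = -((star ((k * n).fst x) * (k * n).fst x : A) : 𝓜(ℂ, A)) :=
        map_neg (DoubleCentralizer.coeHom (𝕜 := ℂ) (A := A)) _
      simp only [this]
      simp only [coe_mul, coe_star, ← mul_coe, star_mul, hns, mul_assoc]
      rw [← mul_assoc m, hmn, ← mul_assoc (star k), ← hk]
      simp only [mul_assoc, neg_mul, mul_neg]
    rw [h3, neg_nonneg] at h2
    have h4 := le_antisymm h2 (star_mul_self_nonneg _)
    rw [CStarRing.star_mul_self_eq_zero_iff] at h4
    simpa using h4
  have h5 : star n * n = 0 := by rw [hns]; nth_rw 1 [hk]; rw [mul_assoc, h1, mul_zero]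
  rwa [CStarRing.star_mul_self_eq_zero_iff] at h5

/-- An element of `M(A)` is positive if all positive functionals on `A` are positive at it. -/
theorem nonneg_of_forall_extend_nonneg {m : 𝓜(ℂ, A)}
    (h : ∀ φ : A →L[ℂ] ℂ, IsPositiveFunctional φ → 0 ≤ extend φ m) : 0 ≤ m := by
  have conj_nonneg : ∀ k : 𝓜(ℂ, A), IsSelfAdjoint k →
      (∀ φ : A →L[ℂ] ℂ, IsPositiveFunctional φ → 0 ≤ extend φ k) → 0 ≤ k := by
    intro k hk hkφ
    refine nonneg_of_forall_star_mul_nonneg hk fun d => nonneg_of_forall_positive ?_ fun φ hφ => ?_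
    · apply coe_injective
      simp only [coe_star, coe_mul, ← mul_coe, star_mul, star_star, hk.star_eq, mul_assoc]
    · rw [← extend_conjFunctional]
      exact hkφ _ (isPositiveFunctional_conj hφ d)
  have hz : ∀ φ : A →L[ℂ] ℂ, IsPositiveFunctional φ → extend φ (m - star m) = 0 := by
    intro φ hφ
    rw [extend_sub, extend_star_of_positive hφ, (IsSelfAdjoint.of_nonneg (h φ hφ)).star_eq,
      sub_self]
  have hsk : IsSelfAdjoint (Complex.I • (m - star m)) := by
    rw [IsSelfAdjoint, star_smul, star_sub, star_star, Complex.star_def, Complex.conj_I, neg_smul,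
      ← smul_neg, neg_sub]
  have h1 := conj_nonneg _ hsk fun φ hφ => by rw [extend_smul, hz φ hφ, mul_zero]
  have h2 := conj_nonneg _ hsk.neg fun φ hφ => by
    rw [← smul_neg, extend_smul, ← neg_one_smul ℂ (m - star m), extend_smul, hz φ hφ, mul_zero,
      mul_zero]
  have h3 : Complex.I • (m - star m) = 0 := le_antisymm (neg_nonneg.mp h2) h1
  rw [smul_eq_zero_iff_right Complex.I_ne_zero, sub_eq_zero] at h3
  exact conj_nonneg m h3.symm h

end Extension

/-! ### Affine minorants of convex functions -/

section Affine

variable {n : ℕ}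

/-- The affine function `s ↦ ∑ pᵢ sᵢ + c` with coefficients `q = (p, c)`. -/
def affine (q : (Fin n → ℝ) × ℝ) (s : Fin n → ℝ) : ℝ := ∑ i, q.1 i * s i + q.2

theorem continuous_affine (q : (Fin n → ℝ) × ℝ) : Continuous (affine q) := by
  unfold affine; fun_prop

/-- A continuous convex function on a convex set, closed or not, is the supremum of its affine
minorants: separate a point below the graph from the closure of the epigraph. -/
theorem exists_affine_minorant {S : Set (Fin n → ℝ)} {f : (Fin n → ℝ) → ℝ}
    (hf : ContinuousOn f S) (hconv : ConvexOn ℝ S f) {s : Fin n → ℝ} (hs : s ∈ S) {ε : ℝ}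
    (hε : 0 < ε) : ∃ q, (∀ z ∈ S, affine q z ≤ f z) ∧ affine q s = f s - ε := by
  set E : Set ((Fin n → ℝ) × ℝ) := {p | p.1 ∈ S ∧ f p.1 ≤ p.2} with hE
  have hnot : (s, f s - ε) ∉ closure E := by
    intro hmem
    have h1 : ∀ᶠ z in 𝓝[S] s, f s - ε / 2 < f z := hf s hs (lt_mem_nhds (by linarith))
    rw [eventually_nhdsWithin_iff] at h1
    have h2 : ∀ᶠ p : (Fin n → ℝ) × ℝ in 𝓝 (s, f s - ε), p ∉ E := by
      rw [nhds_prod_eq]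
      filter_upwards [h1.prod_mk (gt_mem_nhds (show f s - ε < f s - ε / 2 by linarith))]
        with p hp hpE
      have := hp.1 hpE.1
      have h3 := hpE.2
      have h4 := hp.2
      linarith
    rw [mem_closure_iff_frequently] at hmem
    exact hmem h2
  obtain ⟨L, u, hL1, hL2⟩ := geometric_hahn_banach_point_closed hconv.convex_epigraph.closure
    isClosed_closure hnot
  have hsplit : ∀ (z : Fin n → ℝ) (r : ℝ), L (z, r) = L (z, 0) + r * L (0, 1) := by
    intro z r
    have : (z, r) = (z, (0 : ℝ)) + r • ((0 : Fin n → ℝ), (1 : ℝ)) := by simp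
    rw [this, map_add, map_smul, smul_eq_mul]
  have hlt : ∀ z ∈ S, L (s, 0) + (f s - ε) * L (0, 1) < L (z, 0) + f z * L (0, 1) := by
    intro z hz
    rw [← hsplit, ← hsplit]
    exact hL1.trans (hL2 _ (subset_closure ⟨hz, le_rfl⟩))
  have hα : 0 < L (0, 1) := by
    have := hlt s hs
    nlinarith
  set α := L (0, 1) with hαdef
  have hlin : ∀ z : Fin n → ℝ, ∑ i, (-(L (Pi.single i 1, 0)) / α) * z i = -L (z, 0) / α := by
    intro z
    have h := LinearMap.pi_apply_eq_sum_univ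
      ((L : ((Fin n → ℝ) × ℝ) →ₗ[ℝ] ℝ).comp (LinearMap.inl ℝ (Fin n → ℝ) ℝ)) z
    simp only [LinearMap.comp_apply, LinearMap.inl_apply, ContinuousLinearMap.coe_coe,
      smul_eq_mul] at h
    rw [h, ← Finset.sum_neg_distrib, Finset.sum_div]
    refine Finset.sum_congr rfl fun i _ => ?_
    have : (fun j => if i = j then (1 : ℝ) else 0) = Pi.single i 1 := by
      ext j; simp [Pi.single_apply, eq_comm]
    rw [this]
    ring
  refine ⟨(fun i => -(L (Pi.single i 1, 0)) / α, f s - ε + L (s, 0) / α), fun z hz => ?_, ?_⟩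
  · rw [affine, hlin]
    have := hlt z hz
    have h2 : L (s, 0) / α - L (z, 0) / α + (f s - ε) ≤ f z := by
      rw [← sub_div, ← le_sub_iff_add_le, div_le_iff₀ hα]
      linarith
    linarith [neg_div α (L (z, 0))]
  · rw [affine, hlin]
    ring

/-- By compactness, finitely many affine minorants suffice up to `ε`. -/
theorem exists_finset_affine {S K : Set (Fin n → ℝ)} {f : (Fin n → ℝ) → ℝ}
    (hf : ContinuousOn f S) (hconv : ConvexOn ℝ S f) (hK : IsCompact K) (hKS : K ⊆ S) {ε : ℝ}
    (hε : 0 < ε) : ∃ t : Finset ((Fin n → ℝ) × ℝ), (∀ q ∈ t, ∀ z ∈ S, affine q z ≤ f z) ∧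
      ∀ s ∈ K, ∃ q ∈ t, f s - ε < affine q s := by
  classical
  refine hK.induction_on (p := fun V => ∃ t : Finset ((Fin n → ℝ) × ℝ),
    (∀ q ∈ t, ∀ z ∈ S, affine q z ≤ f z) ∧ ∀ s ∈ V, ∃ q ∈ t, f s - ε < affine q s)
    ⟨∅, by simp, by simp⟩ ?_ ?_ ?_
  · rintro V W hVW ⟨t, h1, h2⟩
    exact ⟨t, h1, fun s hs => h2 s (hVW hs)⟩
  · rintro V W ⟨t, h1, h2⟩ ⟨t', h1', h2'⟩
    refine ⟨t ∪ t', fun q hq => ?_, fun s hs => ?_⟩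
    · rcases Finset.mem_union.mp hq with h | h
      · exact h1 q h
      · exact h1' q h
    · rcases hs with h | h
      · obtain ⟨q, hq, h3⟩ := h2 s h
        exact ⟨q, Finset.mem_union_left _ hq, h3⟩
      · obtain ⟨q, hq, h3⟩ := h2' s h
        exact ⟨q, Finset.mem_union_right _ hq, h3⟩
  · intro s hs
    obtain ⟨q, hq1, hq2⟩ := exists_affine_minorant hf hconv (hKS hs) (half_pos hε)
    refine ⟨{z | f z - ε < affine q z}, ?_, {q}, by simpa using hq1, fun z hz => ⟨q, by simp, hz⟩⟩
    have h1 : Tendsto (fun z => f z - ε) (𝓝[K] s) (𝓝 (f s - ε)) :=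
      ((hf.mono hKS) s hs).sub_const ε
    have h2 : Tendsto (affine q) (𝓝[K] s) (𝓝 (affine q s)) :=
      (continuous_affine q).continuousWithinAt
    exact h1.eventually_lt h2 (by linarith)

end Affine

/-! ### The functional calculus of an abelian tuple -/

section Calculus

variable {B : Type*} [CStarAlgebra B] {n : ℕ}

theorem isClosed_generated (x : Fin n → B) : IsClosed (generated x : Set B) :=
  StarSubalgebra.isClosed_topologicalClosure _

theorem IsAbelianTuple.mul_comm_generated {x : Fin n → B} (hx : IsAbelianTuple x)
    (a b : generated x) : a * b = b * a := by
  have h1 : IsMulCommutative (StarAlgebra.adjoin ℂ (Set.range x)) := by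
    refine StarAlgebra.isMulCommutative_adjoin ℂ ?_ ?_
    · rintro _ ⟨i, rfl⟩ _ ⟨j, rfl⟩
      exact hx.2 i j
    · rintro _ ⟨i, rfl⟩ _ ⟨j, rfl⟩
      rw [(hx.1 j).star_eq]
      exact hx.2 i j
  exact (StarSubalgebra.commRingTopologicalClosure _ fun a b => h1.is_comm.comm a b).mul_comm a b

theorem IsAbelianTuple.commute_of_mem {x : Fin n → B} (hx : IsAbelianTuple x) {a b : B}
    (ha : a ∈ generated x) (hb : b ∈ generated x) : a * b = b * a :=
  congrArg Subtype.val (hx.mul_comm_generated ⟨a, ha⟩ ⟨b, hb⟩)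

/-- The C*-algebra generated by an abelian tuple is commutative. -/
noncomputable abbrev IsAbelianTuple.commCStarAlgebra {x : Fin n → B} (hx : IsAbelianTuple x) :
    CommCStarAlgebra (generated x) :=
  { StarSubalgebra.cstarAlgebra (generated x) (h_closed := isClosed_generated x) with
    mul_comm := hx.mul_comm_generated }

theorem isCompact_characterSpace (x : Fin n → B) :
    CompactSpace (WeakDual.characterSpace ℂ (generated x)) := by
  let _ := StarSubalgebra.cstarAlgebra (generated x) (h_closed := isClosed_generated x)
  infer_instance

theorem continuous_jointPoint (x : Fin n → B) : Continuous (jointPoint x) := by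
  refine continuous_pi fun i => Complex.continuous_re.comp ?_
  exact (WeakDual.eval_continuous _).comp continuous_subtype_val

theorem IsAbelianTuple.exists_gelfand {x : Fin n → B} (hx : IsAbelianTuple x)
    (h : C(WeakDual.characterSpace ℂ (generated x), ℂ)) : ∃ z : generated x, ∀ χ, χ z = h χ := by
  let _ := hx.commCStarAlgebra
  refine ⟨(gelfandStarTransform (generated x)).symm h, fun χ => ?_⟩
  have := (gelfandStarTransform (generated x)).apply_symm_apply h
  exact DFunLike.congr_fun this χ

theorem IsAbelianTuple.norm_le_of_forall {x : Fin n → B} (hx : IsAbelianTuple x)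
    {z : generated x} {C : ℝ} (hC : 0 ≤ C)
    (h : ∀ χ : WeakDual.characterSpace ℂ (generated x), ‖χ z‖ ≤ C) : ‖(z : B)‖ ≤ C := by
  let _ := hx.commCStarAlgebra
  have h1 : ‖WeakDual.gelfandTransform ℂ (generated x) z‖ = ‖z‖ :=
    (AddMonoidHomClass.isometry_iff_norm _).mp (gelfandTransform_isometry (generated x)) z
  change ‖z‖ ≤ C
  rw [← h1, ContinuousMap.norm_le _ hC]
  exact h

theorem apply_star (x : Fin n → B) (χ : WeakDual.characterSpace ℂ (generated x))
    (z : generated x) : χ (star z) = star (χ z) := by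
  let _ := StarSubalgebra.cstarAlgebra (generated x) (h_closed := isClosed_generated x)
  exact map_star χ z

theorem IsAbelianTuple.eq_of_forall {x : Fin n → B} (hx : IsAbelianTuple x) {z w : generated x}
    (h : ∀ χ : WeakDual.characterSpace ℂ (generated x), χ z = χ w) : z = w := by
  have := hx.norm_le_of_forall (z := z - w) le_rfl
    (fun χ => by rw [map_sub, h, sub_self, norm_zero])
  have h2 : ((z - w : generated x) : B) = 0 := norm_le_zero_iff.mp this
  exact sub_eq_zero.mp (Subtype.ext h2)

theorem coe_re_apply {x : Fin n → B} (hx : IsAbelianTuple x)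
    (χ : WeakDual.characterSpace ℂ (generated x)) (i : Fin n) :
    χ ⟨x i, mem_generated x i⟩ = (jointPoint x χ i : ℂ) := by
  have h1 : star (⟨x i, mem_generated x i⟩ : generated x) = ⟨x i, mem_generated x i⟩ :=
    Subtype.ext (hx.1 i)
  have h2 := apply_star x χ ⟨x i, mem_generated x i⟩
  rw [h1] at h2
  exact (Complex.conj_eq_iff_re.mp h2.symm).symm

theorem jointPoint_mem_spectrum {x : Fin n → B} (hx : IsAbelianTuple x)
    (χ : WeakDual.characterSpace ℂ (generated x)) (i : Fin n) :
    jointPoint x χ i ∈ spectrum ℝ (x i) := by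
  let _ := StarSubalgebra.cstarAlgebra (generated x) (h_closed := isClosed_generated x)
  have h1 : χ ⟨x i, mem_generated x i⟩ ∈ spectrum ℂ (⟨x i, mem_generated x i⟩ : generated x) :=
    AlgHom.apply_mem_spectrum χ _
  rw [StarSubalgebra.spectrum_eq (hS := isClosed_generated x), coe_re_apply hx] at h1
  exact spectrum.of_algebraMap_mem ℂ h1

/-- The joint spectrum of a tuple. -/
def jointSpectrum (x : Fin n → B) : Set (Fin n → ℝ) := Set.range (jointPoint x)

theorem isCompact_jointSpectrum (x : Fin n → B) : IsCompact (jointSpectrum x) := by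
  have := isCompact_characterSpace x
  exact isCompact_range (continuous_jointPoint x)

theorem IsAbelianTuple.exists_isCalculus {x : Fin n → B} (hx : IsAbelianTuple x)
    {f : (Fin n → ℝ) → ℝ} (hf : ContinuousOn f (jointSpectrum x)) :
    ∃ z : generated x, IsCalculus x f z := by
  have h1 : Continuous fun χ => f (jointPoint x χ) := by
    rw [← continuousOn_univ]
    exact hf.comp (continuous_jointPoint x).continuousOn fun χ _ => ⟨χ, rfl⟩
  exact hx.exists_gelfand ⟨fun χ => (f (jointPoint x χ) : ℂ), Complex.continuous_ofReal.comp h1⟩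

theorem IsAbelianTuple.calculus_eq {x : Fin n → B} (hx : IsAbelianTuple x)
    {f : (Fin n → ℝ) → ℝ} {z : generated x} (hz : IsCalculus x f z) : calculus x f = z := by
  have h : ∃ z : generated x, IsCalculus x f z := ⟨z, hz⟩
  rw [calculus, dif_pos h]
  have h1 := h.choose_spec
  exact congrArg Subtype.val (hx.eq_of_forall fun χ => by rw [h1 χ, hz χ])

theorem calculus_mem (x : Fin n → B) (f : (Fin n → ℝ) → ℝ) : calculus x f ∈ generated x := by
  unfold calculus
  split_ifs with h
  · exact h.choose.2
  · exact zero_mem _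

variable {x : Fin n → B} {f g : (Fin n → ℝ) → ℝ}

theorem IsAbelianTuple.calculus_spec (hx : IsAbelianTuple x)
    (hf : ContinuousOn f (jointSpectrum x)) :
    IsCalculus x f ⟨calculus x f, calculus_mem x f⟩ := by
  obtain ⟨z, hz⟩ := hx.exists_isCalculus hf
  have : (⟨calculus x f, calculus_mem x f⟩ : generated x) = z := Subtype.ext (hx.calculus_eq hz)
  rwa [this]

theorem IsAbelianTuple.calculus_congr (hx : IsAbelianTuple x)
    (hf : ContinuousOn f (jointSpectrum x)) (h : ∀ s ∈ jointSpectrum x, f s = g s) :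
    calculus x f = calculus x g := by
  symm
  exact hx.calculus_eq (z := ⟨calculus x f, calculus_mem x f⟩) fun χ => by
    rw [hx.calculus_spec hf χ, h _ ⟨χ, rfl⟩]

theorem IsAbelianTuple.calculus_add (hx : IsAbelianTuple x)
    (hf : ContinuousOn f (jointSpectrum x)) (hg : ContinuousOn g (jointSpectrum x)) :
    calculus x (fun s => f s + g s) = calculus x f + calculus x g :=
  hx.calculus_eq (z := ⟨calculus x f, calculus_mem x f⟩ + ⟨calculus x g, calculus_mem x g⟩)
    fun χ => by rw [map_add, hx.calculus_spec hf χ, hx.calculus_spec hg χ]; push_cast; rfl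

theorem IsAbelianTuple.calculus_sub (hx : IsAbelianTuple x)
    (hf : ContinuousOn f (jointSpectrum x)) (hg : ContinuousOn g (jointSpectrum x)) :
    calculus x (fun s => f s - g s) = calculus x f - calculus x g :=
  hx.calculus_eq (z := ⟨calculus x f, calculus_mem x f⟩ - ⟨calculus x g, calculus_mem x g⟩)
    fun χ => by rw [map_sub, hx.calculus_spec hf χ, hx.calculus_spec hg χ]; push_cast; rfl

theorem IsAbelianTuple.calculus_mul (hx : IsAbelianTuple x)
    (hf : ContinuousOn f (jointSpectrum x)) (hg : ContinuousOn g (jointSpectrum x)) :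
    calculus x (fun s => f s * g s) = calculus x f * calculus x g :=
  hx.calculus_eq (z := ⟨calculus x f, calculus_mem x f⟩ * ⟨calculus x g, calculus_mem x g⟩)
    fun χ => by rw [map_mul, hx.calculus_spec hf χ, hx.calculus_spec hg χ]; push_cast; rfl

theorem IsAbelianTuple.calculus_const (hx : IsAbelianTuple x) (c : ℝ) :
    calculus x (fun _ => c) = (c : ℂ) • (1 : B) :=
  hx.calculus_eq (z := (c : ℂ) • (1 : generated x)) fun χ => by
    rw [map_smul, map_one, smul_eq_mul, mul_one]

theorem IsAbelianTuple.calculus_coord (hx : IsAbelianTuple x) (i : Fin n) :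
    calculus x (fun s => s i) = x i :=
  hx.calculus_eq (z := ⟨x i, mem_generated x i⟩) fun χ => coe_re_apply hx χ i

theorem IsAbelianTuple.calculus_sum (hx : IsAbelianTuple x) {ι : Type*} (t : Finset ι)
    (h : ι → (Fin n → ℝ) → ℝ) (hh : ∀ k ∈ t, ContinuousOn (h k) (jointSpectrum x)) :
    calculus x (fun s => ∑ k ∈ t, h k s) = ∑ k ∈ t, calculus x (h k) := by
  classical
  induction t using Finset.induction_on with
  | empty =>
    simp only [Finset.sum_empty]
    rw [hx.calculus_const 0]
    simp
  | insert a t ha ih =>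
    simp only [Finset.sum_insert ha]
    rw [hx.calculus_add (hh a (Finset.mem_insert_self a t))
      (continuousOn_finsetSum _ fun k hk => hh k (Finset.mem_insert_of_mem hk)),
      ih fun k hk => hh k (Finset.mem_insert_of_mem hk)]

/-- The value `∑ pᵢ xᵢ + c` of an affine function at a tuple. -/
noncomputable def affineValue (q : (Fin n → ℝ) × ℝ) (x : Fin n → B) : B :=
  ∑ i, (q.1 i : ℂ) • x i + (q.2 : ℂ) • 1

theorem IsAbelianTuple.calculus_affine (hx : IsAbelianTuple x) (q : (Fin n → ℝ) × ℝ) :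
    calculus x (affine q) = affineValue q x := by
  unfold affineValue
  have h1 : ∀ i, calculus x (fun s => q.1 i * s i) = (q.1 i : ℂ) • x i := fun i => by
    rw [hx.calculus_mul (f := fun _ => q.1 i) (g := fun s => s i) continuousOn_const
      (continuous_apply i).continuousOn, hx.calculus_const, hx.calculus_coord, smul_mul_assoc,
      one_mul]
  have h2 := hx.calculus_add (f := fun s => ∑ i, q.1 i * s i) (g := fun _ => q.2)
    (Continuous.continuousOn (by fun_prop)) continuousOn_const
  refine h2.trans ?_
  rw [hx.calculus_const, hx.calculus_sum Finset.univ (fun i s => q.1 i * s i)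
    fun i _ => Continuous.continuousOn (by fun_prop)]
  simp only [h1]

theorem IsAbelianTuple.star_calculus (hx : IsAbelianTuple x)
    (hf : ContinuousOn f (jointSpectrum x)) : star (calculus x f) = calculus x f := by
  symm
  exact hx.calculus_eq (z := star ⟨calculus x f, calculus_mem x f⟩) fun χ => by
    rw [apply_star, hx.calculus_spec hf χ, Complex.star_def, Complex.conj_ofReal]

theorem IsAbelianTuple.norm_calculus_le (hx : IsAbelianTuple x)
    (hf : ContinuousOn f (jointSpectrum x)) {C : ℝ} (hC : 0 ≤ C)
    (h : ∀ s ∈ jointSpectrum x, |f s| ≤ C) : ‖calculus x f‖ ≤ C :=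
  hx.norm_le_of_forall (z := ⟨calculus x f, calculus_mem x f⟩) hC fun χ => by
    rw [hx.calculus_spec hf χ, Complex.norm_real]
    exact h _ ⟨χ, rfl⟩

variable [PartialOrder B] [StarOrderedRing B]

theorem IsAbelianTuple.calculus_nonneg (hx : IsAbelianTuple x)
    (hf : ContinuousOn f (jointSpectrum x)) (h : ∀ s ∈ jointSpectrum x, 0 ≤ f s) :
    0 ≤ calculus x f := by
  have hs : ContinuousOn (fun s => √(f s)) (jointSpectrum x) := hf.sqrt
  have h1 : calculus x f = star (calculus x fun s => √(f s)) * calculus x fun s => √(f s) := by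
    rw [hx.star_calculus hs, ← hx.calculus_mul hs hs]
    exact hx.calculus_congr hf fun s hs => (Real.mul_self_sqrt (h s hs)).symm
  rw [h1]
  exact star_mul_self_nonneg _

theorem IsAbelianTuple.calculus_mono (hx : IsAbelianTuple x)
    (hf : ContinuousOn f (jointSpectrum x)) (hg : ContinuousOn g (jointSpectrum x))
    (h : ∀ s ∈ jointSpectrum x, f s ≤ g s) : calculus x f ≤ calculus x g := by
  rw [← sub_nonneg, ← hx.calculus_sub hg hf]
  exact hx.calculus_nonneg (hg.sub hf) fun s hs => sub_nonneg.mpr (h s hs)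

omit [PartialOrder B] [StarOrderedRing B] in
/-- Closed conditions on the C*-algebra generated by a self-adjoint tuple need only be checked on
polynomials in the tuple. -/
theorem generated_induction (hx : ∀ i, IsSelfAdjoint (x i)) {P : B → Prop}
    (hP : IsClosed {b | P b}) (mem : ∀ i, P (x i)) (const : ∀ c : ℂ, P (algebraMap ℂ B c))
    (add : ∀ a b, a ∈ generated x → b ∈ generated x → P a → P b → P (a + b))
    (mul : ∀ a b, a ∈ generated x → b ∈ generated x → P a → P b → P (a * b)) {b : B}
    (hb : b ∈ generated x) : P b := by
  have hle : ∀ b ∈ StarAlgebra.adjoin ℂ (Set.range x), b ∈ generated x := fun b hb =>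
    StarSubalgebra.le_topologicalClosure _ hb
  have h1 : ∀ b ∈ StarAlgebra.adjoin ℂ (Set.range x), P b := by
    intro b hb
    have hstar : star (Set.range x) = Set.range x := by
      ext z
      constructor
      · rintro ⟨i, hi⟩
        exact ⟨i, by rw [← (hx i).star_eq, hi, star_star]⟩
      · rintro ⟨i, rfl⟩
        exact ⟨i, ((hx i).star_eq).symm⟩
    have hadj : ∀ b, b ∈ StarAlgebra.adjoin ℂ (Set.range x) ↔
        b ∈ Algebra.adjoin ℂ (Set.range x) := by
      intro b
      rw [← StarSubalgebra.mem_toSubalgebra, StarAlgebra.adjoin_toSubalgebra, hstar,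
        Set.union_self]
    rw [hadj] at hb
    induction hb using Algebra.adjoin_induction with
    | mem b hb => obtain ⟨i, rfl⟩ := hb; exact mem i
    | algebraMap c => exact const c
    | add a b ha hb h1 h2 =>
      exact add a b (hle a ((hadj a).mpr ha)) (hle b ((hadj b).mpr hb)) h1 h2
    | mul a b ha hb h1 h2 =>
      exact mul a b (hle a ((hadj a).mpr ha)) (hle b ((hadj b).mpr hb)) h1 h2
  have hb' : b ∈ closure (StarAlgebra.adjoin ℂ (Set.range x) : Set B) := by
    rw [← StarSubalgebra.topologicalClosure_coe]
    exact hb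
  exact closure_minimal (s := (StarAlgebra.adjoin ℂ (Set.range x) : Set B)) h1 hP hb'

end Calculus

/-! ### Jensen's inequality for a functional centralized by the tuple -/

section Jensen

variable {B : Type*} [CStarAlgebra B] {n : ℕ} {y : Fin n → B}

/-- The centralizer of a bounded functional is a closed algebra. -/
theorem apply_mul_comm_of_mem_generated {ψ : B →L[ℂ] ℂ} (hy : ∀ i, IsSelfAdjoint (y i))
    (hψ : ∀ i z, ψ (z * y i) = ψ (y i * z)) {b : B} (hb : b ∈ generated y) (z : B) :
    ψ (z * b) = ψ (b * z) := by
  refine generated_induction hy (P := fun b => ∀ z, ψ (z * b) = ψ (b * z)) ?_ hψ ?_ ?_ ?_ hb z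
  · rw [Set.ofPred_forall]
    exact isClosed_iInter fun z => isClosed_eq (by fun_prop) (by fun_prop)
  · intro c z
    rw [Algebra.commutes]
  · intro a b _ _ ha hb z
    rw [mul_add, add_mul, map_add, map_add, ha, hb]
  · intro a b _ _ ha hb z
    rw [← mul_assoc, hb, ← mul_assoc, ha, mul_assoc]

variable [PartialOrder B] [StarOrderedRing B]

/-- Suppose that `F` dominates the values at `y` of all affine minorants of the convex function
`f`.  A partition of unity on the joint spectrum of `y`, subordinate to sets where one of the affine
minorants almost equals `f`, is centralized by `ψ`; therefore it can be split evenly to the two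
sides of `F` inside `ψ`, where it compares `F` with an element close to `f(y)`. -/
theorem apply_calculus_le {ψ : B →L[ℂ] ℂ} (hψ0 : ∀ b, 0 ≤ b → 0 ≤ ψ b) (hy : IsAbelianTuple y)
    (hψ : ∀ i z, ψ (z * y i) = ψ (y i * z)) {S : Set (Fin n → ℝ)} {f : (Fin n → ℝ) → ℝ}
    (hf : ContinuousOn f S) (hconv : ConvexOn ℝ S f) (hS : jointSpectrum y ⊆ S) {F : B}
    (hF : ∀ q, (∀ s ∈ S, affine q s ≤ f s) → affineValue q y ≤ F) :
    ψ (calculus y f) ≤ ψ F := by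
  have hmono : ∀ a b, a ≤ b → ψ a ≤ ψ b := fun a b h => by
    rw [← sub_nonneg, ← map_sub]; exact hψ0 _ (sub_nonneg.mpr h)
  have hfK := hf.mono hS
  have key : ∀ ε : ℝ, 0 < ε → ψ (calculus y f) - ε * ψ 1 ≤ ψ F := by
    intro ε hε
    obtain ⟨t, ht1, ht2⟩ := exists_finset_affine hf hconv (isCompact_jointSpectrum y) hS hε
    let w : (Fin n → ℝ) × ℝ → (Fin n → ℝ) → ℝ := fun q s => max (affine q s - f s + ε) 0
    have hw : ∀ q, ContinuousOn (w q) (jointSpectrum y) := fun q =>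
      ContinuousOn.sup (((continuous_affine q).continuousOn.sub hfK).add continuousOn_const)
        continuousOn_const
    have hw0 : ∀ q s, 0 ≤ w q s := fun q s => le_max_right _ _
    let W : (Fin n → ℝ) → ℝ := fun s => ∑ q ∈ t, w q s
    have hW : ContinuousOn W (jointSpectrum y) := continuousOn_finsetSum _ fun q _ => hw q
    have hWpos : ∀ s ∈ jointSpectrum y, 0 < W s := by
      intro s hs
      obtain ⟨q, hq, hqs⟩ := ht2 s hs
      exact Finset.sum_pos' (fun q _ => hw0 q s) ⟨q, hq, lt_max_of_lt_left (by linarith)⟩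
    let r : (Fin n → ℝ) × ℝ → (Fin n → ℝ) → ℝ := fun q s => √(w q s / W s)
    have hr : ∀ q, ContinuousOn (r q) (jointSpectrum y) := fun q =>
      ((hw q).div hW fun s hs => (hWpos s hs).ne').sqrt
    have hrr : ∀ q, ∀ s ∈ jointSpectrum y, r q s * r q s = w q s / W s := fun q s hs =>
      Real.mul_self_sqrt (div_nonneg (hw0 q s) (hWpos s hs).le)
    have hsum : ∑ q ∈ t, calculus y (r q) * calculus y (r q) = 1 := by
      have h1 : calculus y (fun s => ∑ q ∈ t, r q s * r q s)
          = ∑ q ∈ t, calculus y (r q) * calculus y (r q) := by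
        rw [hy.calculus_sum t (fun q s => r q s * r q s) fun q _ => (hr q).mul (hr q)]
        exact Finset.sum_congr rfl fun q _ => hy.calculus_mul (hr q) (hr q)
      rw [← h1, hy.calculus_congr (f := fun s => ∑ q ∈ t, r q s * r q s) (g := fun _ => 1)
        (continuousOn_finsetSum _ fun q _ => (hr q).mul (hr q)), hy.calculus_const]
      · simp
      · intro s hs
        rw [Finset.sum_congr rfl fun q _ => hrr q s hs, ← Finset.sum_div]
        exact div_self (hWpos s hs).ne'
    have hconj : ∀ (q) (b : B), ψ (calculus y (r q) * b * calculus y (r q))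
        = ψ (b * (calculus y (r q) * calculus y (r q))) := by
      intro q b
      rw [mul_assoc, ← apply_mul_comm_of_mem_generated hy.1 hψ (calculus_mem y (r q)), mul_assoc]
    have hFsum : ψ F = ∑ q ∈ t, ψ (calculus y (r q) * F * calculus y (r q)) := by
      simp only [hconj]
      rw [← map_sum, ← Finset.mul_sum, hsum, mul_one]
    have hlow : calculus y (fun s => f s - ε)
        ≤ ∑ q ∈ t, calculus y (r q) * affineValue q y * calculus y (r q) := by
      have h1 : ∀ q, calculus y (r q) * affineValue q y * calculus y (r q)
          = calculus y (fun s => r q s * affine q s * r q s) := by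
        intro q
        rw [hy.calculus_mul (f := fun s => r q s * affine q s)
          ((hr q).mul (continuous_affine q).continuousOn) (hr q),
          hy.calculus_mul (hr q) (continuous_affine q).continuousOn, hy.calculus_affine]
      have hc : ∀ q, ContinuousOn (fun s => r q s * affine q s * r q s) (jointSpectrum y) :=
        fun q => ((hr q).mul (continuous_affine q).continuousOn).mul (hr q)
      simp only [h1]
      rw [← hy.calculus_sum t (fun q s => r q s * affine q s * r q s) fun q _ => hc q]
      refine hy.calculus_mono (hfK.sub continuousOn_const)
        (continuousOn_finsetSum _ fun q _ => hc q) fun s hs => ?_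
      have h2 : ∀ q ∈ t, (w q s / W s) * (f s - ε) ≤ r q s * affine q s * r q s := by
        intro q _
        rw [mul_right_comm, hrr q s hs]
        rcases (hw0 q s).eq_or_lt with h | h
        · rw [← h]; simp
        · have h3 : 0 < affine q s - f s + ε := by
            by_contra hneg
            exact h.ne' (max_eq_right (not_lt.mp hneg))
          exact mul_le_mul_of_nonneg_left (by linarith) (div_nonneg (hw0 q s) (hWpos s hs).le)
      refine le_trans (le_of_eq ?_) (Finset.sum_le_sum h2)
      rw [← Finset.sum_mul, ← Finset.sum_div]
      change f s - ε = W s / W s * (f s - ε)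
      rw [div_self (hWpos s hs).ne', one_mul]
    have hsub : calculus y (fun s => f s - ε) = calculus y f - (ε : ℂ) • (1 : B) := by
      rw [hy.calculus_sub hfK continuousOn_const, hy.calculus_const]
    calc ψ (calculus y f) - ε * ψ 1 = ψ (calculus y fun s => f s - ε) := by
          rw [hsub, map_sub, map_smul, smul_eq_mul]
      _ ≤ ψ (∑ q ∈ t, calculus y (r q) * affineValue q y * calculus y (r q)) := hmono _ _ hlow
      _ = ∑ q ∈ t, ψ (calculus y (r q) * affineValue q y * calculus y (r q)) := map_sum _ _ _
      _ ≤ ∑ q ∈ t, ψ (calculus y (r q) * F * calculus y (r q)) := by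
          refine Finset.sum_le_sum fun q hq => hmono _ _ ?_
          have hsa : IsSelfAdjoint (calculus y (r q)) := hy.star_calculus (hr q)
          exact hsa.conjugate_le_conjugate (hF q (ht1 q hq))
      _ = ψ F := hFsum.symm
  have hlim : Tendsto (fun ε : ℝ => ψ (calculus y f) - ε * ψ 1) (𝓝[>] 0)
      (𝓝 (ψ (calculus y f))) := by
    have : Tendsto (fun ε : ℝ => ψ (calculus y f) - ε * ψ 1) (𝓝 0)
        (𝓝 (ψ (calculus y f) - (0 : ℝ) * ψ 1)) :=
      Continuous.tendsto (by fun_prop) 0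
    rw [Complex.ofReal_zero, zero_mul, sub_zero] at this
    exact this.mono_left nhdsWithin_le_nhds
  exact le_of_tendsto hlim (eventually_nhdsWithin_of_forall fun ε hε => key ε hε)

end Jensen

/-! ### Weakly measurable functions and countable approximate units -/

section Separable

open TopologicalSpace

theorem exists_separating_sequence (E : Type*) [NormedAddCommGroup E] [NormedSpace ℂ E]
    [SeparableSpace E] :
    ∃ ψ : ℕ → E →L[ℂ] ℂ, ∀ x, (∀ l, ψ l x = 0) → x = 0 := by
  choose ψ hψ1 hψ2 using fun l => exists_dual_vector'' ℂ (denseSeq E l)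
  refine ⟨ψ, fun x hx => ?_⟩
  by_contra hne
  obtain ⟨l, hl⟩ := (denseRange_denseSeq E).exists_dist_lt x
    (ε := ‖x‖ / 2) (half_pos (norm_pos_iff.mpr hne))
  rw [dist_comm, dist_eq_norm] at hl
  have h1 : ‖denseSeq E l‖ ≤ ‖denseSeq E l - x‖ := by
    have h2 := (ψ l).le_of_opNorm_le (hψ1 l) (denseSeq E l - x)
    rw [map_sub, hx, sub_zero, one_mul, hψ2] at h2
    simpa using h2
  have h3 := norm_sub_norm_le x (denseSeq E l)
  rw [norm_sub_rev] at h3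
  linarith

/-- Pettis' theorem in a separable space: a countable separating family of functionals embeds the
space as a Borel subset of `ℂ^ℕ`. -/
theorem aestronglyMeasurable_of_forall_dual {E : Type*} [NormedAddCommGroup E] [NormedSpace ℂ E]
    [CompleteSpace E] [SeparableSpace E] {T : Type*} [MeasurableSpace T] {μ : Measure T}
    {g : T → E} (h : ∀ φ : E →L[ℂ] ℂ, AEStronglyMeasurable (fun t => φ (g t)) μ) :
    AEStronglyMeasurable g μ := by
  borelize E
  have : SecondCountableTopology E := UniformSpace.secondCountable_of_separable E
  obtain ⟨ψ, hψ⟩ := exists_separating_sequence E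
  have hc : Continuous fun (x : E) (l : ℕ) => ψ l x :=
    continuous_pi fun l => (ψ l).continuous
  have hi : Function.Injective fun (x : E) (l : ℕ) => ψ l x := by
    intro x y hxy
    rw [← sub_eq_zero]
    refine hψ _ fun l => ?_
    rw [map_sub, sub_eq_zero]
    exact congrFun hxy l
  have h1 : AEMeasurable ((fun (x : E) (l : ℕ) => ψ l x) ∘ g) μ :=
    aemeasurable_pi_iff.mpr fun l => (h (ψ l)).aemeasurable
  exact ((hc.measurableEmbedding hi).aemeasurable_comp_iff.mp h1).aestronglyMeasurable

variable (A : Type*) [NonUnitalCStarAlgebra A] [PartialOrder A] [StarOrderedRing A]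

/-- A separable C*-algebra has an approximate unit that is a sequence. -/
theorem exists_sequence_approximateUnit [SeparableSpace A] :
    ∃ u : ℕ → A, (∀ n, 0 ≤ u n) ∧ (∀ n, ‖u n‖ ≤ 1) ∧
      (map u atTop).IsIncreasingApproximateUnit := by
  have hl := CStarAlgebra.increasingApproximateUnit A
  have := hl.neBot
  set D := denseSeq A
  have hex : ∀ n : ℕ, ∃ u : A, 0 ≤ u ∧ ‖u‖ ≤ 1 ∧
      ∀ k ∈ Finset.range (n + 1), ‖D k * u - D k‖ < 1 / ((n : ℝ) + 1) ∧
        ‖u * D k - D k‖ < 1 / ((n : ℝ) + 1) := by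
    intro n
    have h : ∀ᶠ u in CStarAlgebra.approximateUnit A,
        ∀ k ∈ Finset.range (n + 1), ‖D k * u - D k‖ < 1 / ((n : ℝ) + 1) ∧
        ‖u * D k - D k‖ < 1 / ((n : ℝ) + 1) := by
      rw [eventually_all_finset]
      intro k _
      have h0 : (0 : ℝ) < 1 / ((n : ℝ) + 1) := by positivity
      filter_upwards [Metric.tendsto_nhds.mp (hl.tendsto_mul_left (D k)) _ h0,
        Metric.tendsto_nhds.mp (hl.tendsto_mul_right (D k)) _ h0] with u h1 h2
      rw [dist_eq_norm] at h1 h2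
      exact ⟨h1, h2⟩
    obtain ⟨u, h1, h2, h3⟩ := (hl.eventually_nonneg.and (hl.eventually_norm.and h)).exists
    exact ⟨u, h1, h2, h3⟩
  choose u hu0 hu1 hu using hex
  have key : ∀ m : A, ∀ ε > 0, ∀ᶠ n in atTop, ‖m * u n - m‖ < ε ∧ ‖u n * m - m‖ < ε := by
    intro m ε hε
    obtain ⟨k, hk⟩ := (denseRange_denseSeq A).exists_dist_lt m (ε := ε / 3) (by positivity)
    rw [dist_eq_norm] at hk
    obtain ⟨N, hN⟩ := exists_nat_one_div_lt (show (0 : ℝ) < ε / 3 by positivity)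
    filter_upwards [eventually_ge_atTop (max k N)] with n hn
    have h1 := hu n k (Finset.mem_range.mpr (by omega))
    have h2 : 1 / ((n : ℝ) + 1) ≤ 1 / ((N : ℝ) + 1) := by
      have : (N : ℝ) ≤ n := by exact_mod_cast le_trans (le_max_right _ _) hn
      gcongr
    have e1 : m * u n - m = (m - D k) * u n + (D k * u n - D k) - (m - D k) := by
      rw [sub_mul]; abel
    have e2 : u n * m - m = u n * (m - D k) + (u n * D k - D k) - (m - D k) := by
      rw [mul_sub]; abel
    have h3 : ‖(m - D k) * u n‖ ≤ ‖m - D k‖ :=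
      (norm_mul_le _ _).trans (mul_le_of_le_one_right (norm_nonneg _) (hu1 n))
    have h4 : ‖u n * (m - D k)‖ ≤ ‖m - D k‖ :=
      (norm_mul_le _ _).trans (mul_le_of_le_one_left (norm_nonneg _) (hu1 n))
    constructor
    · rw [e1]
      have := norm_sub_le ((m - D k) * u n + (D k * u n - D k)) (m - D k)
      have := norm_add_le ((m - D k) * u n) (D k * u n - D k)
      change ‖m - D k‖ < _ at hk
      linarith [h1.1]
    · rw [e2]
      have := norm_sub_le (u n * (m - D k) + (u n * D k - D k)) (m - D k)
      have := norm_add_le (u n * (m - D k)) (u n * D k - D k)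
      change ‖m - D k‖ < _ at hk
      linarith [h1.2]
  refine ⟨u, hu0, hu1, ⟨⟨fun m => ?_, fun m => ?_⟩, eventually_map.mpr (Eventually.of_forall hu0),
    eventually_map.mpr (Eventually.of_forall hu1)⟩⟩
  · exact tendsto_map'_iff.mpr (Metric.tendsto_nhds.mpr fun ε hε => by
      filter_upwards [key m ε hε] with n hn
      rw [Function.comp_apply, dist_eq_norm]; exact hn.1)
  · exact tendsto_map'_iff.mpr (Metric.tendsto_nhds.mpr fun ε hε => by
      filter_upwards [key m ε hε] with n hn
      rw [Function.comp_apply, dist_eq_norm]; exact hn.2)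

end Separable

/-! ### Strictly measurable fields -/

section StrictlyMeasurable

open TopologicalSpace

variable {A : Type*} [NonUnitalCStarAlgebra A]
variable {T : Type*} [MeasurableSpace T] {μ : Measure T} {b c : T → 𝓜(ℂ, A)}

/-- Measurability of a field of multipliers in the left strict topology.  For separable `A` it is
equivalent to weak* measurability. -/
def StrictlyMeasurable (μ : Measure T) (b : T → 𝓜(ℂ, A)) : Prop :=
  ∀ d : A, AEStronglyMeasurable (fun t => (b t).fst d) μ

theorem StrictlyMeasurable.add (h : StrictlyMeasurable μ b)
    (hc : StrictlyMeasurable μ c) : StrictlyMeasurable μ fun t => b t + c t := fun d =>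
  (h d).add (hc d)

theorem StrictlyMeasurable.smul (h : StrictlyMeasurable μ b) {θ : T → ℂ}
    (hθ : AEStronglyMeasurable θ μ) : StrictlyMeasurable μ fun t => θ t • b t := fun d =>
  hθ.smul (h d)

theorem strictlyMeasurable_const (m : 𝓜(ℂ, A)) : StrictlyMeasurable μ fun _ : T => m := fun _ =>
  aestronglyMeasurable_const

theorem strictlyMeasurable_of_tendsto {b' : ℕ → T → 𝓜(ℂ, A)}
    (h : ∀ k, StrictlyMeasurable μ (b' k))
    (hlim : ∀ t, Tendsto (fun k => b' k t) atTop (𝓝 (b t))) : StrictlyMeasurable μ b := fun d => by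
  refine aestronglyMeasurable_of_tendsto_ae atTop (fun k => h k d)
    (Eventually.of_forall fun t => ?_)
  have h1 := hlim t
  rw [tendsto_iff_norm_sub_tendsto_zero] at h1 ⊢
  refine squeeze_zero (fun _ => norm_nonneg _)
    (fun k => norm_fst_apply_le (b' k t - b t) d) ?_
  simpa using h1.mul_const ‖d‖

variable [PartialOrder A] [StarOrderedRing A]

theorem WeakStarMeasurable.strictlyMeasurable [SeparableSpace A] (h : WeakStarMeasurable μ b) :
    StrictlyMeasurable μ b := fun d =>
  aestronglyMeasurable_of_forall_dual fun φ => by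
    simpa only [extend_rightFunctional] using h (rightFunctional φ d)

theorem StrictlyMeasurable.weakStarMeasurable [SeparableSpace A] (h : StrictlyMeasurable μ b) :
    WeakStarMeasurable μ b := by
  obtain ⟨u, -, -, hu⟩ := exists_sequence_approximateUnit A
  intro φ
  exact aestronglyMeasurable_of_tendsto_ae atTop
    (fun n => φ.continuous.comp_aestronglyMeasurable (h (u n)))
    (Eventually.of_forall fun t => tendsto_extend hu φ (b t))

theorem WeakStarMeasurable.star (h : WeakStarMeasurable μ b) :
    WeakStarMeasurable μ fun t => star (b t) := fun φ => by
  simp only [extend_star]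
  exact continuous_star.comp_aestronglyMeasurable (h _)

theorem StrictlyMeasurable.star [SeparableSpace A] (h : StrictlyMeasurable μ b) :
    StrictlyMeasurable μ fun t => star (b t) :=
  h.weakStarMeasurable.star.strictlyMeasurable

theorem StrictlyMeasurable.fst_apply [SeparableSpace A] (h : StrictlyMeasurable μ b)
    {g : T → A} (hg : AEStronglyMeasurable g μ) :
    AEStronglyMeasurable (fun t => (b t).fst (g t)) μ := by
  obtain ⟨u, -, -, hu⟩ := exists_sequence_approximateUnit A
  refine aestronglyMeasurable_of_tendsto_ae atTop
    (f := fun n t => Star.star ((Star.star (b t)).fst (Star.star (u n))) * g t) (fun n => ?_)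
    (Eventually.of_forall fun t => ?_)
  · exact (continuous_star.comp_aestronglyMeasurable (h.star _)).mul hg
  · simp only [star_fst_mul, star_star]
    exact hu.tendsto_mul_right _

theorem StrictlyMeasurable.mul [SeparableSpace A] (h : StrictlyMeasurable μ b)
    (hc : StrictlyMeasurable μ c) : StrictlyMeasurable μ fun t => b t * c t := fun d => by
  simpa only [mul_fst_apply] using h.fst_apply (hc d)

end StrictlyMeasurable

/-! ### Cauchy–Schwarz and Dini for C*-algebra valued integrals -/

section CauchySchwarz

variable {A : Type*} [NonUnitalCStarAlgebra A] {T : Type*} [MeasurableSpace T] {ν : Measure T}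

theorem integral_star (g : T → A) : ∫ t, star (g t) ∂ν = star (∫ t, g t ∂ν) :=
  (starL' ℝ : A ≃L[ℝ] A).integral_comp_comm g

theorem integrable_star {g : T → A} (hg : Integrable g ν) : Integrable (fun t => star (g t)) ν :=
  ((starL' ℝ : A ≃L[ℝ] A) : A →L[ℝ] A).integrable_comp hg

theorem integrable_const_mul {g : T → A} (hg : Integrable g ν) (x : A) :
    Integrable (fun t => x * g t) ν :=
  (ContinuousLinearMap.mul ℂ A x).integrable_comp hg

theorem integrable_mul_const {g : T → A} (hg : Integrable g ν) (x : A) :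
    Integrable (fun t => g t * x) ν :=
  ((ContinuousLinearMap.mul ℂ A).flip x).integrable_comp hg

theorem integral_const_mul_of_integrable {g : T → A} (hg : Integrable g ν) (x : A) :
    ∫ t, x * g t ∂ν = x * ∫ t, g t ∂ν :=
  (ContinuousLinearMap.mul ℂ A x).integral_comp_comm hg

theorem integral_mul_const_of_integrable {g : T → A} (hg : Integrable g ν) (x : A) :
    ∫ t, g t * x ∂ν = (∫ t, g t ∂ν) * x :=
  ((ContinuousLinearMap.mul ℂ A).flip x).integral_comp_comm hg

variable [PartialOrder A] [StarOrderedRing A]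

/-- Cauchy–Schwarz for the `A`-valued inner product `∫ u* v`. -/
theorem norm_integral_star_mul_sq_le {u v : T → A}
    (huu : Integrable (fun t => star (u t) * u t) ν)
    (hvv : Integrable (fun t => star (v t) * v t) ν)
    (huv : Integrable (fun t => star (u t) * v t) ν) :
    ‖∫ t, star (u t) * v t ∂ν‖ ^ 2
      ≤ ‖∫ t, star (u t) * u t ∂ν‖ * ‖∫ t, star (v t) * v t ∂ν‖ := by
  set P := ∫ t, star (u t) * u t ∂ν with hP
  set Q := ∫ t, star (v t) * v t ∂ν with hQ
  set W := ∫ t, star (u t) * v t ∂ν with hW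
  have hvu : Integrable (fun t => star (v t) * u t) ν := by
    simpa using integrable_star huv
  have hW' : ∫ t, star (v t) * u t ∂ν = star W := by
    rw [hW, ← integral_star]; simp
  have hPsa : IsSelfAdjoint P := by
    rw [IsSelfAdjoint, hP, ← integral_star]; simp
  have key : ∀ x : A, 0 ≤ star x * P * x - star x * W - star W * x + Q := by
    intro x
    have h1 : 0 ≤ ∫ t, star (u t * x - v t) * (u t * x - v t) ∂ν :=
      integral_nonneg_of_ae (Eventually.of_forall fun t => star_mul_self_nonneg _)
    have i1 : Integrable (fun t => star x * (star (u t) * u t) * x) ν :=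
      integrable_mul_const (integrable_const_mul huu _) _
    have i2 : Integrable (fun t => star x * (star (u t) * v t)) ν := integrable_const_mul huv _
    have i3 : Integrable (fun t => star (v t) * u t * x) ν := integrable_mul_const hvu _
    have i12 : Integrable (fun t => star x * (star (u t) * u t) * x
        - star x * (star (u t) * v t)) ν := i1.sub i2
    have i123 : Integrable (fun t => star x * (star (u t) * u t) * x
        - star x * (star (u t) * v t) - star (v t) * u t * x) ν := i12.sub i3
    have h2 : ∀ t, star (u t * x - v t) * (u t * x - v t) = star x * (star (u t) * u t) * x
        - star x * (star (u t) * v t) - star (v t) * u t * x + star (v t) * v t := by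
      intro t
      simp only [star_sub, star_mul, sub_mul, mul_sub, mul_assoc]
      abel
    simp only [h2] at h1
    rw [integral_add i123 hvv, integral_sub i12 i3, integral_sub i1 i2,
      integral_mul_const_of_integrable (integrable_const_mul huu _),
      integral_const_mul_of_integrable huu,
      integral_const_mul_of_integrable huv, integral_mul_const_of_integrable hvu, hW'] at h1
    exact h1
  have main : ∀ κ : ℝ, ‖P‖ < κ → ‖W‖ ^ 2 ≤ κ * ‖Q‖ := by
    intro κ hκ
    have hκ0 : 0 < κ := (norm_nonneg P).trans_lt hκ
    have h1 := key ((κ⁻¹ : ℝ) • W)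
    have h2 : star ((κ⁻¹ : ℝ) • W) * P * ((κ⁻¹ : ℝ) • W) ≤ (κ⁻¹ : ℝ) • (star W * W) := by
      have h3 : star W * P * W ≤ κ • (star W * W) :=
        (CStarAlgebra.star_left_conjugate_le_norm_smul hPsa).trans
          (smul_le_smul_of_nonneg_right hκ.le (star_mul_self_nonneg W))
      have h4 := smul_le_smul_of_nonneg_left h3 (show 0 ≤ κ⁻¹ * κ⁻¹ by positivity)
      rw [smul_smul, mul_assoc κ⁻¹, inv_mul_cancel₀ hκ0.ne', mul_one] at h4
      convert h4 using 1
      simp only [star_smul, star_trivial, smul_mul_assoc, mul_smul_comm, smul_smul]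
    have h5 : (κ⁻¹ : ℝ) • (star W * W) ≤ Q := by
      have h6 : star ((κ⁻¹ : ℝ) • W) * W = (κ⁻¹ : ℝ) • (star W * W) := by
        simp [smul_mul_assoc]
      have h7 : star W * ((κ⁻¹ : ℝ) • W) = (κ⁻¹ : ℝ) • (star W * W) := by
        simp [mul_smul_comm]
      rw [h6, h7] at h1
      have h8 := add_nonneg h1 (sub_nonneg.mpr h2)
      rw [← sub_nonneg]
      convert h8 using 1
      abel
    have h9 := CStarAlgebra.norm_le_norm_of_nonneg_of_le
      (smul_nonneg (inv_nonneg.mpr hκ0.le) (star_mul_self_nonneg W)) h5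
    rw [norm_smul, CStarRing.norm_star_mul_self, Real.norm_eq_abs,
      abs_of_pos (inv_pos.mpr hκ0), inv_mul_le_iff₀ hκ0] at h9
    linarith [sq ‖W‖]
  refine le_of_forall_pos_le_add fun ε hε => ?_
  have h := main (‖P‖ + ε / (‖Q‖ + 1))
    (by have := norm_nonneg Q; linarith [show 0 < ε / (‖Q‖ + 1) by positivity])
  refine h.trans ?_
  rw [add_mul]
  gcongr
  rw [div_mul_eq_mul_div, div_le_iff₀ (by positivity)]
  nlinarith [norm_nonneg Q]

/-- An increasing sequence that converges weakly to an upper bound converges in norm: by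
Hahn–Banach the limit is in the norm closure of the convex set of elements below some member of
the sequence. -/
theorem tendsto_of_monotone_of_forall_tendsto {H : ℕ → A} (hmono : Monotone H) {x : A}
    (hle : ∀ N, H N ≤ x)
    (hw : ∀ φ : A →L[ℂ] ℂ, Tendsto (fun N => φ (H N)) atTop (𝓝 (φ x))) :
    Tendsto H atTop (𝓝 x) := by
  set S : Set A := {g | ∃ N, g ≤ H N} with hS
  have hconv : Convex ℝ S := by
    rintro g ⟨N, hg⟩ g' ⟨N', hg'⟩ r r' hr hr' hrr
    refine ⟨max N N', ?_⟩
    have h1 := smul_le_smul_of_nonneg_left (hg.trans (hmono (le_max_left N N'))) hr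
    have h2 := smul_le_smul_of_nonneg_left (hg'.trans (hmono (le_max_right N N'))) hr'
    refine (add_le_add h1 h2).trans_eq ?_
    rw [← add_smul, hrr, one_smul]
  have hx : x ∈ closure S := by
    by_contra hx
    obtain ⟨φ, r, h1, h2⟩ := RCLike.geometric_hahn_banach_closed_point (𝕜 := ℂ)
      hconv.closure isClosed_closure hx
    have h3 : Tendsto (fun N => (φ (H N)).re) atTop (𝓝 (φ x).re) :=
      (Complex.continuous_re.tendsto _).comp (hw φ)
    have h4 := le_of_tendsto h3 (Eventually.of_forall fun N =>
      (h1 (H N) (subset_closure ⟨N, le_rfl⟩)).le)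
    exact absurd h2 (not_lt.mpr h4)
  rw [Metric.tendsto_atTop]
  intro ε hε
  obtain ⟨g, ⟨N, hgN⟩, hg⟩ := Metric.mem_closure_iff.mp hx ε hε
  refine ⟨N, fun N' hN' => ?_⟩
  rw [dist_comm, dist_eq_norm] at *
  refine lt_of_le_of_lt (CStarAlgebra.norm_le_norm_of_nonneg_of_le
    (sub_nonneg.mpr (hle N')) (sub_le_sub_left (hgN.trans (hmono hN')) x)) ?_
  rwa [norm_sub_rev]

end CauchySchwarz

/-! ### The exhaustion of a unital column field -/

section Exhaustion

open TopologicalSpace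

theorem norm_le_of_forall_fst {A : Type*} [NonUnitalCStarAlgebra A] {m : 𝓜(ℂ, A)}
    {K : ℝ} (hK : 0 ≤ K) {D : ℕ → A} (hD : DenseRange D)
    (h : ∀ k, ‖m.fst (D k)‖ ≤ K * ‖D k‖) : ‖m‖ ≤ K := by
  rw [← DoubleCentralizer.norm_fst]
  refine ContinuousLinearMap.opNorm_le_bound _ hK fun d => ?_
  exact hD.induction_on (p := fun d => ‖m.fst d‖ ≤ K * ‖d‖) d
    (isClosed_le (by fun_prop) (by fun_prop)) h

variable {A : Type*} [NonUnitalCStarAlgebra A] [PartialOrder A] [StarOrderedRing A]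
variable {T : Type*} [MeasurableSpace T] {μ : Measure T} {a : T → 𝓜(ℂ, A)}

theorem IsUnitalColumnField.integrable (ha : IsUnitalColumnField μ a) (φ : A →L[ℂ] ℂ) (d : A) :
    Integrable (fun t => φ (star ((a t).fst d) * (a t).fst d)) μ := by
  have h := (ha.2.2 (conjFunctional φ (star d) d)).1
  simpa only [extend_conjFunctional, mul_fst_apply, star_fst_mul] using h

theorem IsUnitalColumnField.integral (ha : IsUnitalColumnField μ a) (φ : A →L[ℂ] ℂ) (d : A) :
    ∫ t, φ (star ((a t).fst d) * (a t).fst d) ∂μ = φ (star d * d) := by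
  have h := (ha.2.2 (conjFunctional φ (star d) d)).2
  simpa [extend_conjFunctional, mul_fst_apply, star_fst_mul] using h.symm

/-- A unital column field lives on a countable union of sets of finite measure on which it is
bounded. -/
theorem IsUnitalColumnField.exists_exhaustion [SeparableSpace A] (ha : IsUnitalColumnField μ a) :
    ∃ E : ℕ → Set T, Monotone E ∧ (∀ N, MeasurableSet (E N)) ∧ (∀ N, μ (E N) < ∞) ∧
      (∀ N, ∀ᵐ t ∂μ, t ∈ E N → ‖a t‖ ≤ N) ∧ ∀ᵐ t ∂μ, t ∉ ⋃ N, E N → a t = 0 := by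
  have hs := ha.1.strictlyMeasurable
  set D := denseSeq A with hD
  have hDd : DenseRange D := denseRange_denseSeq A
  obtain ⟨ψ, hψ⟩ := exists_separating_sequence A
  set α : ℕ → T → A := fun k => (hs (D k)).mk with hα
  have hαm : ∀ k, StronglyMeasurable (α k) := fun k => (hs (D k)).stronglyMeasurable_mk
  have hαe : ∀ᵐ t ∂μ, ∀ k, (a t).fst (D k) = α k t :=
    ae_all_iff.mpr fun k => (hs (D k)).ae_eq_mk
  set g : ℕ → T → ℂ := fun j t => ψ j.unpair.1 (star (α j.unpair.2 t) * α j.unpair.2 t) with hg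
  have hgm : ∀ j, StronglyMeasurable (g j) := fun j =>
    (ψ _).continuous.comp_stronglyMeasurable
      ((continuous_star.comp_stronglyMeasurable (hαm _)).mul (hαm _))
  have hgi : ∀ j, Integrable (g j) μ := fun j =>
    (ha.integrable (ψ j.unpair.1) (D j.unpair.2)).congr (by
      filter_upwards [hαe] with t ht
      simp only [hg, ht])
  refine ⟨fun N => (⋃ j ∈ Finset.range (N + 1), {t | 1 / ((N : ℝ) + 1) ≤ ‖g j t‖}) ∩
    ⋂ k, {t | ‖α k t‖ ≤ N * ‖D k‖}, ?_, ?_, ?_, ?_, ?_⟩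
  · intro N N' hNN'
    have hc : (N : ℝ) ≤ N' := by exact_mod_cast hNN'
    refine Set.inter_subset_inter ?_ ?_
    · refine Set.iUnion₂_subset fun j hj => ?_
      have hj' : j ∈ Finset.range (N' + 1) := by
        rw [Finset.mem_range] at hj ⊢; omega
      refine subset_trans (fun t ht => ?_) (Set.subset_iUnion₂ j hj')
      refine le_trans ?_ (Set.mem_ofPred_eq ▸ ht)
      gcongr
    · exact Set.iInter_mono fun k t ht => le_trans (Set.mem_ofPred_eq ▸ ht) (by gcongr)
  · intro N
    refine MeasurableSet.inter (Finset.measurableSet_biUnion _ fun j _ => ?_)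
      (MeasurableSet.iInter fun k => ?_)
    · exact measurableSet_le measurable_const (hgm j).norm.measurable
    · exact measurableSet_le (hαm k).norm.measurable measurable_const
  · intro N
    refine (measure_mono Set.inter_subset_left).trans_lt ?_
    refine (measure_biUnion_finset_le _ _).trans_lt (ENNReal.sum_lt_top.mpr fun j _ => ?_)
    exact (hgi j).measure_norm_ge_lt_top (by positivity)
  · intro N
    filter_upwards [hαe] with t ht hmem
    refine norm_le_of_forall_fst (Nat.cast_nonneg N) hDd fun k => ?_
    rw [ht]
    exact Set.mem_iInter.mp hmem.2 k
  · filter_upwards [hαe] with t ht hmem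
    have h0 : ∀ j, g j t = 0 := by
      intro j
      by_contra hne
      obtain ⟨N₁, hN₁⟩ := exists_nat_one_div_lt (norm_pos_iff.mpr hne)
      obtain ⟨N₂, hN₂⟩ := exists_nat_ge ‖a t‖
      set N := max (max N₁ N₂) j with hN
      refine hmem (Set.mem_iUnion.mpr ⟨N, Set.mem_iUnion₂.mpr ⟨j, ?_, ?_⟩, Set.mem_iInter.mpr
        fun k => ?_⟩)
      · rw [Finset.mem_range]; omega
      · refine le_trans ?_ hN₁.le
        have : (N₁ : ℝ) ≤ N := by exact_mod_cast le_trans (le_max_left _ _) (le_max_left _ _)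
        gcongr
      · change ‖α k t‖ ≤ N * ‖D k‖
        rw [← ht]
        refine (norm_fst_apply_le _ _).trans ?_
        have : (N₂ : ℝ) ≤ N := by exact_mod_cast le_trans (le_max_right _ _) (le_max_left _ _)
        have := hN₂.trans this
        gcongr
    refine norm_le_zero_iff.mp (norm_le_of_forall_fst le_rfl hDd fun k => ?_)
    have h1 : star (α k t) * α k t = 0 := hψ _ fun l => by
      simpa [hg] using h0 (Nat.pair l k)
    rw [CStarRing.star_mul_self_eq_zero_iff] at h1
    simp [ht, h1]

end Exhaustion

/-! ### Compressions of bounded fields by a unital column field -/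

section Compression

open TopologicalSpace

theorem star_mul_mul_fst_apply {A : Type*} [NonUnitalCStarAlgebra A] (m k : 𝓜(ℂ, A)) (w d : A) :
    star w * (star m * k * m).fst d = star (m.fst w) * k.fst (m.fst d) := by
  rw [star_fst_mul, mul_assoc, mul_fst_apply, mul_fst_apply]

variable {A : Type*} [NonUnitalCStarAlgebra A] {T : Type*} [MeasurableSpace T]

theorem StrictlyMeasurable.restrict {μ : Measure T} {b : T → 𝓜(ℂ, A)}
    (h : StrictlyMeasurable μ b) (E : Set T) : StrictlyMeasurable (μ.restrict E) b :=
  fun d => (h d).restrict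

theorem integrable_star_fst_mul_fst {ν : Measure T} [IsFiniteMeasure ν] {p q : T → 𝓜(ℂ, A)}
    {K K' : ℝ}
    (hp : StrictlyMeasurable ν p) (hq : StrictlyMeasurable ν q)
    (hK : ∀ᵐ t ∂ν, ‖p t‖ ≤ K) (hK' : ∀ᵐ t ∂ν, ‖q t‖ ≤ K') (w d : A) :
    Integrable (fun t => star ((p t).fst w) * (q t).fst d) ν := by
  refine Integrable.of_bound ((continuous_star.comp_aestronglyMeasurable (hp w)).mul (hq d))
    (K * ‖w‖ * (K' * ‖d‖)) ?_
  filter_upwards [hK, hK'] with t h1 h2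
  have h3 := (norm_fst_apply_le (p t) w).trans (mul_le_mul_of_nonneg_right h1 (norm_nonneg w))
  have h4 := (norm_fst_apply_le (q t) d).trans (mul_le_mul_of_nonneg_right h2 (norm_nonneg d))
  refine (norm_mul_le _ _).trans ?_
  rw [norm_star]
  exact mul_le_mul h3 h4 (norm_nonneg _) ((norm_nonneg _).trans h3)

theorem integrable_fst {ν : Measure T} [IsFiniteMeasure ν] {p : T → 𝓜(ℂ, A)} {K : ℝ}
    (hp : StrictlyMeasurable ν p) (hK : ∀ᵐ t ∂ν, ‖p t‖ ≤ K) (d : A) :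
    Integrable (fun t => (p t).fst d) ν := by
  refine Integrable.of_bound (hp d) (K * ‖d‖) ?_
  filter_upwards [hK] with t h1
  exact (norm_fst_apply_le _ d).trans (mul_le_mul_of_nonneg_right h1 (norm_nonneg d))

theorem norm_compression_ae_le {ν : Measure T} {a c : T → 𝓜(ℂ, A)} {K C : ℝ}
    (hK : ∀ᵐ t ∂ν, ‖a t‖ ≤ K) (hC : ∀ᵐ t ∂ν, ‖c t‖ ≤ C) :
    ∀ᵐ t ∂ν, ‖star (a t) * c t * a t‖ ≤ K * C * K := by
  filter_upwards [hK, hC] with t h1 h2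
  refine norm_mul₃_le.trans ?_
  rw [norm_star]
  have h0 := norm_nonneg (a t)
  have h0' := norm_nonneg (c t)
  gcongr
  · exact mul_nonneg (h0.trans h1) (h0'.trans h2)
  · exact h0.trans h1

variable [PartialOrder A] [StarOrderedRing A]

theorem star_fst_mul_fst_le (m : 𝓜(ℂ, A)) {C : ℝ} (hm : ‖m‖ ≤ C) (d : A) :
    star (m.fst d) * m.fst d ≤ (C ^ 2) • (star d * d) := by
  have h2 : star (d : 𝓜(ℂ, A)) * (star m * m) * d ≤ ‖star m * m‖ • (star (d : 𝓜(ℂ, A)) * d) :=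
    CStarAlgebra.star_left_conjugate_le_norm_smul (IsSelfAdjoint.star_mul_self m)
  have h3 : ‖star m * m‖ • (star (d : 𝓜(ℂ, A)) * d) ≤ (C ^ 2) • (star (d : 𝓜(ℂ, A)) * d) := by
    refine smul_le_smul_of_nonneg_right ?_ (star_mul_self_nonneg _)
    rw [CStarRing.norm_star_mul_self, ← sq]
    gcongr
  have e1 : ((star (m.fst d) * m.fst d : A) : 𝓜(ℂ, A))
      = star (d : 𝓜(ℂ, A)) * (star m * m) * d := by
    rw [coe_mul, coe_star, ← mul_coe, star_mul]
    simp only [mul_assoc]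
  have e2 : (((C ^ 2) • (star d * d) : A) : 𝓜(ℂ, A))
      = (C ^ 2) • (star (d : 𝓜(ℂ, A)) * d) := by
    rw [← Complex.coe_smul, coe_smul, coe_mul, coe_star, Complex.coe_smul]
  rw [← coe_le_coe_iff, e1, e2]
  exact h2.trans h3

theorem extend_functional_sub (φ ψ : A →L[ℂ] ℂ) (m : 𝓜(ℂ, A)) :
    extend (φ - ψ) m = extend φ m - extend ψ m := by
  refine extend_eq_of_tendsto (CStarAlgebra.increasingApproximateUnit A) ?_
  simpa using (tendsto_extend_approximateUnit φ m).sub (tendsto_extend_approximateUnit ψ m)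

section Finite

variable [SeparableSpace A] {ν : Measure T} [IsFiniteMeasure ν]

variable {a c : T → 𝓜(ℂ, A)} {K C : ℝ}

theorem strictlyMeasurable_compression {ν : Measure T} (hs : StrictlyMeasurable ν a)
    (hc : StrictlyMeasurable ν c) : StrictlyMeasurable ν fun t => star (a t) * c t * a t :=
  (hs.star.mul hc).mul hs

/-- The Cauchy–Schwarz estimate `‖∫ a* c a d‖² ≤ C² ‖∫ (a d)* (a d)‖`, from which the truncated
integrals of `a* c a d` form a Cauchy sequence. -/
theorem norm_integral_compression_sq_le (hs : StrictlyMeasurable ν a)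
    (hK : ∀ᵐ t ∂ν, ‖a t‖ ≤ K) (hc : StrictlyMeasurable ν c) (hC : ∀ᵐ t ∂ν, ‖c t‖ ≤ C)
    (hH : ∀ w : A, ‖∫ t, star ((a t).fst w) * (a t).fst w ∂ν‖ ≤ ‖w‖ ^ 2) (d : A) :
    ‖∫ t, (star (a t) * c t * a t).fst d ∂ν‖ ^ 2
      ≤ C ^ 2 * ‖∫ t, star ((a t).fst d) * (a t).fst d ∂ν‖ := by
  set Z := ∫ t, (star (a t) * c t * a t).fst d ∂ν with hZ
  have hb := integrable_fst (strictlyMeasurable_compression hs hc) (norm_compression_ae_le hK hC) d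
  have hca : StrictlyMeasurable ν fun t => c t * a t := hc.mul hs
  have hcaK : ∀ᵐ t ∂ν, ‖c t * a t‖ ≤ C * K := by
    filter_upwards [hK, hC] with t h1 h2
    exact (norm_mul_le _ _).trans
      (mul_le_mul h2 h1 (norm_nonneg _) ((norm_nonneg _).trans h2))
  have e1 : star Z * Z = ∫ t, star ((a t).fst Z) * (c t * a t).fst d ∂ν := by
    have := integral_const_mul_of_integrable hb (star Z)
    rw [← hZ] at this
    rw [← this]
    refine integral_congr_ae (Eventually.of_forall fun t => ?_)
    simp only [star_mul_mul_fst_apply]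
    rw [mul_fst_apply]
  have i1 := integrable_star_fst_mul_fst hs hs hK hK
  have i2 := integrable_star_fst_mul_fst hca hca hcaK hcaK d d
  have h1 := norm_integral_star_mul_sq_le (i1 Z Z) i2
    (integrable_star_fst_mul_fst hs hca hK hcaK Z d)
  rw [← e1, CStarRing.norm_star_mul_self] at h1
  have h2 : ‖∫ t, star ((c t * a t).fst d) * (c t * a t).fst d ∂ν‖
      ≤ C ^ 2 * ‖∫ t, star ((a t).fst d) * (a t).fst d ∂ν‖ := by
    have h3 : ∫ t, star ((c t * a t).fst d) * (c t * a t).fst d ∂ν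
        ≤ (C ^ 2) • ∫ t, star ((a t).fst d) * (a t).fst d ∂ν := by
      have i3 : Integrable (fun t => (C ^ 2) • (star ((a t).fst d) * (a t).fst d)) ν :=
        (i1 d d).smul (C ^ 2)
      rw [← integral_smul, ← sub_nonneg, ← integral_sub i3 i2]
      refine integral_nonneg_of_ae ?_
      filter_upwards [hC] with t ht
      exact sub_nonneg.mpr (star_fst_mul_fst_le (c t) ht _)
    refine (CStarAlgebra.norm_le_norm_of_nonneg_of_le
      (integral_nonneg_of_ae (Eventually.of_forall fun t => star_mul_self_nonneg _)) h3).trans ?_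
    rw [norm_smul, Real.norm_eq_abs, abs_of_nonneg (sq_nonneg C)]
  rcases (norm_nonneg Z).eq_or_lt with h0 | h0
  · rw [← h0, zero_pow two_ne_zero]
    positivity
  · have h4 : ‖Z‖ ^ 2 * ‖Z‖ ^ 2
        ≤ ‖Z‖ ^ 2 * (C ^ 2 * ‖∫ t, star ((a t).fst d) * (a t).fst d ∂ν‖) :=
      calc ‖Z‖ ^ 2 * ‖Z‖ ^ 2 = (‖Z‖ * ‖Z‖) ^ 2 := by ring
        _ ≤ _ := h1
        _ ≤ _ := mul_le_mul (hH Z) h2 (norm_nonneg _) (sq_nonneg _)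
    exact le_of_mul_le_mul_left h4 (by positivity)

end Finite

section Column

variable {μ : Measure T} {a c : T → 𝓜(ℂ, A)} {C : ℝ}

theorem IsUnitalColumnField.setIntegral_le (ha : IsUnitalColumnField μ a) {E : Set T}
    (hE : MeasurableSet E) {d : A}
    (hi : IntegrableOn (fun t => star ((a t).fst d) * (a t).fst d) E μ) :
    ∫ t in E, star ((a t).fst d) * (a t).fst d ∂μ ≤ star d * d := by
  rw [← sub_nonneg]
  refine nonneg_of_forall_positive ?_ fun φ hφ => ?_
  · refine (IsSelfAdjoint.star_mul_self d).sub ?_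
    rw [IsSelfAdjoint, ← integral_star]
    simp
  · rw [map_sub, ← ha.integral φ d, ← φ.integral_comp_comm hi,
      ← integral_add_compl hE (ha.integrable φ d), add_sub_cancel_left]
    exact integral_nonneg_of_ae (Eventually.of_forall fun t => hφ _ (star_mul_self_nonneg _))

theorem IsUnitalColumnField.norm_setIntegral_le (ha : IsUnitalColumnField μ a) {E : Set T}
    (hE : MeasurableSet E) {d : A}
    (hi : IntegrableOn (fun t => star ((a t).fst d) * (a t).fst d) E μ) :
    ‖∫ t in E, star ((a t).fst d) * (a t).fst d ∂μ‖ ≤ ‖d‖ ^ 2 := by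
  have := CStarAlgebra.norm_le_norm_of_nonneg_of_le
    (integral_nonneg_of_ae (Eventually.of_forall fun t => star_mul_self_nonneg _))
    (ha.setIntegral_le hE hi)
  rwa [CStarRing.norm_star_mul_self, ← sq] at this

/-- The truncated integrals `∫_{E_N} (a d)* (a d)` increase to `d* d` in norm. -/
theorem IsUnitalColumnField.tendsto_setIntegral (ha : IsUnitalColumnField μ a) {E : ℕ → Set T}
    (hE : Monotone E) (hEm : ∀ N, MeasurableSet (E N))
    (h0 : ∀ᵐ t ∂μ, t ∉ ⋃ N, E N → a t = 0) {d : A}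
    (hi : ∀ N, IntegrableOn (fun t => star ((a t).fst d) * (a t).fst d) (E N) μ) :
    Tendsto (fun N => ∫ t in E N, star ((a t).fst d) * (a t).fst d ∂μ) atTop
      (𝓝 (star d * d)) := by
  refine tendsto_of_monotone_of_forall_tendsto (fun N N' hN => ?_)
    (fun N => ha.setIntegral_le (hEm N) (hi N)) fun φ => ?_
  · rw [← sub_nonneg, ← setIntegral_sdiff (hEm N) (hi N') (hE hN)]
    exact integral_nonneg_of_ae (Eventually.of_forall fun t => star_mul_self_nonneg _)
  · have h1 := tendsto_setIntegral_of_monotone hEm hE (ha.integrable φ d).integrableOn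
    rw [setIntegral_eq_integral_of_ae_compl_eq_zero (by
      filter_upwards [h0] with t ht hmem
      simp [ht hmem]), ha.integral φ d] at h1
    refine h1.congr fun N => ?_
    rw [← φ.integral_comp_comm (hi N)]

theorem ae_restrict_of_ae_imp {E : Set T} (hE : MeasurableSet E) {p : T → Prop}
    (h : ∀ᵐ t ∂μ, t ∈ E → p t) : ∀ᵐ t ∂μ.restrict E, p t :=
  (ae_restrict_iff' hE).mpr h

variable [SeparableSpace A]

/-- The bound `∫ |φ (a* c a)| ≤ C ‖φ‖`: multiplying `c` by a measurable phase makes the integrand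
positive, so that the truncations are values of `φ`. -/
theorem IsUnitalColumnField.lintegral_enorm_extend_le (ha : IsUnitalColumnField μ a)
    (hc : StrictlyMeasurable μ c) (hC0 : 0 ≤ C) (hC : ∀ t, ‖c t‖ ≤ C) (φ : A →L[ℂ] ℂ) :
    ∫⁻ t, ‖extend φ (star (a t) * c t * a t)‖ₑ ∂μ ≤ ENNReal.ofReal (C * ‖φ‖) := by
  obtain ⟨u, -, hu1, hu⟩ := exists_sequence_approximateUnit A
  obtain ⟨E, hE, hEm, hEf, hEa, h0⟩ := ha.exists_exhaustion
  have hs := ha.1.strictlyMeasurable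
  have hbm := strictlyMeasurable_compression hs hc
  have hfin : ∀ N, IsFiniteMeasure (μ.restrict (E N)) := fun N =>
    ⟨by rw [Measure.restrict_apply_univ]; exact hEf N⟩
  have hpiece : ∀ N, ∫⁻ t in E N, ‖φ ((star (a t) * c t * a t).fst (u N))‖ₑ ∂μ
      ≤ ENNReal.ofReal (C * ‖φ‖) := by
    intro N
    have := hfin N
    set g : T → ℂ := fun t => φ ((star (a t) * c t * a t).fst (u N)) with hg
    have hgm : AEStronglyMeasurable g μ := φ.continuous.comp_aestronglyMeasurable (hbm _)
    set θ : T → ℂ := fun t => star (g t) * ((‖g t‖ : ℂ))⁻¹ with hθ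
    have hθm : AEStronglyMeasurable θ μ :=
      (continuous_star.comp_aestronglyMeasurable hgm).mul
        ((Complex.continuous_ofReal.comp_aestronglyMeasurable
          hgm.norm).aemeasurable.inv.aestronglyMeasurable)
    have hθ1 : ∀ t, ‖θ t‖ ≤ 1 := by
      intro t
      rw [hθ, norm_mul, norm_star, norm_inv, Complex.norm_real, norm_norm]
      exact mul_inv_le_one
    have hθg : ∀ t, θ t * g t = (‖g t‖ : ℂ) := by
      intro t
      rcases eq_or_ne (g t) 0 with h | h
      · simp [h]
      · have h' : (‖g t‖ : ℂ) ≠ 0 := by exact_mod_cast norm_ne_zero_iff.mpr h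
        rw [hθ, mul_right_comm, Complex.star_def, Complex.conj_mul', sq, mul_inv_cancel_right₀ h']
    have hEa' := ae_restrict_of_ae_imp (hEm N) (hEa N)
    have hs' := hs.restrict (E N)
    have hcC : ∀ᵐ t ∂μ.restrict (E N), ‖c t‖ ≤ C := Eventually.of_forall hC
    have hgi : IntegrableOn g (E N) μ :=
      φ.integrable_comp (integrable_fst (hbm.restrict _) (norm_compression_ae_le hEa' hcC) _)
    have hθc : StrictlyMeasurable μ fun t => θ t • c t := hc.smul hθm
    have hθC : ∀ᵐ t ∂μ.restrict (E N), ‖θ t • c t‖ ≤ C := Eventually.of_forall fun t => by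
      rw [norm_smul]
      exact (mul_le_of_le_one_left (norm_nonneg _) (hθ1 t)).trans (hC t)
    have hH : ∀ w : A, ‖∫ t in E N, star ((a t).fst w) * (a t).fst w ∂μ‖ ≤ ‖w‖ ^ 2 := fun w =>
      ha.norm_setIntegral_le (hEm N) (integrable_star_fst_mul_fst hs' hs' hEa' hEa' w w)
    have h1 := norm_integral_compression_sq_le hs' hEa' (hθc.restrict _) hθC hH (u N)
    set Z := ∫ t in E N, (star (a t) * θ t • c t * a t).fst (u N) ∂μ with hZ
    have h2 : ‖Z‖ ≤ C := by
      refine abs_le_of_sq_le_sq' ?_ hC0 |>.2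
      refine h1.trans (mul_le_of_le_one_right (sq_nonneg _) ((hH _).trans ?_))
      exact pow_le_one₀ (norm_nonneg _) (hu1 N)
    have h3 : φ Z = ((∫ t in E N, ‖g t‖ ∂μ : ℝ) : ℂ) := by
      rw [hZ, ← φ.integral_comp_comm (integrable_fst
        ((strictlyMeasurable_compression hs hθc).restrict _)
        (norm_compression_ae_le hEa' hθC) _)]
      refine Eq.trans ?_ integral_ofReal
      refine integral_congr_ae (Eventually.of_forall fun t => ?_)
      change _ = (‖g t‖ : ℂ)
      rw [← hθg, hg, ← smul_eq_mul (θ t), ← map_smul]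
      simp
    rw [← ofReal_integral_norm_eq_lintegral_enorm hgi]
    refine ENNReal.ofReal_le_ofReal ?_
    have h4 : ‖φ Z‖ = ∫ t in E N, ‖g t‖ ∂μ := by
      rw [h3, Complex.norm_real, Real.norm_eq_abs,
        abs_of_nonneg (integral_nonneg fun t => norm_nonneg _)]
    rw [← h4, mul_comm]
    exact (φ.le_opNorm Z).trans (by gcongr)
  set F : ℕ → T → ℝ≥0∞ := fun N =>
    (E N).indicator fun t => ‖φ ((star (a t) * c t * a t).fst (u N))‖ₑ with hF
  have hFm : ∀ N, AEMeasurable (F N) μ := fun N =>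
    ((φ.continuous.comp_aestronglyMeasurable (hbm _)).enorm).indicator (hEm N)
  have hle : ∀ᵐ t ∂μ, ‖extend φ (star (a t) * c t * a t)‖ₑ ≤ liminf (fun N => F N t) atTop := by
    filter_upwards [h0] with t ht
    by_cases hmem : t ∈ ⋃ N, E N
    · obtain ⟨N₀, hN₀⟩ := Set.mem_iUnion.mp hmem
      refine (Tendsto.liminf_eq ?_).ge
      have h1 : Tendsto (fun N => ‖φ ((star (a t) * c t * a t).fst (u N))‖ₑ) atTop
          (𝓝 ‖extend φ (star (a t) * c t * a t)‖ₑ) :=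
        (continuous_enorm.tendsto _).comp (tendsto_extend hu φ (star (a t) * c t * a t))
      refine h1.congr' ?_
      filter_upwards [eventually_ge_atTop N₀] with N hN
      simp only [hF]
      rw [Set.indicator_of_mem (hE hN hN₀)]
    · have : extend φ (star (a t) * c t * a t) = 0 := by
        rw [ht hmem, mul_zero]; exact map_zero (extendCLM φ)
      rw [this, enorm_zero]
      positivity
  calc ∫⁻ t, ‖extend φ (star (a t) * c t * a t)‖ₑ ∂μ
      ≤ ∫⁻ t, liminf (fun N => F N t) atTop ∂μ := lintegral_mono_ae hle
    _ ≤ liminf (fun N => ∫⁻ t, F N t ∂μ) atTop := lintegral_liminf_le' hFm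
    _ ≤ ENNReal.ofReal (C * ‖φ‖) := by
        refine liminf_le_of_le (by isBoundedDefault) fun b hb => ?_
        obtain ⟨N, hN⟩ := hb.exists
        refine hN.trans ?_
        rw [hF, lintegral_indicator (hEm N)]
        exact hpiece N

theorem IsUnitalColumnField.integrable_extend (ha : IsUnitalColumnField μ a)
    (hc : StrictlyMeasurable μ c) (hC0 : 0 ≤ C) (hC : ∀ t, ‖c t‖ ≤ C) (φ : A →L[ℂ] ℂ) :
    Integrable (fun t => extend φ (star (a t) * c t * a t)) μ :=
  ⟨(strictlyMeasurable_compression ha.1.strictlyMeasurable hc).weakStarMeasurable φ,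
    (ha.lintegral_enorm_extend_le hc hC0 hC φ).trans_lt ENNReal.ofReal_lt_top⟩

theorem IsUnitalColumnField.norm_integral_extend_le (ha : IsUnitalColumnField μ a)
    (hc : StrictlyMeasurable μ c) (hC0 : 0 ≤ C) (hC : ∀ t, ‖c t‖ ≤ C) (φ : A →L[ℂ] ℂ) :
    ‖∫ t, extend φ (star (a t) * c t * a t) ∂μ‖ ≤ C * ‖φ‖ := by
  refine (norm_integral_le_integral_norm _).trans ?_
  rw [← ENNReal.ofReal_le_ofReal_iff (by positivity),
    ofReal_integral_norm_eq_lintegral_enorm (ha.integrable_extend hc hC0 hC φ)]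
  exact ha.lintegral_enorm_extend_le hc hC0 hC φ

/-- The integral `∫ a* c a d`, `d ∈ A`, as an element of `A`. -/
theorem IsUnitalColumnField.exists_apply_eq_integral (ha : IsUnitalColumnField μ a)
    (hc : StrictlyMeasurable μ c) (hC0 : 0 ≤ C) (hC : ∀ t, ‖c t‖ ≤ C) (d : A) :
    ∃ ζ : A, ∀ φ : A →L[ℂ] ℂ, φ ζ = ∫ t, φ ((star (a t) * c t * a t).fst d) ∂μ := by
  obtain ⟨E, hE, hEm, hEf, hEa, h0⟩ := ha.exists_exhaustion
  have hs := ha.1.strictlyMeasurable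
  have hbm := strictlyMeasurable_compression hs hc
  have hfin : ∀ N, IsFiniteMeasure (μ.restrict (E N)) := fun N =>
    ⟨by rw [Measure.restrict_apply_univ]; exact hEf N⟩
  have hHi : ∀ N w, IntegrableOn (fun t => star ((a t).fst w) * (a t).fst w) (E N) μ := by
    intro N w
    have := hfin N
    have hEa' := ae_restrict_of_ae_imp (hEm N) (hEa N)
    exact integrable_star_fst_mul_fst (hs.restrict _) (hs.restrict _) hEa' hEa' w w
  have hbi : ∀ N, IntegrableOn (fun t => (star (a t) * c t * a t).fst d) (E N) μ := by
    intro N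
    have := hfin N
    exact integrable_fst (hbm.restrict _) (norm_compression_ae_le
      (ae_restrict_of_ae_imp (hEm N) (hEa N)) (Eventually.of_forall hC)) d
  have hH := ha.tendsto_setIntegral hE hEm h0 (d := d) fun N => hHi N d
  have hZ : CauchySeq fun N => ∫ t in E N, (star (a t) * c t * a t).fst d ∂μ := by
    rw [Metric.cauchySeq_iff']
    intro ε hε
    obtain ⟨N, hN⟩ := Metric.cauchySeq_iff'.mp hH.cauchySeq ((ε / (C + 1)) ^ 2) (by positivity)
    refine ⟨N, fun n hn => ?_⟩
    have h1 := hN n hn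
    rw [dist_eq_norm] at h1 ⊢
    rw [← setIntegral_sdiff (hEm N) (hHi n d) (hE hn)] at h1
    rw [← setIntegral_sdiff (hEm N) (hbi n) (hE hn)]
    have hSm : MeasurableSet (E n \ E N) := (hEm n).diff (hEm N)
    have : IsFiniteMeasure (μ.restrict (E n \ E N)) :=
      ⟨by rw [Measure.restrict_apply_univ]
          exact (measure_mono Set.sdiff_subset).trans_lt (hEf n)⟩
    have hSa : ∀ᵐ t ∂μ.restrict (E n \ E N), ‖a t‖ ≤ n :=
      ae_restrict_of_ae_imp hSm ((hEa n).mono fun t ht hmem => ht hmem.1)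
    have h2 := norm_integral_compression_sq_le (hs.restrict _) hSa (hc.restrict _)
      (Eventually.of_forall hC)
      (fun w => ha.norm_setIntegral_le hSm ((hHi n w).mono_set Set.sdiff_subset)) d
    refine lt_of_pow_lt_pow_left₀ 2 hε.le (h2.trans_lt ?_)
    calc C ^ 2 * ‖∫ t in E n \ E N, star ((a t).fst d) * (a t).fst d ∂μ‖
        ≤ C ^ 2 * (ε / (C + 1)) ^ 2 := by gcongr
      _ = (C * ε / (C + 1)) ^ 2 := by ring
      _ < ε ^ 2 := by
          refine pow_lt_pow_left₀ ?_ (by positivity) two_ne_zero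
          rw [div_lt_iff₀ (by positivity)]
          linarith
  obtain ⟨ζ, hζ⟩ := cauchySeq_tendsto_of_complete hZ
  refine ⟨ζ, fun φ => tendsto_nhds_unique ((φ.continuous.tendsto ζ).comp hζ) ?_⟩
  have hint : Integrable (fun t => φ ((star (a t) * c t * a t).fst d)) μ := by
    simpa only [extend_rightFunctional] using
      ha.integrable_extend hc hC0 hC (rightFunctional φ d)
  have h1 := tendsto_setIntegral_of_monotone hEm hE hint.integrableOn
  rw [setIntegral_eq_integral_of_ae_compl_eq_zero (by
    filter_upwards [h0] with t ht hmem
    simp [ht hmem])] at h1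
  refine h1.congr fun N => ?_
  exact φ.integral_comp_comm (hbi N)

/-- Bounded strictly measurable fields can be compressed by a unital column field. -/
theorem IsUnitalColumnField.fieldIntegrable (ha : IsUnitalColumnField μ a)
    (hc : StrictlyMeasurable μ c) (hC0 : 0 ≤ C) (hC : ∀ t, ‖c t‖ ≤ C) :
    FieldIntegrable μ fun t => star (a t) * c t * a t := by
  have hs := ha.1.strictlyMeasurable
  have hcs : StrictlyMeasurable μ fun t => star (c t) := hc.star
  have hCs : ∀ t, ‖star (c t)‖ ≤ C := fun t => by rw [norm_star]; exact hC t
  have hint := fun φ d => ha.integrable_extend hc hC0 hC (rightFunctional φ d)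
  simp only [extend_rightFunctional] at hint
  choose Z hZ using fun d => ha.exists_apply_eq_integral hc hC0 hC d
  choose Y hY using fun d => ha.exists_apply_eq_integral hcs hC0 hCs d
  -- the pair formed by `d ↦ ∫ a* c a d` and its adjoint is a multiplier
  have hints := fun φ d => ha.integrable_extend hcs hC0 hCs (rightFunctional φ d)
  simp only [extend_rightFunctional] at hints
  have key : ∀ x y : A, star (Y x) * y = star x * Z y := by
    intro x y
    rw [SeparatingDual.eq_iff_forall_dual_eq (R := ℂ)]
    intro φ
    have h1 := hY x (starFunctional (rightFunctional φ y))
    have h2 := hZ y (φ.comp (ContinuousLinearMap.mul ℂ A (star x)))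
    simp only [starFunctional_apply, rightFunctional_apply] at h1
    rw [← star_inj, h1]
    change _ = star ((φ.comp (ContinuousLinearMap.mul ℂ A (star x))) (Z y))
    rw [h2, Complex.star_def, ← integral_conj]
    refine integral_congr_ae (Eventually.of_forall fun t => ?_)
    change star (φ _) = star (φ _)
    rw [star_fst_mul]
    simp [mul_assoc]
  have lin : ∀ {c' : T → 𝓜(ℂ, A)} {Z' : A → A} (_ : StrictlyMeasurable μ c')
      (_ : ∀ t, ‖c' t‖ ≤ C)
      (_ : ∀ d (φ : A →L[ℂ] ℂ), φ (Z' d) = ∫ t, φ ((star (a t) * c' t * a t).fst d) ∂μ),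
      ∃ L : A →L[ℂ] A, ∀ d, L d = Z' d := by
    intro c' Z' hc' hC' hZ'
    have hint' := fun φ d => ha.integrable_extend hc' hC0 hC' (rightFunctional φ d)
    simp only [extend_rightFunctional] at hint'
    refine ⟨LinearMap.mkContinuous
      { toFun := Z'
        map_add' := fun x y => ?_
        map_smul' := fun r x => ?_ } C fun d => ?_, fun d => rfl⟩
    · rw [SeparatingDual.eq_iff_forall_dual_eq (R := ℂ)]
      intro φ
      rw [map_add, hZ', hZ', hZ', ← integral_add (hint' φ x) (hint' φ y)]
      simp only [map_add]
    · rw [SeparatingDual.eq_iff_forall_dual_eq (R := ℂ)]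
      intro φ
      rw [map_smul, hZ', RingHom.id_apply, hZ', ← integral_smul]
      simp only [map_smul]
    · change ‖Z' d‖ ≤ C * ‖d‖
      refine NormedSpace.norm_le_dual_bound ℂ _ (by positivity) fun φ => ?_
      have h1 := ha.norm_integral_extend_le hc' hC0 hC' (rightFunctional φ d)
      simp only [extend_rightFunctional] at h1
      rw [hZ']
      refine h1.trans ?_
      rw [mul_assoc, mul_comm ‖d‖]
      gcongr
      refine ContinuousLinearMap.opNorm_le_bound _ (by positivity) fun z => ?_
      rw [rightFunctional_apply]
      refine (φ.le_opNorm _).trans ?_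
      rw [mul_assoc, mul_comm ‖d‖]
      gcongr
      exact norm_mul_le _ _
  obtain ⟨L, hL⟩ := lin hc hC hZ
  obtain ⟨R, hR⟩ := lin hcs hCs hY
  let Rs : A →L[ℂ] A := LinearMap.mkContinuous
    { toFun := fun x => star (R (star x))
      map_add' := fun x y => by simp
      map_smul' := fun r x => by simp } ‖R‖ fun x => by simpa using R.le_opNorm (star x)
  have hRs : ∀ x, Rs x = star (R (star x)) := fun x => rfl
  let z : 𝓜(ℂ, A) :=
    { toProd := (L, Rs)
      central := fun x y => by rw [hRs, hR, hL, key, star_star] }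
  have hz : ∀ d, z.fst d = Z d := hL
  refine ⟨z, (strictlyMeasurable_compression hs hc).weakStarMeasurable, fun φ =>
    ⟨ha.integrable_extend hc hC0 hC φ, ?_⟩⟩
  -- `φ(z u) = ∫ φ (a* c a u)` and `φ(· u) → φ` in norm along the approximate unit
  obtain ⟨u, -, -, hu⟩ := exists_sequence_approximateUnit A
  have h1 : Tendsto (fun n => φ (z.fst (u n))) atTop (𝓝 (extend φ z)) := tendsto_extend hu φ z
  refine tendsto_nhds_unique h1 ?_
  rw [Metric.tendsto_nhds]
  intro ε hε
  have h2 := eventually_norm_apply_mul_sub_le hu φ (ε := ε / (C + 1)) (by positivity)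
  filter_upwards [eventually_map.mp h2] with n hn
  have h3 := ha.norm_integral_extend_le hc hC0 hC (rightFunctional φ (u n) - φ)
  simp only [extend_functional_sub, extend_rightFunctional] at h3
  rw [integral_sub (hint φ (u n)) (ha.integrable_extend hc hC0 hC φ), ← hZ, ← hz,
    ← dist_eq_norm] at h3
  refine h3.trans_lt ?_
  calc C * ‖rightFunctional φ (u n) - φ‖ ≤ C * (ε / (C + 1)) := by
        gcongr
        exact ContinuousLinearMap.opNorm_le_bound _ (by positivity) hn
    _ = C * ε / (C + 1) := by ring
    _ < ε := by rw [div_lt_iff₀ (by positivity)]; linarith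

end Column

end Compression

/-! ### Measurability of the functional calculus -/

section CalculusMeasurable

variable {A : Type*} [NonUnitalCStarAlgebra A] [PartialOrder A] [StarOrderedRing A]
variable [TopologicalSpace.SeparableSpace A]
variable {T : Type*} [MeasurableSpace T] {μ : Measure T} {n : ℕ} {x : T → Fin n → 𝓜(ℂ, A)} {C : ℝ}

theorem abs_le_of_mem_jointSpectrum {B : Type*} [CStarAlgebra B] {n : ℕ} {x : Fin n → B}
    (hx : IsAbelianTuple x) {s : Fin n → ℝ} (hs : s ∈ jointSpectrum x) (i : Fin n) :
    |s i| ≤ ‖x i‖ := by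
  obtain ⟨χ, rfl⟩ := hs
  have : Nontrivial B := by
    by_contra h
    rw [not_nontrivial_iff_subsingleton] at h
    have := jointPoint_mem_spectrum hx χ i
    simp [spectrum.of_subsingleton] at this
  exact spectrum.norm_le_norm_of_mem (jointPoint_mem_spectrum hx χ i)

/-- By the Stone–Weierstrass theorem on a cube that contains all joint spectra. -/
theorem strictlyMeasurable_calculus_of_continuous (hx : ∀ t, IsAbelianTuple (x t))
    (hC : ∀ t i, ‖x t i‖ ≤ C) (hC0 : 0 ≤ C) (hm : ∀ i, StrictlyMeasurable μ fun t => x t i)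
    {h : (Fin n → ℝ) → ℝ} (hh : Continuous h) :
    StrictlyMeasurable μ fun t => calculus (x t) h := by
  have hle : -C ≤ C := by linarith
  have hcube : ∀ t, ∀ s ∈ jointSpectrum (x t), ∀ i, s i ∈ Set.Icc (-C) C := fun t s hs i =>
    abs_le.mp ((abs_le_of_mem_jointSpectrum (hx t) hs i).trans (hC t i))
  let pr : (Fin n → ℝ) → (Fin n → Set.Icc (-C) C) := fun s i => Set.projIcc (-C) C hle (s i)
  have hpr : Continuous pr := by
    refine continuous_pi fun i => continuous_projIcc.comp (continuous_apply i)
  have hcont : ∀ (g : C(Fin n → Set.Icc (-C) C, ℝ)) (t : T),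
      ContinuousOn (fun s => g (pr s)) (jointSpectrum (x t)) := fun g t =>
    (g.continuous.comp hpr).continuousOn
  let S : Subalgebra ℝ C(Fin n → Set.Icc (-C) C, ℝ) :=
    { carrier := {g | StrictlyMeasurable μ fun t => calculus (x t) fun s => g (pr s)}
      mul_mem' := fun {g g'} hg hg' => by
        have : (fun t => calculus (x t) fun s => (g * g') (pr s))
            = fun t => (calculus (x t) fun s => g (pr s)) * calculus (x t) fun s => g' (pr s) :=
          funext fun t => (hx t).calculus_mul (hcont g t) (hcont g' t)
        change StrictlyMeasurable μ _
        rw [this]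
        exact hg.mul hg'
      add_mem' := fun {g g'} hg hg' => by
        have : (fun t => calculus (x t) fun s => (g + g') (pr s))
            = fun t => (calculus (x t) fun s => g (pr s)) + calculus (x t) fun s => g' (pr s) :=
          funext fun t => (hx t).calculus_add (hcont g t) (hcont g' t)
        change StrictlyMeasurable μ _
        rw [this]
        exact hg.add hg'
      algebraMap_mem' := fun r => by
        have : (fun t => calculus (x t) fun s =>
            (algebraMap ℝ C(Fin n → Set.Icc (-C) C, ℝ) r) (pr s))
            = fun _ => (r : ℂ) • (1 : 𝓜(ℂ, A)) :=
          funext fun t => (hx t).calculus_const r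
        change StrictlyMeasurable μ _
        rw [this]
        exact strictlyMeasurable_const _ }
  have hS : S.topologicalClosure = ⊤ := by
    refine ContinuousMap.subalgebra_topologicalClosure_eq_top_of_separatesPoints S ?_
    intro p q hpq
    obtain ⟨i, hi⟩ := Function.ne_iff.mp hpq
    refine ⟨_, ⟨⟨fun s => (s i : ℝ), by fun_prop⟩, ?_, rfl⟩, fun h => hi (Subtype.ext h)⟩
    have : (fun t => calculus (x t) fun s => ((pr s i : Set.Icc (-C) C) : ℝ)) = fun t => x t i := by
      funext t
      rw [← (hx t).calculus_coord i]
      refine ((hx t).calculus_congr (by fun_prop) fun s hs => ?_).symm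
      exact (congrArg Subtype.val (Set.projIcc_of_mem hle (hcube t s hs i))).symm
    change StrictlyMeasurable μ (fun t => calculus (x t) fun s => ((pr s i : Set.Icc (-C) C) : ℝ))
    rw [this]
    exact hm i
  let g : C(Fin n → Set.Icc (-C) C, ℝ) := ⟨fun p => h fun i => p i, by fun_prop⟩
  have hg : g ∈ closure (S : Set C(Fin n → Set.Icc (-C) C, ℝ)) := by
    have : g ∈ S.topologicalClosure := by rw [hS]; trivial
    exact this
  obtain ⟨gk, hgk, hlim⟩ := mem_closure_iff_seq_limit.mp hg
  have hgh : ∀ t, calculus (x t) h = calculus (x t) fun s => g (pr s) := fun t =>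
    (hx t).calculus_congr hh.continuousOn fun s hs => congrArg h (funext fun i =>
      (congrArg Subtype.val (Set.projIcc_of_mem hle (hcube t s hs i))).symm)
  refine strictlyMeasurable_of_tendsto hgk fun t => ?_
  rw [hgh, tendsto_iff_norm_sub_tendsto_zero]
  refine squeeze_zero (fun _ => norm_nonneg _) (fun k => ?_)
    (tendsto_iff_norm_sub_tendsto_zero.mp hlim)
  rw [← (hx t).calculus_sub (hcont _ t) (hcont _ t)]
  exact (hx t).norm_calculus_le ((hcont _ t).sub (hcont _ t)) (norm_nonneg _) fun s _ =>
    (gk k - g).norm_coe_le_norm (pr s)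

/-- A function on a box is continuous on each joint spectrum, but need not extend continuously to
the closure of the box; it is composed with retractions onto compact boxes. -/
theorem strictlyMeasurable_calculus (hx : ∀ t, IsAbelianTuple (x t))
    (hC : ∀ t i, ‖x t i‖ ≤ C) (hC0 : 0 ≤ C) (hm : ∀ i, StrictlyMeasurable μ fun t => x t i)
    {I : Fin n → Set ℝ} (hI : ∀ i, (I i).OrdConnected)
    (hxI : ∀ t, jointSpectrum (x t) ⊆ Set.univ.pi I)
    {f : (Fin n → ℝ) → ℝ} (hf : ContinuousOn f (Set.univ.pi I)) :
    StrictlyMeasurable μ fun t => calculus (x t) f := by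
  rcases (Set.univ.pi I).eq_empty_or_nonempty with hemp | hne
  · have : (fun t => calculus (x t) f) = fun _ => ((0 : ℝ) : ℂ) • (1 : 𝓜(ℂ, A)) := by
      funext t
      rw [← (hx t).calculus_const 0]
      exact (hx t).calculus_congr (hf.mono (hxI t)) fun s hs =>
        absurd (hxI t hs) (by rw [hemp]; exact Set.notMem_empty s)
    rw [this]
    exact strictlyMeasurable_const _
  have hne' : ∀ i, Nonempty (I i) := fun i =>
    (Set.univ_pi_nonempty_iff.mp hne i).to_subtype
  choose β hβ using fun i => exists_seq_tendsto (atTop : Filter (I i))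
  choose α hα using fun i => exists_seq_tendsto (atBot : Filter (I i))
  let cl : ℕ → (Fin n → ℝ) → (Fin n → ℝ) := fun k s i => max (α i k : ℝ) (min (s i) (β i k))
  have hclc : ∀ k, Continuous (cl k) := fun k => by fun_prop
  have hclI : ∀ k s, cl k s ∈ Set.univ.pi I := by
    intro k s i _
    rcases max_choice (α i k : ℝ) (min (s i) (β i k)) with h | h
    · change max _ _ ∈ I i
      rw [h]; exact (α i k).2
    · refine (hI i).out (α i k).2 (β i k).2 ⟨le_max_left _ _, ?_⟩
      change max _ _ ≤ _
      rw [h]; exact min_le_right _ _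
  refine strictlyMeasurable_of_tendsto (b' := fun k t => calculus (x t) fun s => f (cl k s))
    (fun k => strictlyMeasurable_calculus_of_continuous hx hC hC0 hm
      (hf.comp_continuous (hclc k) (hclI k))) fun t => ?_
  rcases (jointSpectrum (x t)).eq_empty_or_nonempty with he | hne
  · refine tendsto_const_nhds.congr fun k => ?_
    exact (hx t).calculus_congr (hf.mono (hxI t)) fun s hs => by rw [he] at hs; exact hs.elim
  have hbd : ∀ᶠ k in atTop, ∀ i, ∀ s ∈ jointSpectrum (x t), (α i k : ℝ) ≤ s i ∧ s i ≤ β i k := by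
    rw [eventually_all]
    intro i
    obtain ⟨s₁, hs₁, hmin⟩ := (isCompact_jointSpectrum (x t)).exists_isMinOn hne
      (continuous_apply i).continuousOn
    obtain ⟨s₂, hs₂, hmax⟩ := (isCompact_jointSpectrum (x t)).exists_isMaxOn hne
      (continuous_apply i).continuousOn
    filter_upwards [(hα i).eventually (eventually_le_atBot ⟨s₁ i, hxI t hs₁ i trivial⟩),
      (hβ i).eventually (eventually_ge_atTop ⟨s₂ i, hxI t hs₂ i trivial⟩)] with k h1 h2 s hs
    exact ⟨le_trans h1 (hmin hs), le_trans (hmax hs) h2⟩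
  refine tendsto_const_nhds.congr' ?_
  filter_upwards [hbd] with k hk
  refine (hx t).calculus_congr (hf.mono (hxI t)) fun s hs => congrArg f (funext fun i => ?_)
  obtain ⟨h1, h2⟩ := hk i s hs
  change s i = max _ (min _ _)
  rw [min_eq_left h2, max_eq_right h1]

end CalculusMeasurable

/-! ### The spectra of the integrals, and affine minorants -/

section Bounded

theorem isAbelianTuple_coe {A : Type*} [NonUnitalCStarAlgebra A] {n : ℕ} {x : Fin n → A}
    (hx : IsAbelianTuple x) :
    IsAbelianTuple fun i => (x i : 𝓜(ℂ, A)) :=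
  ⟨fun i => by rw [IsSelfAdjoint, ← coe_star, (hx.1 i).star_eq], fun i j => by
    rw [Commute, SemiconjBy, ← coe_mul, ← coe_mul, (hx.2 i j).eq]⟩

variable {A : Type*} [NonUnitalCStarAlgebra A] [PartialOrder A] [StarOrderedRing A]
variable {T : Type*} [MeasurableSpace T] {μ : Measure T} {a : T → 𝓜(ℂ, A)}

theorem isFieldIntegral_fieldIntegral {b : T → 𝓜(ℂ, A)} (h : FieldIntegrable μ b) :
    IsFieldIntegral μ b (fieldIntegral μ b) := by
  rw [fieldIntegral, dif_pos h]
  exact h.choose_spec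

theorem extend_sum (φ : A →L[ℂ] ℂ) {ι : Type*} (s : Finset ι) (m : ι → 𝓜(ℂ, A)) :
    extend φ (∑ i ∈ s, m i) = ∑ i ∈ s, extend φ (m i) := map_sum (extendCLM φ) m s

theorem exists_pos_algebraMap_le {B : Type*} [CStarAlgebra B] [PartialOrder B] [StarOrderedRing B]
    [Nontrivial B] {b : B} (hb : IsSelfAdjoint b) {σ s : ℝ}
    (h : ∀ p ∈ spectrum ℝ b, 0 < σ * (p - s)) :
    ∃ δ : ℝ, 0 < δ ∧ algebraMap ℝ B δ ≤ σ • b - algebraMap ℝ B (σ * s) := by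
  have e : σ • b - algebraMap ℝ B (σ * s) = cfc (fun p : ℝ => σ * (p - s)) b := by
    have : (fun p : ℝ => σ * (p - s)) = fun p => σ * p - σ * s := funext fun p => by ring
    rw [this, cfc_sub .., cfc_const_mul .., cfc_id' .., cfc_const ..]
  rw [e]
  refine (CFC.exists_pos_algebraMap_le_iff (cfc_predicate _ b)).mpr fun p hp => ?_
  rw [cfc_map_spectrum (fun p : ℝ => σ * (p - s)) b] at hp
  obtain ⟨q, hq, rfl⟩ := hp
  exact h q hq

/-- If `∫ φ(a* D a) ≤ 0` for strictly positive `D`, then `φ(a* a)` vanishes almost everywhere. -/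
theorem IsUnitalColumnField.extend_one_eq_zero (ha : IsUnitalColumnField μ a) {φ : A →L[ℂ] ℂ}
    (hφ : IsPositiveFunctional φ) {D : T → 𝓜(ℂ, A)}
    (hD : ∀ t, ∃ δ : ℝ, 0 < δ ∧ algebraMap ℝ 𝓜(ℂ, A) δ ≤ D t)
    (hint : Integrable (fun t => extend φ (star (a t) * D t * a t)) μ)
    (hle : ∫ t, extend φ (star (a t) * D t * a t) ∂μ ≤ 0) : extend φ 1 = 0 := by
  have hD0 : ∀ t, 0 ≤ D t := fun t => by
    obtain ⟨δ, hδ, h⟩ := hD t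
    refine le_trans ?_ h
    rw [Algebra.algebraMap_eq_smul_one]
    exact smul_nonneg hδ.le zero_le_one
  have hnn : ∀ t, 0 ≤ extend φ (star (a t) * D t * a t) := fun t =>
    extend_nonneg hφ (star_left_conjugate_nonneg (hD0 t) _)
  have hre : ∀ t, 0 ≤ (extend φ (star (a t) * D t * a t)).re := fun t =>
    (Complex.nonneg_iff.mp (hnn t)).1
  have h0 : ∫ t, (extend φ (star (a t) * D t * a t)).re ∂μ = 0 := by
    have h1 : ∫ t, (extend φ (star (a t) * D t * a t)).re ∂μ
        = (∫ t, extend φ (star (a t) * D t * a t) ∂μ).re :=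
      Complex.reCLM.integral_comp_comm hint
    refine le_antisymm ?_ (integral_nonneg hre)
    rw [h1]
    exact (Complex.le_def.mp hle).1
  rw [integral_eq_zero_iff_of_nonneg hre (Complex.reCLM.integrable_comp hint)] at h0
  rw [(ha.2.2 φ).2]
  refine integral_eq_zero_of_ae ?_
  filter_upwards [h0] with t ht
  obtain ⟨δ, hδ, h⟩ := hD t
  have h1 : (δ : ℂ) * extend φ (star (a t) * a t) ≤ extend φ (star (a t) * D t * a t) := by
    rw [← extend_smul]
    refine extend_mono hφ ?_
    have := star_left_conjugate_le_conjugate h (a t)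
    rwa [Algebra.algebraMap_eq_smul_one, mul_smul_comm, smul_mul_assoc, mul_one,
      ← Complex.coe_smul] at this
  have h2 : 0 ≤ extend φ (star (a t) * a t) := extend_nonneg hφ (star_mul_self_nonneg _)
  have h3 := (Complex.le_def.mp h1).1
  rw [Complex.re_ofReal_mul] at h3
  have h4 : (extend φ (star (a t) * a t)).re ≤ 0 := by
    simp only [Pi.zero_apply] at ht
    rw [ht] at h3
    exact nonpos_of_mul_nonpos_right h3 hδ
  have h5 := Complex.nonneg_iff.mp h2
  exact Complex.ext (le_antisymm h4 h5.1) h5.2.symm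

/-- A point `s` of the spectrum of `y = ∫ a* x a` is the value of a state at `y`.  If the spectra
of the `x t` all lie on one side of `s`, then the state annihilates `∫ a* a = 1`. -/
theorem IsUnitalColumnField.spectrum_subset (ha : IsUnitalColumnField μ a) {I : Set ℝ}
    (hI : I.OrdConnected) {x : T → A} (hx : ∀ t, IsSelfAdjoint (x t))
    (hxI : ∀ t, spectrum ℝ (x t : 𝓜(ℂ, A)) ⊆ I) {y : A} (hy : IsSelfAdjoint y)
    (hxy : IsFieldIntegral μ (fun t => star (a t) * (x t : 𝓜(ℂ, A)) * a t) y) :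
    spectrum ℝ (y : 𝓜(ℂ, A)) ⊆ I := by
  intro s hs
  by_contra hsI
  have hX : ∀ t, IsSelfAdjoint (x t : 𝓜(ℂ, A)) := fun t => by
    rw [IsSelfAdjoint, ← coe_star, (hx t).star_eq]
  have hY : IsSelfAdjoint (y : 𝓜(ℂ, A)) := by rw [IsSelfAdjoint, ← coe_star, hy.star_eq]
  obtain ⟨σ, hσ⟩ : ∃ σ : ℝ, ∀ p ∈ I, 0 < σ * (p - s) := by
    by_cases h : ∀ p ∈ I, s < p
    · exact ⟨1, fun p hp => by linarith [h p hp]⟩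
    · push Not at h
      obtain ⟨p, hp, hps⟩ := h
      refine ⟨-1, fun q hq => ?_⟩
      have : q < s := lt_of_not_ge fun hq' => hsI (hI.out hp hq ⟨hps, hq'⟩)
      linarith
  obtain ⟨ψ, hψ1, hψn, hψs⟩ := exists_state_apply_eq hY hs
  let κ : A →L[ℂ] 𝓜(ℂ, A) :=
    ⟨(DoubleCentralizer.coeHom (𝕜 := ℂ) (A := A) : A →ₗ[ℂ] 𝓜(ℂ, A)), continuous_coe⟩
  have hκ : ∀ z : A, ψ.comp κ z = ψ (z : 𝓜(ℂ, A)) := fun z => rfl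
  set φ := ψ.comp κ with hφdef
  have hφ : IsPositiveFunctional φ := fun z hz => by
    rw [hκ]; exact nonneg_of_contractive hψ1 hψn (coe_nonneg hz)
  have hφn : ‖φ‖ ≤ 1 := ContinuousLinearMap.opNorm_le_bound _ zero_le_one fun z => by
    rw [hκ, ← norm_coe z]
    exact ψ.le_of_opNorm_le hψn _
  have hnt : Nontrivial 𝓜(ℂ, A) := by
    by_contra h
    rw [not_nontrivial_iff_subsingleton] at h
    simp [spectrum.of_subsingleton] at hs
  have hT : Nonempty T := by
    by_contra h
    rw [not_nonempty_iff] at h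
    refine one_ne_zero (α := 𝓜(ℂ, A)) (eq_of_forall_extend_eq fun φ => ?_)
    rw [(ha.2.2 φ).2, integral_of_isEmpty]
    exact (map_zero (extendCLM φ)).symm
  set l := extend φ 1 with hl
  have hl0 : 0 ≤ l := extend_nonneg hφ zero_le_one
  have hl1 : l.re ≤ 1 := by
    refine (Complex.re_le_norm _).trans ((norm_extend_le φ 1).trans ?_)
    rw [norm_one, mul_one]; exact hφn
  have hlre : (l.re : ℂ) = l :=
    Complex.ext rfl (by rw [Complex.ofReal_im]; exact (Complex.nonneg_iff.mp hl0).2)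
  -- either `A` is unital, or no element of `A` is invertible in `M(A)`
  have hl' : l = 1 ∨ σ * s < 0 := by
    by_cases h0 : (0 : ℝ) ∈ I
    · right; have := hσ 0 h0; linarith
    · left
      obtain ⟨t⟩ := hT
      have hu : IsUnit (x t : 𝓜(ℂ, A)) := by
        by_contra h
        exact h0 (hxI t (spectrum.zero_mem ℝ h))
      obtain ⟨w, hw⟩ := hu.exists_right_inv
      rw [coe_mul_eq] at hw
      rw [hl, ← hψ1, ← hw, extend_coe, hκ]
  have hDint : ∀ t, extend φ (star (a t) * (σ • (x t : 𝓜(ℂ, A))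
      - algebraMap ℝ 𝓜(ℂ, A) (σ * s)) * a t)
      = (σ : ℂ) * extend φ (star (a t) * (x t : 𝓜(ℂ, A)) * a t)
        - ((σ * s : ℝ) : ℂ) * extend φ (star (a t) * a t) := fun t => by
    rw [← extend_smul, ← extend_smul, ← extend_sub, mul_sub, sub_mul,
      Algebra.algebraMap_eq_smul_one, ← Complex.coe_smul, ← Complex.coe_smul]
    simp only [mul_smul_comm, smul_mul_assoc, mul_one]
  have hi := ((hxy.2 φ).1.const_mul (σ : ℂ)).sub ((ha.2.2 φ).1.const_mul ((σ * s : ℝ) : ℂ))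
  have hval : ∫ t, extend φ (star (a t) * (σ • (x t : 𝓜(ℂ, A))
      - algebraMap ℝ 𝓜(ℂ, A) (σ * s)) * a t) ∂μ = ((σ * s * (1 - l.re) : ℝ) : ℂ) := by
    simp only [hDint]
    rw [integral_sub ((hxy.2 φ).1.const_mul (σ : ℂ)) ((ha.2.2 φ).1.const_mul ((σ * s : ℝ) : ℂ)),
      integral_const_mul, integral_const_mul, ← (hxy.2 φ).2, ← (ha.2.2 φ).2, extend_coe, hκ, hψs,
      ← hl]
    push_cast
    rw [hlre]
    ring
  have hD := fun t => exists_pos_algebraMap_le (hX t) fun p hp => hσ p (hxI t hp)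
  have hint : Integrable (fun t => extend φ (star (a t) * (σ • (x t : 𝓜(ℂ, A))
      - algebraMap ℝ 𝓜(ℂ, A) (σ * s)) * a t)) μ := by
    simp only [hDint]; exact hi
  have hle : σ * s * (1 - l.re) ≤ 0 := by
    rcases hl' with h | h
    · simp [h]
    · exact mul_nonpos_of_nonpos_of_nonneg h.le (by linarith)
  have hl2 : l = 0 := ha.extend_one_eq_zero hφ hD hint (by
    rw [hval]; exact_mod_cast hle)
  -- the integral of the nonnegative function `φ(a* D a)` is `σ s`, which is negative
  rcases hl' with h | h
  · exact one_ne_zero (h.symm.trans hl2)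
  · have h1 : 0 ≤ ∫ t, extend φ (star (a t) * (σ • (x t : 𝓜(ℂ, A))
        - algebraMap ℝ 𝓜(ℂ, A) (σ * s)) * a t) ∂μ :=
      integral_nonneg_of_ae (Eventually.of_forall fun t => by
        obtain ⟨δ, hδ, hle⟩ := hD t
        refine extend_nonneg hφ (star_left_conjugate_nonneg (le_trans ?_ hle) _)
        rw [Algebra.algebraMap_eq_smul_one]
        exact smul_nonneg hδ.le zero_le_one)
    rw [hval, hl2, Complex.zero_re, sub_zero, mul_one] at h1
    have : 0 ≤ σ * s := by exact_mod_cast h1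
    linarith

/-- The integral of `a* f(x) a` dominates the affine minorants of `f` evaluated at `∫ a* x a`. -/
theorem IsUnitalColumnField.affineValue_le (ha : IsUnitalColumnField μ a) {n : ℕ}
    {x : T → Fin n → 𝓜(ℂ, A)} (hx : ∀ t, IsAbelianTuple (x t)) {S : Set (Fin n → ℝ)}
    (hxS : ∀ t, jointSpectrum (x t) ⊆ S) {y : Fin n → 𝓜(ℂ, A)}
    (hy : ∀ i, IsFieldIntegral μ (fun t => star (a t) * x t i * a t) (y i))
    {f : (Fin n → ℝ) → ℝ} (hf : ContinuousOn f S) {F : 𝓜(ℂ, A)}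
    (hF : IsFieldIntegral μ (fun t => star (a t) * calculus (x t) f * a t) F)
    {q : (Fin n → ℝ) × ℝ} (hq : ∀ s ∈ S, affine q s ≤ f s) : affineValue q y ≤ F := by
  rw [← sub_nonneg]
  refine nonneg_of_forall_extend_nonneg fun φ hφ => ?_
  have h1 : ∀ t, extend φ (star (a t) * affineValue q (x t) * a t)
      = ∑ i, (q.1 i : ℂ) * extend φ (star (a t) * x t i * a t)
        + (q.2 : ℂ) * extend φ (star (a t) * a t) := fun t => by
    simp only [affineValue, mul_add, add_mul, Finset.mul_sum, Finset.sum_mul, extend_add,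
      extend_sum, mul_smul_comm, smul_mul_assoc, extend_smul, mul_one]
  have i1 : ∀ i ∈ (Finset.univ : Finset (Fin n)), Integrable
      (fun t => (q.1 i : ℂ) * extend φ (star (a t) * x t i * a t)) μ := fun i _ =>
    ((hy i).2 φ).1.const_mul _
  have i2 : Integrable (fun t => (q.2 : ℂ) * extend φ (star (a t) * a t)) μ :=
    (ha.2.2 φ).1.const_mul _
  have h2 : extend φ (affineValue q y)
      = ∫ t, extend φ (star (a t) * affineValue q (x t) * a t) ∂μ := by
    simp only [h1]
    rw [integral_add (integrable_finsetSum _ i1) i2, integral_finsetSum _ i1,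
      integral_const_mul, ← (ha.2.2 φ).2]
    simp only [integral_const_mul, ← ((hy _).2 φ).2, affineValue, extend_add, extend_sum,
      extend_smul]
  have i3 : Integrable (fun t => extend φ (star (a t) * affineValue q (x t) * a t)) μ := by
    simp only [h1]
    exact (integrable_finsetSum _ i1).add i2
  rw [extend_sub, h2, (hF.2 φ).2, ← integral_sub (hF.2 φ).1 i3]
  refine integral_nonneg_of_ae (Eventually.of_forall fun t => ?_)
  rw [Pi.zero_apply, sub_nonneg]
  refine extend_mono hφ (star_left_conjugate_le_conjugate ?_ _)
  rw [← (hx t).calculus_affine q]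
  exact (hx t).calculus_mono (continuous_affine q).continuousOn (hf.mono (hxS t))
    fun s hs => hq s (hxS t hs)

end Bounded

/-! ### The Pedersen ideal inside the multiplier algebra -/

section CoeIdeal

variable {A : Type*} [NonUnitalCStarAlgebra A]

variable (A) in
/-- The algebra `A` as an ideal of `M(A)`. -/
noncomputable def coeIdeal : Submodule ℂ 𝓜(ℂ, A) :=
  LinearMap.range ((DoubleCentralizer.coeHom (𝕜 := ℂ) (A := A) : A →ₗ[ℂ] 𝓜(ℂ, A)))

theorem mem_coeIdeal {m : 𝓜(ℂ, A)} : m ∈ coeIdeal A ↔ ∃ x : A, (x : 𝓜(ℂ, A)) = m := Iff.rfl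

theorem coe_mem_coeIdeal (x : A) : (x : 𝓜(ℂ, A)) ∈ coeIdeal A := ⟨x, rfl⟩

theorem mul_mem_coeIdeal_left (m : 𝓜(ℂ, A)) {b : 𝓜(ℂ, A)} (hb : b ∈ coeIdeal A) :
    m * b ∈ coeIdeal A := by
  obtain ⟨x, rfl⟩ := mem_coeIdeal.mp hb
  rw [mul_coe]
  exact coe_mem_coeIdeal _

theorem mul_mem_coeIdeal_right {b : 𝓜(ℂ, A)} (hb : b ∈ coeIdeal A) (m : 𝓜(ℂ, A)) :
    b * m ∈ coeIdeal A := by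
  obtain ⟨x, rfl⟩ := mem_coeIdeal.mp hb
  rw [coe_mul_eq]
  exact coe_mem_coeIdeal _

theorem real_smul_mem_coeIdeal (r : ℝ) {b : 𝓜(ℂ, A)} (hb : b ∈ coeIdeal A) :
    r • b ∈ coeIdeal A := by
  rw [← Complex.coe_smul]
  exact (coeIdeal A).smul_mem _ hb

end CoeIdeal

section Cone

variable {A : Type*} [NonUnitalCStarAlgebra A] [PartialOrder A] [StarOrderedRing A]

/-- Positive elements of `A` have positive square roots in `A`. -/
theorem exists_sqrt_mem_coeIdeal {X : 𝓜(ℂ, A)} (hX : X ∈ coeIdeal A) (h0 : 0 ≤ X) :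
    ∃ S ∈ coeIdeal A, 0 ≤ S ∧ S * S = X := by
  obtain ⟨x, rfl⟩ := mem_coeIdeal.mp hX
  refine ⟨_, coe_mem_coeIdeal (CFC.sqrt x), coe_nonneg (CFC.sqrt_nonneg x), ?_⟩
  rw [← coe_mul, CFC.sqrt_mul_sqrt_self x (nonneg_of_coe_nonneg h0)]

variable (A) in
/-- The positive part of the Pedersen ideal, as a subset of `M(A)`. -/
def cone : Set 𝓜(ℂ, A) := {X | ∃ x ∈ pedersenCone A, (x : 𝓜(ℂ, A)) = X}

theorem mem_cone_iff {X : 𝓜(ℂ, A)} : X ∈ cone A ↔ X ∈ coeIdeal A ∧ 0 ≤ X ∧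
    ∃ (m : ℕ) (u e : Fin m → 𝓜(ℂ, A)), (∀ k, u k ∈ coeIdeal A ∧ 0 ≤ u k ∧ e k ∈ coeIdeal A ∧
      0 ≤ e k ∧ u k = u k * e k) ∧ X ≤ ∑ k, u k := by
  have hsum : ∀ {m : ℕ} (u : Fin m → A), ((∑ k, u k : A) : 𝓜(ℂ, A)) = ∑ k, (u k : 𝓜(ℂ, A)) :=
    fun u => map_sum (DoubleCentralizer.coeHom (𝕜 := ℂ) (A := A)) u _
  constructor
  · rintro ⟨x, ⟨hx0, m, u, e, hue, hle⟩, rfl⟩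
    refine ⟨coe_mem_coeIdeal x, coe_nonneg hx0, m, fun k => u k, fun k => e k, fun k =>
      ⟨coe_mem_coeIdeal _, coe_nonneg (hue k).1, coe_mem_coeIdeal _,
        coe_nonneg (hue k).2.1, ?_⟩, ?_⟩
    · rw [← coe_mul, ← (hue k).2.2]
    · rw [← hsum]
      exact coe_mono hle
  · rintro ⟨hX, hX0, m, u, e, hue, hle⟩
    obtain ⟨x, rfl⟩ := mem_coeIdeal.mp hX
    choose u' hu' using fun k => mem_coeIdeal.mp (hue k).1
    choose e' he' using fun k => mem_coeIdeal.mp (hue k).2.2.1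
    refine ⟨x, ⟨nonneg_of_coe_nonneg hX0, m, u', e', fun k => ⟨?_, ?_, ?_⟩, ?_⟩, rfl⟩
    · rw [← coe_nonneg_iff, hu']; exact (hue k).2.1
    · rw [← coe_nonneg_iff, he']; exact (hue k).2.2.2.1
    · apply coe_injective
      change (u' k : 𝓜(ℂ, A)) = ((u' k * e' k : A) : 𝓜(ℂ, A))
      rw [coe_mul, hu', he']
      exact (hue k).2.2.2.2
    · rw [← coe_le_coe_iff, hsum]
      simpa only [hu'] using hle

theorem cone_subset_coeIdeal {X : 𝓜(ℂ, A)} (hX : X ∈ cone A) : X ∈ coeIdeal A :=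
  (mem_cone_iff.mp hX).1

theorem nonneg_of_mem_cone {X : 𝓜(ℂ, A)} (hX : X ∈ cone A) : 0 ≤ X := (mem_cone_iff.mp hX).2.1

theorem mem_cone_of_le {X Y : 𝓜(ℂ, A)} (hX : X ∈ cone A) (hY : Y ∈ coeIdeal A) (h0 : 0 ≤ Y)
    (hYX : Y ≤ X) : Y ∈ cone A := by
  obtain ⟨-, -, m, u, e, hue, hle⟩ := mem_cone_iff.mp hX
  exact mem_cone_iff.mpr ⟨hY, h0, m, u, e, hue, hYX.trans hle⟩

theorem mem_cone_of_local_unit {U E : 𝓜(ℂ, A)} (hU : U ∈ coeIdeal A) (hU0 : 0 ≤ U)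
    (hE : E ∈ coeIdeal A) (hE0 : 0 ≤ E) (hUE : U = U * E) : U ∈ cone A :=
  mem_cone_iff.mpr ⟨hU, hU0, 1, fun _ => U, fun _ => E, fun _ => ⟨hU, hU0, hE, hE0, hUE⟩, by simp⟩

theorem add_mem_cone {X Y : 𝓜(ℂ, A)} (hX : X ∈ cone A) (hY : Y ∈ cone A) : X + Y ∈ cone A := by
  obtain ⟨hX1, hX0, m, u, e, hue, hle⟩ := mem_cone_iff.mp hX
  obtain ⟨hY1, hY0, m', u', e', hue', hle'⟩ := mem_cone_iff.mp hY
  refine mem_cone_iff.mpr ⟨(coeIdeal A).add_mem hX1 hY1, add_nonneg hX0 hY0, m + m',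
    Fin.append u u', Fin.append e e', fun k => ?_, ?_⟩
  · refine Fin.addCases (fun i => ?_) (fun i => ?_) k
    · simpa only [Fin.append_left] using hue i
    · simpa only [Fin.append_right] using hue' i
  · simp only [Fin.sum_univ_add, Fin.append_left, Fin.append_right]
    exact add_le_add hle hle'

theorem smul_mem_cone {r : ℝ} (hr : 0 ≤ r) {X : 𝓜(ℂ, A)} (hX : X ∈ cone A) : r • X ∈ cone A := by
  obtain ⟨hX1, hX0, m, u, e, hue, hle⟩ := mem_cone_iff.mp hX
  refine mem_cone_iff.mpr ⟨real_smul_mem_coeIdeal r hX1, smul_nonneg hr hX0, m,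
    fun k => r • u k, e, fun k => ⟨real_smul_mem_coeIdeal r (hue k).1, smul_nonneg hr (hue k).2.1,
      (hue k).2.2.1, (hue k).2.2.2.1, ?_⟩, ?_⟩
  · rw [smul_mul_assoc, ← (hue k).2.2.2.2]
  · rw [← Finset.smul_sum]
    exact smul_le_smul_of_nonneg_left hle hr

theorem unitary_conj_mem_cone {U X : 𝓜(ℂ, A)} (hU : U ∈ unitary 𝓜(ℂ, A)) (hX : X ∈ cone A) :
    star U * X * U ∈ cone A := by
  obtain ⟨hX1, hX0, m, u, e, hue, hle⟩ := mem_cone_iff.mp hX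
  have hmem : ∀ {b}, b ∈ coeIdeal A → star U * b * U ∈ coeIdeal A := fun hb =>
    mul_mem_coeIdeal_right (mul_mem_coeIdeal_left _ hb) _
  refine mem_cone_iff.mpr ⟨hmem hX1, star_left_conjugate_nonneg hX0 U, m,
    fun k => star U * u k * U, fun k => star U * e k * U, fun k => ⟨hmem (hue k).1,
      star_left_conjugate_nonneg (hue k).2.1 U, hmem (hue k).2.2.1,
      star_left_conjugate_nonneg (hue k).2.2.2.1 U, ?_⟩, ?_⟩
  · have h1 : star U * u k * U * (star U * e k * U)
        = star U * (u k * ((U * star U) * e k)) * U := by simp only [mul_assoc]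
    rw [h1, Unitary.mul_star_self_of_mem hU, one_mul, ← (hue k).2.2.2.2]
  · rw [← Finset.sum_mul, ← Finset.mul_sum]
    exact star_left_conjugate_le_conjugate hle U

theorem mul_self_le_norm_smul {B : Type*} [CStarAlgebra B] [PartialOrder B] [StarOrderedRing B]
    {X : B} (hX : 0 ≤ X) : X * X ≤ ‖X‖ • X := by
  have h1 : CFC.sqrt X * CFC.sqrt X = X := CFC.sqrt_mul_sqrt_self X hX
  have hs : star (CFC.sqrt X) = CFC.sqrt X := (IsSelfAdjoint.of_nonneg (CFC.sqrt_nonneg X)).star_eq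
  have h2 := CStarAlgebra.star_left_conjugate_le_norm_smul (a := CFC.sqrt X)
    (IsSelfAdjoint.of_nonneg hX)
  rw [hs, h1] at h2
  refine le_of_eq_of_le ?_ h2
  generalize CFC.sqrt X = S at h1
  rw [← h1]
  simp only [mul_assoc]

theorem star_add_mul_add_le {B : Type*} [CStarAlgebra B] [PartialOrder B] [StarOrderedRing B]
    (a b : B) : star (a + b) * (a + b) ≤ (2 : ℝ) • (star a * a + star b * b) := by
  rw [← sub_nonneg]
  have : (2 : ℝ) • (star a * a + star b * b) - star (a + b) * (a + b)
      = star (a - b) * (a - b) := by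
    rw [two_smul, star_add, star_sub]
    noncomm_ring
  rw [this]
  exact star_mul_self_nonneg _

variable (A) in
/-- The elements `a` of `A` such that `a* a` lies in the Pedersen ideal. -/
def squareIdeal : Set 𝓜(ℂ, A) := {a | a ∈ coeIdeal A ∧ star a * a ∈ cone A}

theorem add_mem_squareIdeal {a b : 𝓜(ℂ, A)} (ha : a ∈ squareIdeal A) (hb : b ∈ squareIdeal A) :
    a + b ∈ squareIdeal A :=
  ⟨(coeIdeal A).add_mem ha.1 hb.1, mem_cone_of_le (smul_mem_cone zero_le_two
    (add_mem_cone ha.2 hb.2)) (mul_mem_coeIdeal_left _ ((coeIdeal A).add_mem ha.1 hb.1))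
    (star_mul_self_nonneg _) (star_add_mul_add_le a b)⟩

theorem mul_mem_squareIdeal_left (m : 𝓜(ℂ, A)) {a : 𝓜(ℂ, A)} (ha : a ∈ squareIdeal A) :
    m * a ∈ squareIdeal A := by
  have h1 : m * a ∈ coeIdeal A := mul_mem_coeIdeal_left m ha.1
  refine ⟨h1, mem_cone_of_le (smul_mem_cone (norm_nonneg (star m * m)) ha.2)
    (mul_mem_coeIdeal_left _ h1) (star_mul_self_nonneg _) ?_⟩
  have := CStarAlgebra.star_left_conjugate_le_norm_smul (a := a) (IsSelfAdjoint.star_mul_self m)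
  refine le_of_eq_of_le ?_ this
  rw [star_mul]
  simp only [mul_assoc]

theorem smul_mem_squareIdeal (c : ℂ) {a : 𝓜(ℂ, A)} (ha : a ∈ squareIdeal A) :
    c • a ∈ squareIdeal A := by
  have := mul_mem_squareIdeal_left (c • 1) ha
  rwa [smul_mul_assoc, one_mul] at this

/-- Local units are carried along by unitaries, and these span `M(A)`. -/
theorem mul_mem_squareIdeal_right {a : 𝓜(ℂ, A)} (ha : a ∈ squareIdeal A) (m : 𝓜(ℂ, A)) :
    a * m ∈ squareIdeal A := by
  have hm : m ∈ Submodule.span ℂ (unitary 𝓜(ℂ, A) : Set 𝓜(ℂ, A)) := by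
    rw [CStarAlgebra.span_unitary]; trivial
  induction hm using Submodule.span_induction with
  | mem U hU =>
    refine ⟨mul_mem_coeIdeal_right ha.1 U, ?_⟩
    have := unitary_conj_mem_cone hU ha.2
    rw [star_mul]
    simpa only [mul_assoc] using this
  | zero =>
    have := smul_mem_squareIdeal 0 ha
    rwa [zero_smul, ← mul_zero a] at this
  | add m k _ _ hm hk =>
    rw [mul_add]
    exact add_mem_squareIdeal hm hk
  | smul c m _ hm =>
    rw [mul_smul_comm]
    exact smul_mem_squareIdeal c hm

theorem mem_squareIdeal_of_mem_cone {X : 𝓜(ℂ, A)} (hX : X ∈ cone A) : X ∈ squareIdeal A := by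
  have h0 := nonneg_of_mem_cone hX
  have h1 := cone_subset_coeIdeal hX
  refine ⟨h1, mem_cone_of_le (smul_mem_cone (norm_nonneg X) hX) (mul_mem_coeIdeal_left _ h1)
    (star_mul_self_nonneg _) ?_⟩
  rw [(IsSelfAdjoint.of_nonneg h0).star_eq]
  exact mul_self_le_norm_smul h0

theorem mem_squareIdeal_of_mem_span {Z : 𝓜(ℂ, A)} (hZ : Z ∈ Submodule.span ℂ (cone A)) :
    Z ∈ squareIdeal A := by
  induction hZ using Submodule.span_induction with
  | mem X hX => exact mem_squareIdeal_of_mem_cone hX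
  | zero =>
    refine ⟨zero_mem _, ?_⟩
    rw [mul_zero]
    exact mem_cone_iff.mpr ⟨zero_mem _, le_rfl, 0, Fin.elim0, Fin.elim0, fun k => k.elim0, by simp⟩
  | add a b _ _ ha hb => exact add_mem_squareIdeal ha hb
  | smul c a _ ha => exact smul_mem_squareIdeal c ha

/-- The polarization identity. -/
theorem four_smul_star_mul {B : Type*} [CStarAlgebra B] (a b : B) :
    (4 : ℂ) • (star a * b) = star (a + (1 : ℂ) • b) * (a + (1 : ℂ) • b)
      - star (a + (-1 : ℂ) • b) * (a + (-1 : ℂ) • b)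
      - Complex.I • (star (a + Complex.I • b) * (a + Complex.I • b)
        - star (a + (-Complex.I) • b) * (a + (-Complex.I) • b)) := by
  have hexp : ∀ c : ℂ, star (a + c • b) * (a + c • b)
      = star a * a + c • (star a * b) + star c • (star b * a) + (star c * c) • (star b * b) := by
    intro c
    simp only [star_add, star_smul, add_mul, mul_add, smul_mul_assoc, mul_smul_comm, smul_smul,
      smul_add]
    rw [mul_comm c (star c)]
    abel
  simp only [hexp, star_neg, star_one, Complex.star_def, Complex.conj_I]
  have hI : Complex.I * Complex.I = -1 := Complex.I_mul_I
  match_scalars <;> norm_num <;>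
    first | linear_combination 2 * hI | linear_combination (-2 : ℂ) * hI

theorem star_mul_mem_span {a b : 𝓜(ℂ, A)} (ha : a ∈ squareIdeal A) (hb : b ∈ squareIdeal A) :
    star a * b ∈ Submodule.span ℂ (cone A) := by
  have hmem : ∀ c : ℂ, star (a + c • b) * (a + c • b) ∈ Submodule.span ℂ (cone A) := fun c =>
    Submodule.subset_span (add_mem_squareIdeal ha (smul_mem_squareIdeal c hb)).2
  have : star a * b = (4 : ℂ)⁻¹ • ((4 : ℂ) • (star a * b)) := by
    rw [smul_smul, inv_mul_cancel₀ (by norm_num), one_smul]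
  rw [this, four_smul_star_mul]
  exact Submodule.smul_mem _ _ (Submodule.sub_mem _ (Submodule.sub_mem _ (hmem _) (hmem _))
    (Submodule.smul_mem _ _ (Submodule.sub_mem _ (hmem _) (hmem _))))

theorem exists_sqrt_mem_squareIdeal {X : 𝓜(ℂ, A)} (hX : X ∈ cone A) :
    ∃ S ∈ squareIdeal A, 0 ≤ S ∧ S * S = X := by
  obtain ⟨S, hS, hS0, hSX⟩ := exists_sqrt_mem_coeIdeal (cone_subset_coeIdeal hX)
    (nonneg_of_mem_cone hX)
  refine ⟨S, ⟨hS, ?_⟩, hS0, hSX⟩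
  rwa [(IsSelfAdjoint.of_nonneg hS0).star_eq, hSX]

/-- The Pedersen ideal is invariant under all compressions by multipliers, because `X^{1/2} m` has
a square in it. -/
theorem star_conj_mem_cone (m : 𝓜(ℂ, A)) {X : 𝓜(ℂ, A)} (hX : X ∈ cone A) :
    star m * X * m ∈ cone A := by
  obtain ⟨S, hS, hS0, rfl⟩ := exists_sqrt_mem_squareIdeal hX
  have := (mul_mem_squareIdeal_right hS m).2
  rw [star_mul, (IsSelfAdjoint.of_nonneg hS0).star_eq] at this
  simpa only [mul_assoc] using this

end Cone

/-! ### Elements with local units from the functional calculus -/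

section LocalUnits

variable {A : Type*} [NonUnitalCStarAlgebra A] [PartialOrder A] [StarOrderedRing A]

/-- A function that vanishes near `0` takes values in the Pedersen ideal. -/
theorem calculus_mem_cone {n : ℕ} {y : Fin n → A} (hy : IsAbelianTuple y)
    {h : (Fin n → ℝ) → ℝ} (hh : Continuous h) (h0 : ∀ s, 0 ≤ h s) {ρ : ℝ} (hρ : 0 < ρ)
    (hv : ∀ s, ∑ i, s i * s i < ρ → h s = 0) :
    calculus (fun i => (y i : 𝓜(ℂ, A))) h ∈ cone A := by
  have hY := isAbelianTuple_coe hy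
  set Y : Fin n → 𝓜(ℂ, A) := fun i => y i
  set N : (Fin n → ℝ) → ℝ := fun s => ∑ i, s i * s i with hN
  have hNc : Continuous N := by fun_prop
  have hN0 : ∀ s, 0 ≤ N s := fun s => Finset.sum_nonneg fun i _ => mul_self_nonneg _
  have hmax : ∀ s, max (N s) ρ ≠ 0 := fun s => (lt_max_of_lt_right hρ).ne'
  have hmaxc : Continuous fun s => max (N s) ρ := hNc.max continuous_const
  have hNmem : calculus Y N ∈ coeIdeal A := by
    rw [hN, hY.calculus_sum _ _ fun k _ => by fun_prop]
    refine Submodule.sum_mem _ fun i _ => ?_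
    rw [hY.calculus_mul (by fun_prop) (by fun_prop), hY.calculus_coord]
    exact mul_mem_coeIdeal_left _ (coe_mem_coeIdeal _)
  have hmem : ∀ g : (Fin n → ℝ) → ℝ, Continuous g →
      calculus Y (fun s => N s * g s) ∈ coeIdeal A := fun g hg => by
    rw [hY.calculus_mul hNc.continuousOn hg.continuousOn]
    exact mul_mem_coeIdeal_right hNmem _
  have hg1 : Continuous fun s => h s / max (N s) ρ := hh.div hmaxc hmax
  have hg2 : Continuous fun s => (max (N s) ρ)⁻¹ := hmaxc.inv₀ hmax
  have hg3 : Continuous fun s => N s * (max (N s) ρ)⁻¹ := hNc.mul hg2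
  have e1 : h = fun s => N s * (h s / max (N s) ρ) := by
    funext s
    rcases lt_or_ge (N s) ρ with hs | hs
    · rw [hv s hs]; simp
    · rw [max_eq_left hs, mul_div_cancel₀]
      exact (hρ.trans_le hs).ne'
  have e2 : h = fun s => h s * (N s * (max (N s) ρ)⁻¹) := by
    funext s
    rcases lt_or_ge (N s) ρ with hs | hs
    · rw [hv s hs]; simp
    · rw [max_eq_left hs, mul_inv_cancel₀ (hρ.trans_le hs).ne', mul_one]
  refine mem_cone_of_local_unit (E := calculus Y fun s => N s * (max (N s) ρ)⁻¹) ?_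
    (hY.calculus_nonneg hh.continuousOn fun s _ => h0 s) (hmem _ hg2)
    (hY.calculus_nonneg hg3.continuousOn fun s _ =>
      mul_nonneg (hN0 s) (inv_nonneg.mpr (hρ.le.trans (le_max_right _ _)))) ?_
  · rw [e1]; exact hmem _ hg1
  · rw [← hY.calculus_mul hh.continuousOn hg3.continuousOn, ← e2]

theorem isAbelianTuple_single {R : Type*} [Mul R] [Star R] {x : R} (hx : IsSelfAdjoint x) :
    IsAbelianTuple fun _ : Fin 1 => x :=
  ⟨fun _ => hx, fun _ _ => Commute.refl x⟩

theorem nonneg_of_mem_jointSpectrum {B : Type*} [CStarAlgebra B] [PartialOrder B]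
    [StarOrderedRing B] {n : ℕ} {x : Fin n → B} (hx : IsAbelianTuple x) {i : Fin n}
    (h0 : 0 ≤ x i) {s : Fin n → ℝ} (hs : s ∈ jointSpectrum x) : 0 ≤ s i := by
  obtain ⟨χ, rfl⟩ := hs
  exact spectrum_nonneg_of_nonneg h0 (jointPoint_mem_spectrum hx χ i)

/-- The element `(X - ε)₊` lies in the Pedersen ideal. -/
theorem exists_mem_cone_le {X : 𝓜(ℂ, A)} (hX : X ∈ coeIdeal A) (h0 : 0 ≤ X) {ε : ℝ} (hε : 0 < ε) :
    ∃ W ∈ cone A, W ≤ X ∧ ‖X - W‖ ≤ ε := by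
  obtain ⟨x, rfl⟩ := mem_coeIdeal.mp hX
  have hx : IsAbelianTuple fun _ : Fin 1 => x :=
    isAbelianTuple_single (IsSelfAdjoint.of_nonneg (nonneg_of_coe_nonneg h0))
  have hX := isAbelianTuple_coe hx
  have hc : Continuous fun s : Fin 1 → ℝ => max (s 0 - ε) 0 := by fun_prop
  have hi : Continuous fun s : Fin 1 → ℝ => s 0 := by fun_prop
  have hsub : Continuous fun s : Fin 1 → ℝ => s 0 - max (s 0 - ε) 0 := hi.sub hc
  set W := calculus (fun _ : Fin 1 => (x : 𝓜(ℂ, A))) fun s => max (s 0 - ε) 0 with hW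
  have hWc : W ∈ cone A := by
    refine calculus_mem_cone hx hc (fun s => le_max_right _ _) (ρ := ε * ε) (by positivity)
      fun s hs => ?_
    rw [Fin.sum_univ_one] at hs
    have : s 0 < ε := by nlinarith
    exact max_eq_right (by linarith)
  have hx0 : (x : 𝓜(ℂ, A)) = calculus (fun _ : Fin 1 => (x : 𝓜(ℂ, A))) fun s => s 0 :=
    (hX.calculus_coord 0).symm
  refine ⟨W, hWc, ?_, ?_⟩
  · rw [hx0]
    refine hX.calculus_mono hc.continuousOn hi.continuousOn fun s hs => ?_
    have := nonneg_of_mem_jointSpectrum hX (i := 0) h0 hs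
    exact max_le (by linarith) this
  · have : (x : 𝓜(ℂ, A)) - W = calculus (fun _ : Fin 1 => (x : 𝓜(ℂ, A)))
        fun s => s 0 - max (s 0 - ε) 0 := by
      rw [hX.calculus_sub hi.continuousOn hc.continuousOn, ← hx0]
    rw [this]
    refine hX.norm_calculus_le hsub.continuousOn hε.le fun s hs => ?_
    have := nonneg_of_mem_jointSpectrum hX (i := 0) h0 hs
    rw [abs_le]
    rcases le_total (s 0 - ε) 0 with h | h
    · rw [max_eq_right h]; constructor <;> linarith
    · rw [max_eq_left h]; constructor <;> linarith

/-- If `U` has a local unit in `A`, then it has one in the Pedersen ideal. -/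
theorem exists_local_unit_mem_cone {U E : 𝓜(ℂ, A)} (hU : IsSelfAdjoint U) (hE : E ∈ coeIdeal A)
    (hE0 : 0 ≤ E) (hUE : U = U * E) : ∃ θ ∈ cone A, θ * U = U := by
  obtain ⟨e, rfl⟩ := mem_coeIdeal.mp hE
  have he : IsAbelianTuple fun _ : Fin 1 => e :=
    isAbelianTuple_single (IsSelfAdjoint.of_nonneg (nonneg_of_coe_nonneg hE0))
  have hE := isAbelianTuple_coe he
  have hEU : (e : 𝓜(ℂ, A)) * U = U := by
    have := congrArg star hUE
    rw [star_mul, hU.star_eq, (IsSelfAdjoint.of_nonneg hE0).star_eq] at this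
    exact this.symm
  have hc1 : Continuous fun s : Fin 1 → ℝ => max (s 0 - 1 / 2) 0 := by fun_prop
  have hc2 : Continuous fun s : Fin 1 → ℝ => max (1 / 2 - s 0) 0 := by fun_prop
  have hc3 : Continuous fun s : Fin 1 → ℝ => max (1 / 2 - s 0) 0 / max (1 - s 0) (1 / 2) := by
    refine hc2.div (by fun_prop) fun s => (lt_max_of_lt_right (by norm_num)).ne'
  have hi : Continuous fun s : Fin 1 → ℝ => s 0 := by fun_prop
  have hone : Continuous fun s : Fin 1 → ℝ => (1 : ℝ) := continuous_const
  have hhalf : Continuous fun s : Fin 1 → ℝ => (1 / 2 : ℝ) := continuous_const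
  set W := calculus (fun _ : Fin 1 => (e : 𝓜(ℂ, A))) fun s => max (s 0 - 1 / 2) 0 with hW
  set W' := calculus (fun _ : Fin 1 => (e : 𝓜(ℂ, A))) fun s => max (1 / 2 - s 0) 0 with hW'
  have hWcone : W ∈ cone A := calculus_mem_cone he hc1 (fun s => le_max_right _ _)
    (ρ := 1 / 4) (by norm_num) fun s hs => by
      rw [Fin.sum_univ_one] at hs
      have : s 0 < 1 / 2 := by nlinarith
      exact max_eq_right (by linarith)
  have hsub : W - W' = (e : 𝓜(ℂ, A)) - ((1 / 2 : ℝ) : ℂ) • 1 := by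
    have h1 : (e : 𝓜(ℂ, A)) - ((1 / 2 : ℝ) : ℂ) • 1
        = calculus (fun _ : Fin 1 => (e : 𝓜(ℂ, A))) fun s => s 0 - 1 / 2 := by
      rw [hE.calculus_sub hi.continuousOn hhalf.continuousOn, hE.calculus_const,
        hE.calculus_coord 0]
    rw [h1, hW, hW', ← hE.calculus_sub hc1.continuousOn hc2.continuousOn]
    refine congrArg (calculus _) (funext fun s => ?_)
    rcases le_total (s 0) (1 / 2) with h | h
    · rw [max_eq_right (by linarith), max_eq_left (by linarith)]; ring
    · rw [max_eq_left (by linarith), max_eq_right (by linarith)]; ring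
  have hW'U : W' * U = 0 := by
    have h1 : W' = calculus (fun _ : Fin 1 => (e : 𝓜(ℂ, A)))
        (fun s => max (1 / 2 - s 0) 0 / max (1 - s 0) (1 / 2)) * (1 - e) := by
      have h2 : (1 : 𝓜(ℂ, A)) - e = calculus (fun _ : Fin 1 => (e : 𝓜(ℂ, A)))
          fun s => 1 - s 0 := by
        rw [hE.calculus_sub hone.continuousOn hi.continuousOn, hE.calculus_const,
          hE.calculus_coord 0, Complex.ofReal_one, one_smul]
      have h3 : Continuous fun s : Fin 1 → ℝ => 1 - s 0 := hone.sub hi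
      rw [h2, ← hE.calculus_mul hc3.continuousOn h3.continuousOn, hW']
      refine congrArg (calculus _) (funext fun s => ?_)
      rcases le_total (s 0) (1 / 2) with h | h
      · rw [max_eq_left (show 1 / 2 ≤ 1 - s 0 by linarith), div_mul_cancel₀]
        linarith
      · rw [max_eq_right (show 1 / 2 - s 0 ≤ 0 by linarith), zero_div, zero_mul]
    rw [h1, mul_assoc, sub_mul, one_mul, hEU, sub_self, mul_zero]
  have hWU : W * U = ((1 / 2 : ℝ) : ℂ) • U := by
    have h1 : W * U = (W - W') * U := by rw [sub_mul, hW'U, sub_zero]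
    rw [h1, hsub, sub_mul, hEU, smul_mul_assoc, one_mul, Complex.coe_smul]
    nth_rw 1 [← one_smul ℝ U]
    rw [← sub_smul]
    norm_num
  refine ⟨(2 : ℝ) • W, smul_mem_cone zero_le_two hWcone, ?_⟩
  rw [smul_mul_assoc, hWU, Complex.coe_smul, smul_smul]
  norm_num

end LocalUnits

/-! ### Regularized inverses -/

section Resolvent

variable {B : Type*} [CStarAlgebra B]

theorem norm_sq_eq_norm_conj {S V X : B} (hS : star S = S) (hV : star V = V) (hX : S * S = X) :
    ‖S * V‖ ^ 2 = ‖V * X * V‖ := by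
  rw [sq, ← CStarRing.norm_star_mul_self, star_mul, hS, hV, ← hX]
  simp only [mul_assoc]

variable [PartialOrder B] [StarOrderedRing B]

/-- The elements are `H = (D + δ)^{-1/2}` and `V = (δ / (D + δ))^{1/2}`. -/
theorem exists_resolvent {D : B} (hD : 0 ≤ D) {δ : ℝ} (hδ : 0 < δ) :
    ∃ H V : B, star H = H ∧ star V = V ∧ H * D * H + V * V = 1 ∧ H * D = D * H ∧
      ‖V * D * V‖ ≤ δ ∧ ‖V‖ ≤ 1 ∧ ‖H * D * H‖ ≤ 1 := by
  have hx : IsAbelianTuple fun _ : Fin 1 => D := isAbelianTuple_single (IsSelfAdjoint.of_nonneg hD)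
  have hpos : ∀ s : Fin 1 → ℝ, 0 < |s 0| + δ := fun s => by positivity
  have hsq : ∀ s : Fin 1 → ℝ, √(|s 0| + δ) ≠ 0 := fun s => (Real.sqrt_pos.mpr (hpos s)).ne'
  have hms : ∀ s : Fin 1 → ℝ, √(|s 0| + δ) * √(|s 0| + δ) = |s 0| + δ := fun s =>
    Real.mul_self_sqrt (hpos s).le
  have hmd : √δ * √δ = δ := Real.mul_self_sqrt hδ.le
  have c0 : Continuous fun s : Fin 1 → ℝ => √(|s 0| + δ) := by fun_prop
  have c1 : Continuous fun s : Fin 1 → ℝ => (√(|s 0| + δ))⁻¹ := c0.inv₀ hsq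
  have c2 : Continuous fun s : Fin 1 → ℝ => √δ / √(|s 0| + δ) := continuous_const.div c0 hsq
  have ci : Continuous fun s : Fin 1 → ℝ => s 0 := by fun_prop
  have c1i : Continuous fun s : Fin 1 → ℝ => (√(|s 0| + δ))⁻¹ * s 0 := c1.mul ci
  have c2i : Continuous fun s : Fin 1 → ℝ => √δ / √(|s 0| + δ) * s 0 := c2.mul ci
  have c11 : Continuous fun s : Fin 1 → ℝ => (√(|s 0| + δ))⁻¹ * s 0 * (√(|s 0| + δ))⁻¹ := c1i.mul c1
  have c22 : Continuous fun s : Fin 1 → ℝ => √δ / √(|s 0| + δ) * (√δ / √(|s 0| + δ)) := c2.mul c2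
  have c2i2 : Continuous fun s : Fin 1 → ℝ =>
    √δ / √(|s 0| + δ) * s 0 * (√δ / √(|s 0| + δ)) := c2i.mul c2
  have hn : ∀ s ∈ jointSpectrum (fun _ : Fin 1 => D), 0 ≤ s 0 := fun s hs =>
    nonneg_of_mem_jointSpectrum hx (i := 0) hD hs
  have hDc : calculus (fun _ : Fin 1 => D) (fun s => s 0) = D := hx.calculus_coord 0
  set H := calculus (fun _ : Fin 1 => D) fun s => (√(|s 0| + δ))⁻¹ with hH
  set V := calculus (fun _ : Fin 1 => D) fun s => √δ / √(|s 0| + δ) with hV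
  have e1 : H * D * H = calculus (fun _ : Fin 1 => D)
      fun s => (√(|s 0| + δ))⁻¹ * s 0 * (√(|s 0| + δ))⁻¹ := by
    rw [hx.calculus_mul c1i.continuousOn c1.continuousOn,
      hx.calculus_mul c1.continuousOn ci.continuousOn, hDc]
  have e2 : V * D * V = calculus (fun _ : Fin 1 => D)
      fun s => √δ / √(|s 0| + δ) * s 0 * (√δ / √(|s 0| + δ)) := by
    rw [hx.calculus_mul c2i.continuousOn c2.continuousOn,
      hx.calculus_mul c2.continuousOn ci.continuousOn, hDc]
  have e3 : V * V = calculus (fun _ : Fin 1 => D)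
      fun s => √δ / √(|s 0| + δ) * (√δ / √(|s 0| + δ)) :=
    (hx.calculus_mul c2.continuousOn c2.continuousOn).symm
  have f1 : ∀ s : Fin 1 → ℝ, (√(|s 0| + δ))⁻¹ * s 0 * (√(|s 0| + δ))⁻¹ = s 0 / (|s 0| + δ) :=
    fun s => by
      rw [mul_right_comm, ← mul_inv, hms, div_eq_inv_mul]
  have f2 : ∀ s : Fin 1 → ℝ, √δ / √(|s 0| + δ) * s 0 * (√δ / √(|s 0| + δ))
      = δ * s 0 / (|s 0| + δ) := fun s => by
    rw [mul_right_comm, div_mul_div_comm, hms, hmd, div_mul_eq_mul_div]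
  have f3 : ∀ s : Fin 1 → ℝ, √δ / √(|s 0| + δ) * (√δ / √(|s 0| + δ)) = δ / (|s 0| + δ) :=
    fun s => by rw [div_mul_div_comm, hms, hmd]
  refine ⟨H, V, hx.star_calculus c1.continuousOn, hx.star_calculus c2.continuousOn, ?_, ?_, ?_, ?_,
    ?_⟩
  · rw [e1, e3, ← hx.calculus_add c11.continuousOn c22.continuousOn, ← one_smul ℂ (1 : B),
      ← Complex.ofReal_one, ← hx.calculus_const]
    refine hx.calculus_congr (c11.add c22).continuousOn fun s hs => ?_
    rw [f1, f3, abs_of_nonneg (hn s hs), ← add_div, div_self]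
    have := hn s hs
    positivity
  · refine hx.commute_of_mem (calculus_mem _ _) ?_
    exact mem_generated (fun _ : Fin 1 => D) 0
  · rw [e2]
    refine hx.norm_calculus_le c2i2.continuousOn hδ.le fun s hs => ?_
    have := hn s hs
    rw [f2, abs_of_nonneg this, abs_of_nonneg (by positivity), div_le_iff₀ (by positivity)]
    nlinarith [sq_nonneg δ]
  · refine hx.norm_calculus_le c2.continuousOn zero_le_one fun s hs => ?_
    rw [abs_of_nonneg (by positivity), div_le_one (Real.sqrt_pos.mpr (hpos s))]
    exact Real.sqrt_le_sqrt (by linarith [abs_nonneg (s 0)])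
  · rw [e1]
    refine hx.norm_calculus_le c11.continuousOn zero_le_one fun s hs => ?_
    have := hn s hs
    rw [f1, abs_of_nonneg this, abs_of_nonneg (by positivity), div_le_one (by positivity)]
    linarith

theorem norm_conj_le {V X Y : B} (hV : star V = V) (hX : 0 ≤ X) (hXY : X ≤ Y) :
    ‖V * X * V‖ ≤ ‖V * Y * V‖ := by
  have h1 := star_left_conjugate_nonneg hX V
  have h2 := star_left_conjugate_le_conjugate hXY V
  rw [hV] at h1 h2
  exact CStarAlgebra.norm_le_norm_of_nonneg_of_le h1 h2

theorem tendsto_sqrt_one_div_nat :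
    Tendsto (fun j : ℕ => √(1 / ((j : ℝ) + 1))) atTop (𝓝 0) := by
  have := (Real.continuous_sqrt.tendsto 0).comp
    (tendsto_one_div_add_atTop_nhds_zero_nat (𝕜 := ℝ))
  rw [Real.sqrt_zero] at this
  exact this

end Resolvent

/-! ### Unbounded functionals on the ideal `A` of `M(A)` -/

section Weight

variable {A : Type*} [NonUnitalCStarAlgebra A]

/-- The functional `φ` on `A`, regarded as a function on `M(A)` that vanishes off `A`. -/
noncomputable def weight (φ : A → ℝ≥0∞) : 𝓜(ℂ, A) → ℝ≥0∞ :=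
  Function.extend (fun x : A => (x : 𝓜(ℂ, A))) φ 0

theorem weight_coe (φ : A → ℝ≥0∞) (x : A) : weight φ (x : 𝓜(ℂ, A)) = φ x :=
  coe_injective.extend_apply φ 0 x

variable [PartialOrder A] [StarOrderedRing A] {φ : A → ℝ≥0∞} {X Y : 𝓜(ℂ, A)}

theorem IsCStarIntegral.weight_add (hφ : IsCStarIntegral φ) (hX : X ∈ coeIdeal A) (hX0 : 0 ≤ X)
    (hY : Y ∈ coeIdeal A) (hY0 : 0 ≤ Y) : weight φ (X + Y) = weight φ X + weight φ Y := by
  obtain ⟨x, rfl⟩ := mem_coeIdeal.mp hX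
  obtain ⟨y, rfl⟩ := mem_coeIdeal.mp hY
  rw [← coe_add, weight_coe, weight_coe, weight_coe,
    hφ.map_add x y (nonneg_of_coe_nonneg hX0) (nonneg_of_coe_nonneg hY0)]

theorem IsCStarIntegral.weight_smul (hφ : IsCStarIntegral φ) {r : ℝ} (hr : 0 ≤ r)
    (hX : X ∈ coeIdeal A) (hX0 : 0 ≤ X) : weight φ (r • X) = ENNReal.ofReal r * weight φ X := by
  obtain ⟨x, rfl⟩ := mem_coeIdeal.mp hX
  rw [← Complex.coe_smul, ← coe_smul, Complex.coe_smul, weight_coe, weight_coe,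
    hφ.map_smul r x hr (nonneg_of_coe_nonneg hX0)]

theorem IsCStarIntegral.weight_zero (hφ : IsCStarIntegral φ) :
    weight φ (0 : 𝓜(ℂ, A)) = 0 := by
  have := hφ.weight_smul (X := (0 : 𝓜(ℂ, A))) le_rfl (zero_mem _) le_rfl
  simpa using this

theorem IsCStarIntegral.weight_mono (hφ : IsCStarIntegral φ) (hX : X ∈ coeIdeal A) (hX0 : 0 ≤ X)
    (hY : Y ∈ coeIdeal A) (hXY : X ≤ Y) : weight φ X ≤ weight φ Y := by
  have := hφ.weight_add hX hX0 ((coeIdeal A).sub_mem hY hX) (sub_nonneg.mpr hXY)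
  rw [add_sub_cancel] at this
  rw [this]
  exact le_self_add

theorem IsCStarIntegral.weight_sum (hφ : IsCStarIntegral φ) {ι : Type*} (t : Finset ι)
    {g : ι → 𝓜(ℂ, A)} (hg : ∀ i, g i ∈ coeIdeal A) (hg0 : ∀ i, 0 ≤ g i) :
    weight φ (∑ i ∈ t, g i) = ∑ i ∈ t, weight φ (g i) := by
  classical
  induction t using Finset.induction_on with
  | empty => simpa using hφ.weight_zero
  | insert a t ha ih =>
    rw [Finset.sum_insert ha, Finset.sum_insert ha, hφ.weight_add (hg a) (hg0 a)
      (Submodule.sum_mem _ fun i _ => hg i) (Finset.sum_nonneg fun i _ => hg0 i), ih]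

omit [StarOrderedRing A] in
theorem IsCStarIntegral.weight_lt_top (hφ : IsCStarIntegral φ) (hX : X ∈ cone A) :
    weight φ X < ∞ := by
  obtain ⟨x, hx, rfl⟩ := hX
  rw [weight_coe]
  exact hφ.finite x (Submodule.subset_span hx) hx.1

/-- Lower semicontinuity, in terms of `M(A)`. -/
theorem IsCStarIntegral.eventually_lt_weight (hφ : IsCStarIntegral φ) {ι : Type*} {l : Filter ι}
    {g : ι → 𝓜(ℂ, A)} (hg : ∀ i, g i ∈ coeIdeal A) (hg0 : ∀ i, 0 ≤ g i)
    (hX : X ∈ coeIdeal A) (hX0 : 0 ≤ X) (hlim : Tendsto g l (𝓝 X)) {K : ℝ≥0∞}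
    (hK : K < weight φ X) : ∀ᶠ i in l, K < weight φ (g i) := by
  obtain ⟨x, rfl⟩ := mem_coeIdeal.mp hX
  choose g' hg' using fun i => mem_coeIdeal.mp (hg i)
  rw [weight_coe] at hK
  have h1 : Tendsto g' l (𝓝 x) := by
    rw [tendsto_iff_norm_sub_tendsto_zero] at hlim ⊢
    refine hlim.congr fun i => ?_
    rw [← hg' i, ← coe_sub, norm_coe]
  have h2 : Tendsto g' l (𝓝[{x | 0 ≤ x}] x) :=
    tendsto_nhdsWithin_iff.mpr ⟨h1, Eventually.of_forall fun i =>
      nonneg_of_coe_nonneg ((hg' i).symm ▸ hg0 i)⟩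
  filter_upwards [h2.eventually (hφ.lsc x (nonneg_of_coe_nonneg hX0) K hK)] with i hi
  rwa [← hg' i, weight_coe]

theorem IsCStarIntegral.weight_le_of_tendsto (hφ : IsCStarIntegral φ) {ι : Type*} {l : Filter ι}
    [l.NeBot] {g : ι → 𝓜(ℂ, A)} (hg : ∀ i, g i ∈ coeIdeal A) (hg0 : ∀ i, 0 ≤ g i)
    (hX : X ∈ coeIdeal A) (hX0 : 0 ≤ X) (hlim : Tendsto g l (𝓝 X)) {K : ℝ≥0∞}
    (hK : ∀ i, weight φ (g i) ≤ K) : weight φ X ≤ K := by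
  by_contra h
  obtain ⟨i, hi⟩ := (hφ.eventually_lt_weight hg hg0 hX hX0 hlim (not_le.mp h)).exists
  exact absurd (hK i) (not_le.mpr hi)

/-- Since `φ` is lower semicontinuous and finite at all `m* X m`, the Baire category theorem gives
a uniform bound. -/
theorem IsCStarIntegral.exists_weight_conj_le (hφ : IsCStarIntegral φ) (hX : X ∈ cone A) :
    ∃ C : ℝ, 0 ≤ C ∧ ∀ m : 𝓜(ℂ, A), weight φ (star m * X * m) ≤ ENNReal.ofReal (C * ‖m‖ ^ 2) := by
  have hmem : ∀ m, star m * X * m ∈ coeIdeal A := fun m =>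
    mul_mem_coeIdeal_right (mul_mem_coeIdeal_left _ (cone_subset_coeIdeal hX)) _
  have hpos : ∀ m, 0 ≤ star m * X * m := fun m =>
    star_left_conjugate_nonneg (nonneg_of_mem_cone hX) m
  have hcont : Continuous fun m : 𝓜(ℂ, A) => star m * X * m := by fun_prop
  have hclosed : ∀ n : ℕ, IsClosed {m : 𝓜(ℂ, A) | weight φ (star m * X * m) ≤ n} := by
    intro n
    rw [← isOpen_compl_iff, isOpen_iff_mem_nhds]
    intro m hm
    have hm' : (n : ℝ≥0∞) < weight φ (star m * X * m) := not_le.mp hm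
    filter_upwards [hφ.eventually_lt_weight hmem hpos (hmem m) (hpos m) (hcont.tendsto m) hm']
      with k hk
    exact not_le.mpr hk
  have huniv : ⋃ n : ℕ, {m : 𝓜(ℂ, A) | weight φ (star m * X * m) ≤ n} = Set.univ := by
    refine Set.eq_univ_of_forall fun m => Set.mem_iUnion.mpr ?_
    obtain ⟨n, hn⟩ := ENNReal.exists_nat_gt (hφ.weight_lt_top (star_conj_mem_cone m hX)).ne
    exact ⟨n, hn.le⟩
  obtain ⟨n, m₀, hm₀⟩ := nonempty_interior_of_iUnion_of_closed hclosed huniv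
  obtain ⟨r, hr, hball⟩ := Metric.isOpen_iff.mp isOpen_interior m₀ hm₀
  have hball' : ∀ m ∈ Metric.ball m₀ r, weight φ (star m * X * m) ≤ n := fun m hm => by
    have : m ∈ {m : 𝓜(ℂ, A) | weight φ (star m * X * m) ≤ n} := interior_subset (hball hm)
    exact this
  obtain ⟨S, hS, hS0, hSX⟩ := exists_sqrt_mem_squareIdeal hX
  have hSs : star S = S := (IsSelfAdjoint.of_nonneg hS0).star_eq
  have hsm : ∀ m, star (S * m) * (S * m) = star m * X * m := fun m => by
    rw [star_mul, hSs, ← hSX]; simp only [mul_assoc]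
  have hsmall : ∀ h : 𝓜(ℂ, A), ‖h‖ < r → weight φ (star h * X * h) ≤ ENNReal.ofReal (4 * n) := by
    intro h hh
    have h1 : star h * X * h ≤ (2 : ℝ) • (star (m₀ + h) * X * (m₀ + h) + star m₀ * X * m₀) := by
      have := star_add_mul_add_le (S * (m₀ + h)) (-(S * m₀))
      rw [← sub_eq_add_neg, ← mul_sub, add_sub_cancel_left, star_neg, neg_mul_neg, hsm, hsm,
        hsm] at this
      exact this
    have hsum := (coeIdeal A).add_mem (hmem (m₀ + h)) (hmem m₀)
    refine (hφ.weight_mono (hmem h) (hpos h) (real_smul_mem_coeIdeal 2 hsum) h1).trans ?_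
    rw [hφ.weight_smul zero_le_two hsum (add_nonneg (hpos _) (hpos _)),
      hφ.weight_add (hmem _) (hpos _) (hmem _) (hpos _)]
    have h2 := hball' (m₀ + h) (by simpa [Metric.mem_ball, dist_eq_norm] using hh)
    have h3 := hball' m₀ (Metric.mem_ball_self hr)
    calc ENNReal.ofReal 2 * (weight φ (star (m₀ + h) * X * (m₀ + h)) + weight φ (star m₀ * X * m₀))
        ≤ ENNReal.ofReal 2 * (n + n) := by gcongr
      _ = ENNReal.ofReal (4 * n) := by
          rw [← ENNReal.ofReal_natCast, ← ENNReal.ofReal_add (by positivity) (by positivity),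
            ← ENNReal.ofReal_mul zero_le_two]
          congr 1; ring
  refine ⟨16 * n / r ^ 2, by positivity, fun m => ?_⟩
  rcases eq_or_ne m 0 with rfl | hm
  · rw [mul_zero, hφ.weight_zero]
    positivity
  have hm0 : 0 < ‖m‖ := norm_pos_iff.mpr hm
  set κ : ℝ := 2 * ‖m‖ / r with hκ
  have hκ0 : 0 < κ := by positivity
  have h1 := hsmall (κ⁻¹ • m) (by
    rw [norm_smul, norm_inv, Real.norm_eq_abs, abs_of_pos hκ0, hκ, inv_div, div_mul_eq_mul_div,
      div_lt_iff₀ (by positivity)]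
    nlinarith)
  have h2 : star m * X * m = (κ ^ 2) • (star (κ⁻¹ • m) * X * (κ⁻¹ • m)) := by
    simp only [star_smul, star_trivial, smul_mul_assoc, mul_smul_comm, smul_smul]
    rw [show κ ^ 2 * (κ⁻¹ * κ⁻¹) = 1 by field_simp, one_smul]
  rw [h2, hφ.weight_smul (sq_nonneg κ) (hmem _) (hpos _)]
  refine (mul_le_mul_right h1 _).trans ?_
  rw [← ENNReal.ofReal_mul (sq_nonneg κ)]
  refine ENNReal.ofReal_le_ofReal (le_of_eq ?_)
  rw [hκ]
  field_simp
  ring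

/-- A positive `b ∈ A` with `b²` in the Pedersen ideal has finite weight.  If `b² ≤ u = ∑ u_k` with
local units `θ_k` for `u_k`, then `b` is the limit of the sums of
`z_k* z_k`, where `z_k = u_k^{1/2} (u + δ)^{-1/2} b^{1/2} = θ_k z_k` is bounded by `‖b‖^{1/2}`. -/
theorem IsCStarIntegral.weight_lt_top_of_sq_mem (hφ : IsCStarIntegral φ) {b : 𝓜(ℂ, A)}
    (hb : b ∈ coeIdeal A) (hb0 : 0 ≤ b) (hbb : b * b ∈ cone A) : weight φ b < ∞ := by
  obtain ⟨-, hbb0, n, u, e, hue, hle⟩ := mem_cone_iff.mp hbb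
  set U := ∑ k, u k with hU
  have hU0 : 0 ≤ U := Finset.sum_nonneg fun k _ => (hue k).2.1
  choose θ hθ hθu using fun k => exists_local_unit_mem_cone
    (IsSelfAdjoint.of_nonneg (hue k).2.1) (hue k).2.2.1 (hue k).2.2.2.1 (hue k).2.2.2.2
  choose s hs hs0 hsu using fun k => exists_sqrt_mem_coeIdeal (hue k).1 (hue k).2.1
  have hss : ∀ k, star (s k) = s k := fun k => (IsSelfAdjoint.of_nonneg (hs0 k)).star_eq
  have hθs : ∀ k, θ k * s k = s k := by
    intro k
    rw [← sub_eq_zero, ← CStarRing.mul_star_self_eq_zero_iff, star_sub, star_mul, hss k]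
    have h1 : (θ k * s k - s k) * (s k * star (θ k) - s k)
        = (θ k * (s k * s k) - s k * s k) * star (θ k) - (θ k * (s k * s k) - s k * s k) := by
      noncomm_ring
    rw [h1, hsu k, hθu k, sub_self, zero_mul, sub_zero]
  have hθ2 : ∀ k, star (θ k) * θ k ∈ cone A := fun k => (mem_squareIdeal_of_mem_cone (hθ k)).2
  choose C hC0 hC using fun k => hφ.exists_weight_conj_le (hθ2 k)
  obtain ⟨S, hS, hS0, hSb⟩ := exists_sqrt_mem_coeIdeal hb hb0
  have hSs : star S = S := (IsSelfAdjoint.of_nonneg hS0).star_eq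
  have hbs : star b = b := (IsSelfAdjoint.of_nonneg hb0).star_eq
  set K : ℝ≥0∞ := ∑ k, ENNReal.ofReal (C k * ‖b‖) with hK
  have hKtop : K < ∞ := ENNReal.sum_lt_top.mpr fun k _ => ENNReal.ofReal_lt_top
  refine lt_of_le_of_lt ?_ hKtop
  have key : ∀ j : ℕ, ∃ g ∈ coeIdeal A, 0 ≤ g ∧ ‖g - b‖ ≤ √(1 / ((j : ℝ) + 1)) ∧
      weight φ g ≤ K := by
    intro j
    set δ : ℝ := 1 / ((j : ℝ) + 1) with hδ
    have hδ0 : 0 < δ := by positivity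
    obtain ⟨H, V, hHs, hVs, h1, -, h2, h3, -⟩ := exists_resolvent hU0 hδ0
    set z : Fin n → 𝓜(ℂ, A) := fun k => s k * H * S with hz
    have hzz : ∀ k, star (z k) * z k = S * (H * u k * H) * S := fun k => by
      simp only [hz, star_mul, hSs, hHs, hss k, ← hsu k, mul_assoc]
    have hzmem : ∀ k, star (z k) * z k ∈ coeIdeal A := fun k =>
      mul_mem_coeIdeal_left _ (mul_mem_coeIdeal_left _ hS)
    have hsum : ∑ k, star (z k) * z k = S * (H * U * H) * S := by
      simp only [hzz, hU, Finset.mul_sum, Finset.sum_mul]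
    have hdiff : b - ∑ k, star (z k) * z k = star (V * S) * (V * S) := by
      have h4 : H * U * H = 1 - V * V := eq_sub_of_add_eq h1
      rw [hsum, h4, star_mul, hSs, hVs, ← hSb]
      noncomm_ring
    have hsumle : ∑ k, star (z k) * z k ≤ b := by
      rw [← sub_nonneg, hdiff]; exact star_mul_self_nonneg _
    refine ⟨∑ k, star (z k) * z k, Submodule.sum_mem _ fun k _ => hzmem k,
      Finset.sum_nonneg fun k _ => star_mul_self_nonneg _, ?_, ?_⟩
    · -- `‖V b V‖² ≤ ‖b V‖² = ‖V b² V‖ ≤ ‖V u V‖ ≤ δ`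
      rw [norm_sub_rev, hdiff]
      have h5 : ‖star (V * S) * (V * S)‖ = ‖V * b * V‖ := by
        rw [← norm_sq_eq_norm_conj hSs hVs hSb, CStarRing.norm_star_mul_self, ← sq,
          ← norm_star (V * S), star_mul, hSs, hVs]
      rw [h5]
      refine Real.le_sqrt_of_sq_le ?_
      calc ‖V * b * V‖ ^ 2 ≤ ‖b * V‖ ^ 2 := by
            rw [mul_assoc]
            gcongr
            exact (norm_mul_le _ _).trans (mul_le_of_le_one_left (norm_nonneg _) h3)
        _ = ‖V * (b * b) * V‖ := norm_sq_eq_norm_conj hbs hVs rfl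
        _ ≤ ‖V * U * V‖ := norm_conj_le hVs hbb0 hle
        _ ≤ δ := h2
    · rw [hφ.weight_sum _ hzmem fun k => star_mul_self_nonneg _]
      refine Finset.sum_le_sum fun k _ => ?_
      have h6 : star (z k) * z k = star (z k) * (star (θ k) * θ k) * z k := by
        have h7 : θ k * z k = z k := by
          simp only [hz, ← mul_assoc, hθs k]
        calc star (z k) * z k = star (θ k * z k) * (θ k * z k) := by rw [h7]
          _ = _ := by rw [star_mul]; simp only [mul_assoc]
      rw [h6]
      refine (hC k (z k)).trans (ENNReal.ofReal_le_ofReal ?_)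
      have h8 : ‖z k‖ ^ 2 ≤ ‖b‖ := by
        rw [sq, ← CStarRing.norm_star_mul_self]
        refine CStarAlgebra.norm_le_norm_of_nonneg_of_le (star_mul_self_nonneg _)
          (le_trans ?_ hsumle)
        exact Finset.single_le_sum (f := fun k => star (z k) * z k)
          (fun i _ => star_mul_self_nonneg _) (Finset.mem_univ k)
      have := hC0 k
      gcongr
  choose g hg hg0 hgb hgK using key
  refine hφ.weight_le_of_tendsto (l := atTop) hg hg0 hb hb0 ?_ hgK
  rw [tendsto_iff_norm_sub_tendsto_zero]
  exact squeeze_zero (fun _ => norm_nonneg _) hgb tendsto_sqrt_one_div_nat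

/-- If `c ≤ w* w`, then `φ(c)` is at most the lower limit of `φ(w* v² w)` along an approximate
unit: `c^{1/2}` is the limit of `r w` with the contractions `r = c^{1/2} (w* w + δ)^{-1} w*`. -/
theorem IsCStarIntegral.eventually_lt_weight_conj_sq (hφ : IsCStarIntegral φ) {l : Filter A}
    (hl : l.IsIncreasingApproximateUnit) {c w : 𝓜(ℂ, A)} (hc : c ∈ coeIdeal A) (hc0 : 0 ≤ c)
    (hcw : c ≤ star w * w) {K : ℝ≥0∞} (hK : K < weight φ c) :
    ∀ᶠ v : A in l, K < weight φ (star w * ((v : 𝓜(ℂ, A)) * v) * w) := by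
  obtain ⟨S, hS, hS0, hSc⟩ := exists_sqrt_mem_coeIdeal hc hc0
  have hSs : star S = S := (IsSelfAdjoint.of_nonneg hS0).star_eq
  have hw0 : 0 ≤ star w * w := star_mul_self_nonneg w
  have key : ∀ j : ℕ, ∃ r ∈ coeIdeal A, ‖r‖ ≤ 1 ∧ ‖r * w - S‖ ≤ √(1 / ((j : ℝ) + 1)) := by
    intro j
    have hδ0 : (0 : ℝ) < 1 / ((j : ℝ) + 1) := by positivity
    obtain ⟨H, V, hHs, hVs, h1, h1', h2, h3, h4⟩ := exists_resolvent hw0 hδ0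
    refine ⟨S * H * (H * star w), ?_, ?_, ?_⟩
    · exact mul_mem_coeIdeal_right (mul_mem_coeIdeal_right hS _) _
    · have h5 : ‖S * H‖ ≤ 1 := by
        rw [← sq_le_one_iff₀ (norm_nonneg _), norm_sq_eq_norm_conj hSs hHs hSc]
        exact (norm_conj_le hHs hc0 hcw).trans h4
      have h6 : ‖H * star w‖ ≤ 1 := by
        rw [← sq_le_one_iff₀ (norm_nonneg _), sq, ← CStarRing.norm_self_mul_star, star_mul,
          star_star, hHs]
        simpa only [mul_assoc] using h4
      exact (norm_mul_le _ _).trans (mul_le_one₀ h5 (norm_nonneg _) h6)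
    · have h7 : S * H * (H * star w) * w - S = -(S * V * V) := by
        have h8 : H * H * (star w * w) = 1 - V * V := by
          rw [mul_assoc, h1', ← mul_assoc]
          exact eq_sub_of_add_eq h1
        have h9 : S * H * (H * star w) * w = S * (H * H * (star w * w)) := by
          simp only [mul_assoc]
        rw [h9, h8]
        noncomm_ring
      rw [h7, norm_neg]
      refine Real.le_sqrt_of_sq_le ?_
      calc ‖S * V * V‖ ^ 2 ≤ ‖S * V‖ ^ 2 := by
            gcongr
            exact (norm_mul_le _ _).trans (mul_le_of_le_one_right (norm_nonneg _) h3)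
        _ = ‖V * c * V‖ := norm_sq_eq_norm_conj hSs hVs hSc
        _ ≤ ‖V * (star w * w) * V‖ := norm_conj_le hVs hc0 hcw
        _ ≤ 1 / ((j : ℝ) + 1) := h2
  choose r hr hr1 hrS using key
  have hlim : Tendsto (fun j => r j * w) atTop (𝓝 S) := by
    rw [tendsto_iff_norm_sub_tendsto_zero]
    exact squeeze_zero (fun _ => norm_nonneg _) hrS tendsto_sqrt_one_div_nat
  have hlim2 : Tendsto (fun j => star (r j * w) * (r j * w)) atTop (𝓝 c) := by
    have := (hlim.star).mul hlim
    rwa [hSs, hSc] at this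
  have hmem : ∀ {q : 𝓜(ℂ, A)} (_ : q ∈ coeIdeal A), star (q * w) * (q * w) ∈ coeIdeal A :=
    fun hq => mul_mem_coeIdeal_left _ (mul_mem_coeIdeal_right hq _)
  obtain ⟨j, hj⟩ := (hφ.eventually_lt_weight (fun j => hmem (hr j))
    (fun j => star_mul_self_nonneg _) hc hc0 hlim2 hK).exists
  obtain ⟨q, hq⟩ := mem_coeIdeal.mp (hr j)
  have hrv : Tendsto (fun v : A => r j * (v : 𝓜(ℂ, A)) * w) l (𝓝 (r j * w)) := by
    have h1 := (continuous_coe.tendsto q).comp (hl.tendsto_mul_left q)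
    have h2 := h1.mul_const w
    rw [hq] at h2
    refine h2.congr fun v => ?_
    rw [Function.comp_apply, coe_mul, hq]
  have hrv2 : Tendsto (fun v : A => star (r j * (v : 𝓜(ℂ, A)) * w) * (r j * (v : 𝓜(ℂ, A)) * w)) l
      (𝓝 (star (r j * w) * (r j * w))) := hrv.star.mul hrv
  filter_upwards [hφ.eventually_lt_weight
    (fun v => hmem (mul_mem_coeIdeal_right (hr j) _)) (fun v => star_mul_self_nonneg _)
    (hmem (hr j)) (star_mul_self_nonneg _) hrv2 hj, hl.eventually_star_eq] with v hv hvs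
  refine hv.trans_le ?_
  have hvs' : star (v : 𝓜(ℂ, A)) = v := by rw [← coe_star, hvs]
  refine hφ.weight_mono (hmem (mul_mem_coeIdeal_right (hr j) _)) (star_mul_self_nonneg _)
    (mul_mem_coeIdeal_right (mul_mem_coeIdeal_left _ (mul_mem_coeIdeal_left _
      (coe_mem_coeIdeal v))) _) ?_
  have h1 : star (r j * (v : 𝓜(ℂ, A)) * w) * (r j * (v : 𝓜(ℂ, A)) * w)
      = star (v * w) * (star (r j) * r j) * (v * w) := by
    simp only [star_mul, mul_assoc]
  have h2 : star w * ((v : 𝓜(ℂ, A)) * v) * w = star (v * w) * (v * w) := by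
    rw [star_mul, hvs']; simp only [mul_assoc]
  rw [h1, h2]
  refine (CStarAlgebra.star_left_conjugate_le_norm_smul
    (IsSelfAdjoint.star_mul_self (r j))).trans ?_
  conv_rhs => rw [← one_smul ℝ (star ((v : 𝓜(ℂ, A)) * w) * (v * w))]
  refine smul_le_smul_of_nonneg_right ?_ (star_mul_self_nonneg _)
  rw [CStarRing.norm_star_mul_self]
  exact mul_le_one₀ (hr1 j) (norm_nonneg _) (hr1 j)

end Weight

/-! ### The linear extension of an unbounded functional to the Pedersen ideal -/

section OnIdeal

/-- A linear functional that is bounded on the unit ball, given as a bare function. -/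
theorem exists_clm_of_norm_le {E : Type*} [NormedAddCommGroup E] [NormedSpace ℂ E] {D : E → ℂ}
    (hadd : ∀ m k, D (m + k) = D m + D k) (hsmul : ∀ (c : ℂ) m, D (c • m) = c * D m)
    (hK : ∃ K : ℝ, ∀ m, ‖m‖ ≤ 1 → ‖D m‖ ≤ K) : ∃ ψ : E →L[ℂ] ℂ, ∀ m, ψ m = D m := by
  obtain ⟨K, hK⟩ := hK
  set L : E →ₗ[ℂ] ℂ := { toFun := D, map_add' := hadd, map_smul' := hsmul }
  have hb := LinearMap.bound_of_ball_bound' (r := 1) one_pos K L fun m hm =>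
    hK m (mem_closedBall_zero_iff.mp hm)
  exact ⟨L.mkContinuous (K / 1) hb, fun m => rfl⟩

variable {A : Type*} [NonUnitalCStarAlgebra A] [PartialOrder A] [StarOrderedRing A]
  {φ : A → ℝ≥0∞}

theorem mem_span_cone_iff {X : 𝓜(ℂ, A)} :
    X ∈ Submodule.span ℂ (cone A) ↔ ∃ x ∈ pedersenIdeal A, (x : 𝓜(ℂ, A)) = X := by
  have h : Submodule.span ℂ (cone A) = (pedersenIdeal A).map
      (DoubleCentralizer.coeHom (𝕜 := ℂ) (A := A) : A →ₗ[ℂ] 𝓜(ℂ, A)) := by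
    rw [pedersenIdeal, Submodule.map_span]
    rfl
  rw [h]
  exact Iff.rfl

theorem star_mem_pedersenIdeal {z : A} (hz : z ∈ pedersenIdeal A) : star z ∈ pedersenIdeal A := by
  induction hz using Submodule.span_induction with
  | mem x hx =>
    rw [(IsSelfAdjoint.of_nonneg hx.1).star_eq]
    exact Submodule.subset_span hx
  | zero => rw [star_zero]; exact zero_mem _
  | add a b _ _ ha hb => rw [star_add]; exact add_mem ha hb
  | smul c a _ ha => rw [star_smul]; exact Submodule.smul_mem _ _ ha

omit [StarOrderedRing A] in
theorem real_smul_mem_pedersenIdeal (r : ℝ) {z : A} (hz : z ∈ pedersenIdeal A) :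
    r • z ∈ pedersenIdeal A := by
  rw [← Complex.coe_smul]
  exact Submodule.smul_mem _ _ hz

theorem realPart_mem_pedersenIdeal {z : A} (hz : z ∈ pedersenIdeal A) :
    (ℜ z : A) ∈ pedersenIdeal A := by
  rw [realPart_apply_coe]
  exact real_smul_mem_pedersenIdeal _ (add_mem hz (star_mem_pedersenIdeal hz))

theorem imaginaryPart_mem_pedersenIdeal {z : A} (hz : z ∈ pedersenIdeal A) :
    (ℑ z : A) ∈ pedersenIdeal A := by
  rw [imaginaryPart_apply_coe]
  exact Submodule.smul_mem _ _
    (real_smul_mem_pedersenIdeal _ (sub_mem hz (star_mem_pedersenIdeal hz)))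

/-- The positive and negative parts of `h` need not lie in the Pedersen ideal, but their squares
do. -/
theorem IsCStarIntegral.posPart_negPart_lt_top (hφ : IsCStarIntegral φ) {h : A}
    (hs : IsSelfAdjoint h) (hh : h ∈ pedersenIdeal A) : φ h⁺ < ∞ ∧ φ h⁻ < ∞ := by
  have h1 : (h : 𝓜(ℂ, A)) ∈ squareIdeal A :=
    mem_squareIdeal_of_mem_span (mem_span_cone_iff.mpr ⟨h, hh, rfl⟩)
  have h2 : h * h = h⁺ * h⁺ + h⁻ * h⁻ := by
    nth_rw 1 2 [← CFC.posPart_sub_negPart h hs]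
    rw [sub_mul, mul_sub, mul_sub, CFC.posPart_mul_negPart, CFC.negPart_mul_posPart]
    abel
  have h3 : ∀ p : A, 0 ≤ p → p * p ≤ h * h → φ p < ∞ := fun p hp hle => by
    rw [← weight_coe φ]
    refine hφ.weight_lt_top_of_sq_mem (coe_mem_coeIdeal p) (coe_nonneg hp) ?_
    have h4 := h1.2
    rw [← coe_star, hs.star_eq, ← coe_mul] at h4
    rw [← coe_mul]
    refine mem_cone_of_le h4 (coe_mem_coeIdeal _) (coe_nonneg ?_) (coe_mono hle)
    have := star_mul_self_nonneg p
    rwa [(IsSelfAdjoint.of_nonneg hp).star_eq] at this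
  have h5 : ∀ p : A, 0 ≤ p → 0 ≤ p * p := fun p hp => by
    have := star_mul_self_nonneg p
    rwa [(IsSelfAdjoint.of_nonneg hp).star_eq] at this
  refine ⟨h3 _ (CFC.posPart_nonneg h) ?_, h3 _ (CFC.negPart_nonneg h) ?_⟩
  · rw [h2]; exact le_add_of_nonneg_right (h5 _ (CFC.negPart_nonneg h))
  · rw [h2]; exact le_add_of_nonneg_left (h5 _ (CFC.posPart_nonneg h))

/-- The value of the linear extension of `φ` at a self-adjoint element of the Pedersen ideal. -/
noncomputable def realValue (φ : A → ℝ≥0∞) (h : A) : ℝ := (φ h⁺).toReal - (φ h⁻).toReal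

omit [PartialOrder A] [StarOrderedRing A] in
theorem onIdeal_eq (z : A) :
    onIdeal φ z = (realValue φ (ℜ z) : ℂ) + (realValue φ (ℑ z) : ℂ) * Complex.I := rfl

/-- The value does not depend on how `h` is written as a difference of positive elements of finite
weight. -/
theorem IsCStarIntegral.realValue_eq (hφ : IsCStarIntegral φ) {p q : A} (hp : 0 ≤ p) (hq : 0 ≤ q)
    (hpt : φ p < ∞) (hqt : φ q < ∞) (hh : p - q ∈ pedersenIdeal A) :
    realValue φ (p - q) = (φ p).toReal - (φ q).toReal := by
  have hs : IsSelfAdjoint (p - q) := (IsSelfAdjoint.of_nonneg hp).sub (IsSelfAdjoint.of_nonneg hq)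
  obtain ⟨h1, h2⟩ := hφ.posPart_negPart_lt_top hs hh
  have h3 := CFC.posPart_sub_negPart (p - q) hs
  have h4 : (p - q)⁺ + q = p + (p - q)⁻ := by
    rw [sub_eq_sub_iff_add_eq_add] at h3
    exact h3
  have h5 := congrArg φ h4
  rw [hφ.map_add _ _ (CFC.posPart_nonneg _) hq, hφ.map_add _ _ hp (CFC.negPart_nonneg _)] at h5
  have h6 := congrArg ENNReal.toReal h5
  rw [ENNReal.toReal_add h1.ne hqt.ne, ENNReal.toReal_add hpt.ne h2.ne] at h6
  rw [realValue]
  linarith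

theorem IsCStarIntegral.realValue_of_nonneg (hφ : IsCStarIntegral φ) {x : A} (hx : 0 ≤ x)
    (hxK : x ∈ pedersenIdeal A) : realValue φ x = (φ x).toReal := by
  have h0 : φ 0 = 0 := by
    have := hφ.map_smul 0 0 le_rfl le_rfl
    simpa using this
  have := hφ.realValue_eq hx le_rfl (hφ.finite x hxK hx) (by rw [h0]; exact ENNReal.zero_lt_top)
    (by rwa [sub_zero])
  simpa [h0] using this

theorem IsCStarIntegral.realValue_add (hφ : IsCStarIntegral φ) {h k : A} (hs : IsSelfAdjoint h)
    (hh : h ∈ pedersenIdeal A) (ks : IsSelfAdjoint k) (hk : k ∈ pedersenIdeal A) :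
    realValue φ (h + k) = realValue φ h + realValue φ k := by
  obtain ⟨h1, h2⟩ := hφ.posPart_negPart_lt_top hs hh
  obtain ⟨k1, k2⟩ := hφ.posPart_negPart_lt_top ks hk
  have e : h + k = h⁺ + k⁺ - (h⁻ + k⁻) := by
    nth_rw 1 [← CFC.posPart_sub_negPart h hs, ← CFC.posPart_sub_negPart k ks]
    abel
  have hmem := add_mem hh hk
  rw [e] at hmem ⊢
  rw [hφ.realValue_eq (add_nonneg (CFC.posPart_nonneg _) (CFC.posPart_nonneg _))
    (add_nonneg (CFC.negPart_nonneg _) (CFC.negPart_nonneg _)) ?_ ?_ hmem,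
    hφ.map_add _ _ (CFC.posPart_nonneg _) (CFC.posPart_nonneg _),
    hφ.map_add _ _ (CFC.negPart_nonneg _) (CFC.negPart_nonneg _),
    ENNReal.toReal_add h1.ne k1.ne, ENNReal.toReal_add h2.ne k2.ne, realValue, realValue]
  · ring
  · rw [hφ.map_add _ _ (CFC.posPart_nonneg _) (CFC.posPart_nonneg _)]
    exact ENNReal.add_lt_top.mpr ⟨h1, k1⟩
  · rw [hφ.map_add _ _ (CFC.negPart_nonneg _) (CFC.negPart_nonneg _)]
    exact ENNReal.add_lt_top.mpr ⟨h2, k2⟩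

theorem IsCStarIntegral.realValue_smul (hφ : IsCStarIntegral φ) {h : A} (hs : IsSelfAdjoint h)
    (hh : h ∈ pedersenIdeal A) (r : ℝ) : realValue φ (r • h) = r * realValue φ h := by
  obtain ⟨h1, h2⟩ := hφ.posPart_negPart_lt_top hs hh
  have hmem := real_smul_mem_pedersenIdeal r hh
  have key : ∀ {t : ℝ} (_ : 0 ≤ t) {p : A} (_ : 0 ≤ p) (_ : φ p < ∞),
      φ (t • p) < ∞ ∧ (φ (t • p)).toReal = t * (φ p).toReal := fun ht p hp hpt => by
    rw [hφ.map_smul _ _ ht hp, ENNReal.toReal_mul, ENNReal.toReal_ofReal ht]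
    exact ⟨ENNReal.mul_lt_top ENNReal.ofReal_lt_top hpt, rfl⟩
  have hp := CFC.posPart_nonneg h
  have hn := CFC.negPart_nonneg h
  rcases le_total 0 r with hr | hr
  · have e : r • h = r • h⁺ - r • h⁻ := by rw [← smul_sub, CFC.posPart_sub_negPart h hs]
    rw [e] at hmem ⊢
    rw [hφ.realValue_eq (smul_nonneg hr hp) (smul_nonneg hr hn) (key hr hp h1).1 (key hr hn h2).1
      hmem, (key hr hp h1).2, (key hr hn h2).2, realValue]
    ring
  · have e : r • h = (-r) • h⁻ - (-r) • h⁺ := by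
      rw [← smul_sub, neg_smul, ← smul_neg, neg_sub, CFC.posPart_sub_negPart h hs]
    have hr' : 0 ≤ -r := neg_nonneg.mpr hr
    rw [e] at hmem ⊢
    rw [hφ.realValue_eq (smul_nonneg hr' hn) (smul_nonneg hr' hp) (key hr' hn h2).1
      (key hr' hp h1).1 hmem, (key hr' hp h1).2, (key hr' hn h2).2, realValue]
    ring

theorem IsCStarIntegral.onIdeal_add (hφ : IsCStarIntegral φ) {x z : A} (hx : x ∈ pedersenIdeal A)
    (hz : z ∈ pedersenIdeal A) : onIdeal φ (x + z) = onIdeal φ x + onIdeal φ z := by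
  have e1 : (ℜ (x + z) : A) = (ℜ x : A) + (ℜ z : A) := by
    rw [_root_.map_add realPart x z]; rfl
  have e2 : (ℑ (x + z) : A) = (ℑ x : A) + (ℑ z : A) := by
    rw [_root_.map_add imaginaryPart x z]; rfl
  rw [onIdeal_eq, onIdeal_eq, onIdeal_eq, e1, e2]
  rw [hφ.realValue_add (ℜ x).2 (realPart_mem_pedersenIdeal hx) (ℜ z).2
    (realPart_mem_pedersenIdeal hz), hφ.realValue_add (ℑ x).2
    (imaginaryPart_mem_pedersenIdeal hx) (ℑ z).2 (imaginaryPart_mem_pedersenIdeal hz)]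
  push_cast
  ring

theorem IsCStarIntegral.onIdeal_smul (hφ : IsCStarIntegral φ) (c : ℂ) {x : A}
    (hx : x ∈ pedersenIdeal A) : onIdeal φ (c • x) = c * onIdeal φ x := by
  have hr := realPart_mem_pedersenIdeal hx
  have hi := imaginaryPart_mem_pedersenIdeal hx
  have e : ∀ {h k : A} (_ : IsSelfAdjoint h) (_ : h ∈ pedersenIdeal A) (_ : IsSelfAdjoint k)
      (_ : k ∈ pedersenIdeal A) (r s : ℝ),
      realValue φ (r • h + s • k) = r * realValue φ h + s * realValue φ k := by
    intro h k hs hh ks hk r s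
    rw [hφ.realValue_add ((IsSelfAdjoint.all r).smul hs) (real_smul_mem_pedersenIdeal r hh)
      ((IsSelfAdjoint.all s).smul ks) (real_smul_mem_pedersenIdeal s hk),
      hφ.realValue_smul hs hh, hφ.realValue_smul ks hk]
  have e1 : ((ℜ (c • x) : selfAdjoint A) : A) = c.re • (ℜ x : A) + (-c.im) • (ℑ x : A) := by
    rw [realPart_smul, neg_smul, ← sub_eq_add_neg]; rfl
  have e2 : ((ℑ (c • x) : selfAdjoint A) : A) = c.re • (ℑ x : A) + c.im • (ℜ x : A) := by
    rw [imaginaryPart_smul]; rfl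
  rw [onIdeal_eq, onIdeal_eq, e1, e2, e (ℜ x).2 hr (ℑ x).2 hi, e (ℑ x).2 hi (ℜ x).2 hr]
  nth_rw 5 [← Complex.re_add_im c]
  push_cast
  linear_combination (c.im : ℂ) * (realValue φ (ℑ x) : ℂ) * (-Complex.I_mul_I)

theorem IsCStarIntegral.onIdeal_of_nonneg (hφ : IsCStarIntegral φ) {x : A} (hx : 0 ≤ x)
    (hxK : x ∈ pedersenIdeal A) : onIdeal φ x = ((φ x).toReal : ℂ) := by
  have hs := IsSelfAdjoint.of_nonneg hx
  have h0 : realValue φ (0 : A) = 0 := by simp [realValue]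
  rw [onIdeal_eq, hs.coe_realPart, hs.imaginaryPart, AddSubgroup.coe_zero, h0,
    hφ.realValue_of_nonneg hx hxK, Complex.ofReal_zero, zero_mul, add_zero]

/-- The linear extension of `φ` to the Pedersen ideal, regarded as a function on `M(A)` that
vanishes off `A`. -/
noncomputable def linearWeight (φ : A → ℝ≥0∞) : 𝓜(ℂ, A) → ℂ :=
  Function.extend (fun x : A => (x : 𝓜(ℂ, A))) (onIdeal φ) 0

omit [PartialOrder A] [StarOrderedRing A] in
theorem linearWeight_coe (φ : A → ℝ≥0∞) (x : A) :
    linearWeight φ (x : 𝓜(ℂ, A)) = onIdeal φ x :=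
  coe_injective.extend_apply (onIdeal φ) 0 x

variable {X Z : 𝓜(ℂ, A)}

theorem IsCStarIntegral.linearWeight_add (hφ : IsCStarIntegral φ)
    (hX : X ∈ Submodule.span ℂ (cone A)) (hZ : Z ∈ Submodule.span ℂ (cone A)) :
    linearWeight φ (X + Z) = linearWeight φ X + linearWeight φ Z := by
  obtain ⟨x, hx, rfl⟩ := mem_span_cone_iff.mp hX
  obtain ⟨z, hz, rfl⟩ := mem_span_cone_iff.mp hZ
  rw [← coe_add, linearWeight_coe, linearWeight_coe, linearWeight_coe, hφ.onIdeal_add hx hz]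

theorem IsCStarIntegral.linearWeight_smul (hφ : IsCStarIntegral φ) (c : ℂ)
    (hX : X ∈ Submodule.span ℂ (cone A)) : linearWeight φ (c • X) = c * linearWeight φ X := by
  obtain ⟨x, hx, rfl⟩ := mem_span_cone_iff.mp hX
  rw [← coe_smul, linearWeight_coe, linearWeight_coe, hφ.onIdeal_smul c hx]

theorem IsCStarIntegral.linearWeight_sub (hφ : IsCStarIntegral φ)
    (hX : X ∈ Submodule.span ℂ (cone A)) (hZ : Z ∈ Submodule.span ℂ (cone A)) :
    linearWeight φ (X - Z) = linearWeight φ X - linearWeight φ Z := by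
  rw [sub_eq_add_neg, ← neg_one_smul ℂ Z,
    hφ.linearWeight_add hX (Submodule.smul_mem _ _ hZ), hφ.linearWeight_smul _ hZ]
  ring

theorem IsCStarIntegral.linearWeight_of_mem_cone (hφ : IsCStarIntegral φ) (hX : X ∈ cone A) :
    linearWeight φ X = ((weight φ X).toReal : ℂ) := by
  obtain ⟨x, hx, rfl⟩ := hX
  rw [linearWeight_coe, weight_coe, hφ.onIdeal_of_nonneg hx.1 (Submodule.subset_span hx)]

theorem mul_mem_span_cone_left (m : 𝓜(ℂ, A)) (hX : X ∈ Submodule.span ℂ (cone A)) :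
    m * X ∈ Submodule.span ℂ (cone A) := by
  induction hX using Submodule.span_induction with
  | mem X hX =>
    obtain ⟨S, hS, hS0, rfl⟩ := exists_sqrt_mem_squareIdeal hX
    have := star_mul_mem_span (mul_mem_squareIdeal_right hS (star m)) hS
    rwa [star_mul, star_star, (IsSelfAdjoint.of_nonneg hS0).star_eq, mul_assoc] at this
  | zero => rw [mul_zero]; exact zero_mem _
  | add a b _ _ ha hb => rw [mul_add]; exact add_mem ha hb
  | smul c a _ ha => rw [mul_smul_comm]; exact Submodule.smul_mem _ _ ha

theorem mul_mem_span_cone_right (hX : X ∈ Submodule.span ℂ (cone A)) (m : 𝓜(ℂ, A)) :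
    X * m ∈ Submodule.span ℂ (cone A) := by
  induction hX using Submodule.span_induction with
  | mem X hX =>
    obtain ⟨S, hS, hS0, rfl⟩ := exists_sqrt_mem_squareIdeal hX
    have := star_mul_mem_span hS (mul_mem_squareIdeal_right hS m)
    rwa [(IsSelfAdjoint.of_nonneg hS0).star_eq, ← mul_assoc] at this
  | zero => rw [zero_mul]; exact zero_mem _
  | add a b _ _ ha hb => rw [add_mul]; exact add_mem ha hb
  | smul c a _ ha => rw [smul_mul_assoc]; exact Submodule.smul_mem _ _ ha

/-- A substitute for the Cauchy–Schwarz inequality, by polarization. -/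
theorem IsCStarIntegral.norm_linearWeight_star_mul_le (hφ : IsCStarIntegral φ) {a b : 𝓜(ℂ, A)}
    (ha : a ∈ squareIdeal A) (hb : b ∈ squareIdeal A) : ‖linearWeight φ (star a * b)‖ ≤
      2 * ((weight φ (star a * a)).toReal + (weight φ (star b * b)).toReal) := by
  have hc : ∀ {c : ℂ}, ‖c‖ = 1 → star (a + c • b) * (a + c • b) ∈ cone A :=
    fun _ => (add_mem_squareIdeal ha (smul_mem_squareIdeal _ hb)).2
  have hsum := add_mem_cone ha.2 hb.2
  have hbound : ∀ {c : ℂ}, ‖c‖ = 1 → ‖linearWeight φ (star (a + c • b) * (a + c • b))‖ ≤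
      2 * ((weight φ (star a * a)).toReal + (weight φ (star b * b)).toReal) := by
    intro c h
    have h1 := star_add_mul_add_le a (c • b)
    have h2 : star (c • b) * (c • b) = star b * b := by
      rw [star_smul, smul_mul_assoc, mul_smul_comm, smul_smul, Complex.star_def, mul_comm,
        Complex.mul_conj, Complex.normSq_eq_norm_sq, h]
      simp
    rw [h2] at h1
    have h3 := hφ.weight_mono (cone_subset_coeIdeal (hc h)) (star_mul_self_nonneg _)
      (cone_subset_coeIdeal (smul_mem_cone zero_le_two hsum)) h1
    rw [hφ.weight_smul zero_le_two (cone_subset_coeIdeal hsum) (nonneg_of_mem_cone hsum),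
      hφ.weight_add (cone_subset_coeIdeal ha.2) (star_mul_self_nonneg a)
      (cone_subset_coeIdeal hb.2) (star_mul_self_nonneg b)] at h3
    have ha' := hφ.weight_lt_top ha.2
    have hb' := hφ.weight_lt_top hb.2
    have h4 := ENNReal.toReal_mono (ENNReal.mul_lt_top ENNReal.ofReal_lt_top
      (ENNReal.add_lt_top.mpr ⟨ha', hb'⟩)).ne h3
    rw [ENNReal.toReal_mul, ENNReal.toReal_ofReal zero_le_two,
      ENNReal.toReal_add ha'.ne hb'.ne] at h4
    rw [hφ.linearWeight_of_mem_cone (hc h), Complex.norm_real, Real.norm_of_nonneg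
      ENNReal.toReal_nonneg]
    exact h4
  have hm : ∀ {c : ℂ}, ‖c‖ = 1 →
      star (a + c • b) * (a + c • b) ∈ Submodule.span ℂ (cone A) := fun h =>
    Submodule.subset_span (hc h)
  have n1 : ‖(1 : ℂ)‖ = 1 := norm_one
  have n2 : ‖(-1 : ℂ)‖ = 1 := by simp
  have n3 : ‖Complex.I‖ = 1 := Complex.norm_I
  have n4 : ‖-Complex.I‖ = 1 := by simp
  have h4 := congrArg (linearWeight φ) (four_smul_star_mul a b)
  rw [hφ.linearWeight_smul _ (star_mul_mem_span ha hb), hφ.linearWeight_sub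
    (sub_mem (hm n1) (hm n2)) (Submodule.smul_mem _ _ (sub_mem (hm n3) (hm n4))),
    hφ.linearWeight_sub (hm n1) (hm n2), hφ.linearWeight_smul _ (sub_mem (hm n3) (hm n4)),
    hφ.linearWeight_sub (hm n3) (hm n4)] at h4
  have h5 := congrArg norm h4
  rw [norm_mul, show ‖(4 : ℂ)‖ = 4 by norm_num] at h5
  have h6 := norm_sub_le (linearWeight φ (star (a + (1 : ℂ) • b) * (a + (1 : ℂ) • b)))
    (linearWeight φ (star (a + (-1 : ℂ) • b) * (a + (-1 : ℂ) • b)))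
  have h7 := norm_sub_le
    (linearWeight φ (star (a + Complex.I • b) * (a + Complex.I • b)))
    (linearWeight φ (star (a + (-Complex.I) • b) * (a + (-Complex.I) • b)))
  have h8 := norm_sub_le (linearWeight φ (star (a + (1 : ℂ) • b) * (a + (1 : ℂ) • b)) -
    linearWeight φ (star (a + (-1 : ℂ) • b) * (a + (-1 : ℂ) • b)))
    (Complex.I * (linearWeight φ (star (a + Complex.I • b) * (a + Complex.I • b)) -
    linearWeight φ (star (a + (-Complex.I) • b) * (a + (-Complex.I) • b))))
  rw [norm_mul, n3, one_mul] at h8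
  linarith [hbound n1, hbound n2, hbound n3, hbound n4]

theorem IsCStarIntegral.exists_weight_conj_toReal_le (hφ : IsCStarIntegral φ) (hX : X ∈ cone A) :
    ∃ C : ℝ, ∀ m : 𝓜(ℂ, A), ‖m‖ ≤ 1 → (weight φ (star m * X * m)).toReal ≤ C := by
  obtain ⟨C, hC0, hC⟩ := hφ.exists_weight_conj_le hX
  refine ⟨C, fun m hm => ENNReal.toReal_le_of_le_ofReal hC0 ((hC m).trans
    (ENNReal.ofReal_le_ofReal ?_))⟩
  have : ‖m‖ ^ 2 ≤ 1 := pow_le_one₀ (norm_nonneg _) hm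
  nlinarith

theorem IsCStarIntegral.exists_clm_mul_right (hφ : IsCStarIntegral φ)
    (hX : X ∈ Submodule.span ℂ (cone A)) :
    ∃ ψ : 𝓜(ℂ, A) →L[ℂ] ℂ, ∀ m, ψ m = linearWeight φ (X * m) := by
  have hmem := fun {X : 𝓜(ℂ, A)} (hX : X ∈ Submodule.span ℂ (cone A)) =>
    mul_mem_span_cone_right hX
  refine exists_clm_of_norm_le (fun m k => ?_) (fun c m => ?_) ?_
  · rw [mul_add, hφ.linearWeight_add (hmem hX m) (hmem hX k)]
  · rw [mul_smul_comm, hφ.linearWeight_smul c (hmem hX m)]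
  induction hX using Submodule.span_induction with
  | mem X hX =>
    obtain ⟨S, hS, hS0, rfl⟩ := exists_sqrt_mem_squareIdeal hX
    have hs := (IsSelfAdjoint.of_nonneg hS0).star_eq
    obtain ⟨C, hC⟩ := hφ.exists_weight_conj_toReal_le hX
    refine ⟨2 * ((weight φ (star S * S)).toReal + C), fun m hm => ?_⟩
    have h1 := hφ.norm_linearWeight_star_mul_le hS (mul_mem_squareIdeal_right hS m)
    have h2 : star (S * m) * (S * m) = star m * (S * S) * m := by
      rw [star_mul, hs]; simp only [mul_assoc]
    rw [h2] at h1
    have h3 : S * S * m = star S * (S * m) := by rw [hs, mul_assoc]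
    rw [h3]
    linarith [hC m hm]
  | zero =>
    refine ⟨0, fun m _ => ?_⟩
    have := hφ.linearWeight_smul 0 (hmem (zero_mem _) m)
    rw [zero_smul, zero_mul] at this
    rw [zero_mul, this, norm_zero]
  | add X Z hX hZ ihX ihZ =>
    obtain ⟨K, hK⟩ := ihX
    obtain ⟨K', hK'⟩ := ihZ
    refine ⟨K + K', fun m hm => ?_⟩
    rw [add_mul, hφ.linearWeight_add (hmem hX m) (hmem hZ m)]
    exact (norm_add_le _ _).trans (add_le_add (hK m hm) (hK' m hm))
  | smul c X hX ih =>
    obtain ⟨K, hK⟩ := ih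
    refine ⟨‖c‖ * K, fun m hm => ?_⟩
    rw [smul_mul_assoc, hφ.linearWeight_smul c (hmem hX m), norm_mul]
    exact mul_le_mul_of_nonneg_left (hK m hm) (norm_nonneg c)

theorem IsCStarIntegral.exists_clm_mul_left (hφ : IsCStarIntegral φ)
    (hX : X ∈ Submodule.span ℂ (cone A)) :
    ∃ ψ : 𝓜(ℂ, A) →L[ℂ] ℂ, ∀ m, ψ m = linearWeight φ (m * X) := by
  have hmem := fun {X : 𝓜(ℂ, A)} (hX : X ∈ Submodule.span ℂ (cone A)) (m : 𝓜(ℂ, A)) =>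
    mul_mem_span_cone_left m hX
  refine exists_clm_of_norm_le (fun m k => ?_) (fun c m => ?_) ?_
  · rw [add_mul, hφ.linearWeight_add (hmem hX m) (hmem hX k)]
  · rw [smul_mul_assoc, hφ.linearWeight_smul c (hmem hX m)]
  induction hX using Submodule.span_induction with
  | mem X hX =>
    obtain ⟨S, hS, hS0, rfl⟩ := exists_sqrt_mem_squareIdeal hX
    have hs := (IsSelfAdjoint.of_nonneg hS0).star_eq
    obtain ⟨C, hC⟩ := hφ.exists_weight_conj_toReal_le hX
    refine ⟨2 * (C + (weight φ (star S * S)).toReal), fun m hm => ?_⟩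
    have h1 := hφ.norm_linearWeight_star_mul_le (mul_mem_squareIdeal_right hS (star m)) hS
    have h2 : star (S * star m) * (S * star m) = star (star m) * (S * S) * star m := by
      rw [star_mul, hs]; simp only [mul_assoc]
    have h3 : m * (S * S) = star (S * star m) * S := by rw [star_mul, star_star, hs, mul_assoc]
    rw [h2, ← h3] at h1
    linarith [hC (star m) (by rwa [norm_star])]
  | zero =>
    refine ⟨0, fun m _ => ?_⟩
    have := hφ.linearWeight_smul 0 (hmem (zero_mem _) m)
    rw [zero_smul, zero_mul] at this
    rw [mul_zero, this, norm_zero]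
  | add X Z hX hZ ihX ihZ =>
    obtain ⟨K, hK⟩ := ihX
    obtain ⟨K', hK'⟩ := ihZ
    refine ⟨K + K', fun m hm => ?_⟩
    rw [mul_add, hφ.linearWeight_add (hmem hX m) (hmem hZ m)]
    exact (norm_add_le _ _).trans (add_le_add (hK m hm) (hK' m hm))
  | smul c X hX ih =>
    obtain ⟨K, hK⟩ := ih
    refine ⟨‖c‖ * K, fun m hm => ?_⟩
    rw [mul_smul_comm, hφ.linearWeight_smul c (hmem hX m), norm_mul]
    exact mul_le_mul_of_nonneg_left (hK m hm) (norm_nonneg c)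

end OnIdeal

/-! ### The trace property on the algebra generated by the tuple -/

section Centralizer

variable {A : Type*} [NonUnitalCStarAlgebra A] [PartialOrder A] [StarOrderedRing A]
  {φ : A → ℝ≥0∞} {n : ℕ} {y : Fin n → A} {X : 𝓜(ℂ, A)}

/-- The continuity of `m ↦ φ(X m)` and `m ↦ φ(m X)` extends the trace property from the `y i` to
the C*-algebra that they generate. -/
theorem IsCStarIntegral.linearWeight_mul_comm (hφ : IsCStarIntegral φ) (hy : IsAbelianTuple y)
    (hyφ : ∀ i, y i ∈ unboundedCentralizer φ) {m : 𝓜(ℂ, A)}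
    (hm : m ∈ generated fun i => (y i : 𝓜(ℂ, A))) (hX : X ∈ Submodule.span ℂ (cone A)) :
    linearWeight φ (X * m) = linearWeight φ (m * X) := by
  revert X
  refine generated_induction (isAbelianTuple_coe hy).1 (P := fun m => ∀ {X : 𝓜(ℂ, A)},
    X ∈ Submodule.span ℂ (cone A) → linearWeight φ (X * m) = linearWeight φ (m * X))
    ?_ ?_ ?_ ?_ ?_ hm
  · simp only [Set.ofPred_forall]
    refine isClosed_iInter fun X => isClosed_iInter fun hX => ?_
    obtain ⟨ψ, hψ⟩ := hφ.exists_clm_mul_right hX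
    obtain ⟨ψ', hψ'⟩ := hφ.exists_clm_mul_left hX
    simp only [← hψ, ← hψ']
    exact isClosed_eq ψ.continuous ψ'.continuous
  · intro i X hX
    obtain ⟨x, hx, rfl⟩ := mem_span_cone_iff.mp hX
    rw [← coe_mul, ← coe_mul, linearWeight_coe, linearWeight_coe, hyφ i x hx]
  · intro c X hX
    rw [Algebra.commutes]
  · intro a b _ _ ha hb X hX
    rw [mul_add, add_mul, hφ.linearWeight_add (mul_mem_span_cone_right hX a)
      (mul_mem_span_cone_right hX b), hφ.linearWeight_add (mul_mem_span_cone_left a hX)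
      (mul_mem_span_cone_left b hX), ha hX, hb hX]
  · intro a b _ _ ha hb X hX
    rw [← mul_assoc, hb (mul_mem_span_cone_right hX a), ← mul_assoc,
      ha (mul_mem_span_cone_left b hX), mul_assoc]

/-- On the Pedersen ideal `φ(r X r) = φ(r² X)`, because `r` centralizes `φ`. -/
theorem IsCStarIntegral.weight_conj_add_conj (hφ : IsCStarIntegral φ) (hy : IsAbelianTuple y)
    (hyφ : ∀ i, y i ∈ unboundedCentralizer φ) {r₀ r₁ : 𝓜(ℂ, A)}
    (h₀ : r₀ ∈ generated fun i => (y i : 𝓜(ℂ, A)))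
    (h₁ : r₁ ∈ generated fun i => (y i : 𝓜(ℂ, A))) (hs₀ : star r₀ = r₀) (hs₁ : star r₁ = r₁)
    (hsum : r₀ * r₀ + r₁ * r₁ = 1) (hX : X ∈ cone A) :
    weight φ (r₀ * X * r₀) + weight φ (r₁ * X * r₁) = weight φ X := by
  have hXs := Submodule.subset_span (R := ℂ) hX
  have hc₀ : r₀ * X * r₀ ∈ cone A := by
    have := star_conj_mem_cone r₀ hX
    rwa [hs₀] at this
  have hc₁ : r₁ * X * r₁ ∈ cone A := by
    have := star_conj_mem_cone r₁ hX
    rwa [hs₁] at this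
  have e : linearWeight φ (r₀ * X * r₀ + r₁ * X * r₁) = linearWeight φ X := by
    rw [hφ.linearWeight_add (Submodule.subset_span hc₀) (Submodule.subset_span hc₁),
      hφ.linearWeight_mul_comm hy hyφ h₀ (mul_mem_span_cone_left r₀ hXs),
      hφ.linearWeight_mul_comm hy hyφ h₁ (mul_mem_span_cone_left r₁ hXs),
      ← hφ.linearWeight_add (mul_mem_span_cone_left _ (mul_mem_span_cone_left _ hXs))
        (mul_mem_span_cone_left _ (mul_mem_span_cone_left _ hXs)), ← mul_assoc, ← mul_assoc,
      ← add_mul, hsum, one_mul]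
  rw [hφ.linearWeight_of_mem_cone (add_mem_cone hc₀ hc₁), hφ.linearWeight_of_mem_cone hX,
    Complex.ofReal_inj, ENNReal.toReal_eq_toReal_iff' (hφ.weight_lt_top (add_mem_cone hc₀ hc₁)).ne
    (hφ.weight_lt_top hX).ne, hφ.weight_add (cone_subset_coeIdeal hc₀) (nonneg_of_mem_cone hc₀)
    (cone_subset_coeIdeal hc₁) (nonneg_of_mem_cone hc₁)] at e
  exact e

/-- Superadditivity of lower limits. -/
theorem add_le_of_forall_eventually {ι : Type*} {l : Filter ι} [l.NeBot] {g₀ g₁ : ι → ℝ≥0∞}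
    {a b c : ℝ≥0∞} (h₀ : ∀ K < a, ∀ᶠ i in l, K < g₀ i) (h₁ : ∀ K < b, ∀ᶠ i in l, K < g₁ i)
    (h : ∀ᶠ i in l, g₀ i + g₁ i ≤ c) : a + b ≤ c := by
  have key : ∀ d, (∀ᶠ i in l, d ≤ g₁ i) → a + d ≤ c := by
    intro d hd
    obtain ⟨i, hi, hi'⟩ := (hd.and h).exists
    have hdc : d ≤ c := hi.trans (le_add_self.trans hi')
    by_cases hdt : d = ∞
    · rw [hdt, top_le_iff] at hdc
      rw [hdc]
      exact le_top
    refine add_le_of_le_tsub_right_of_le hdc (le_of_forall_lt_imp_le_of_dense fun K hK => ?_)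
    obtain ⟨j, hj, hj', hj''⟩ := ((h₀ K hK).and (hd.and h)).exists
    exact ENNReal.le_sub_of_add_le_right hdt ((add_le_add hj.le hj').trans hj'')
  have ha : a ≤ c := by simpa using key 0 (Eventually.of_forall fun _ => zero_le)
  by_cases hat : a = ∞
  · rw [hat, top_le_iff] at ha
    rw [ha]
    exact le_top
  rw [add_comm]
  refine add_le_of_le_tsub_right_of_le ha (le_of_forall_lt_imp_le_of_dense fun K hK => ?_)
  refine ENNReal.le_sub_of_add_le_left hat (key K ((h₁ K hK).mono fun _ => le_of_lt))

/-- Off the Pedersen ideal there remains an inequality, by lower semicontinuity and approximation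
of `X` from below. -/
theorem IsCStarIntegral.weight_conj_add_conj_le (hφ : IsCStarIntegral φ) (hy : IsAbelianTuple y)
    (hyφ : ∀ i, y i ∈ unboundedCentralizer φ) {r₀ r₁ : 𝓜(ℂ, A)}
    (h₀ : r₀ ∈ generated fun i => (y i : 𝓜(ℂ, A)))
    (h₁ : r₁ ∈ generated fun i => (y i : 𝓜(ℂ, A))) (hs₀ : star r₀ = r₀) (hs₁ : star r₁ = r₁)
    (hsum : r₀ * r₀ + r₁ * r₁ = 1) (hX : X ∈ coeIdeal A) (hX0 : 0 ≤ X) :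
    weight φ (r₀ * X * r₀) + weight φ (r₁ * X * r₁) ≤ weight φ X := by
  choose W hW hWX hWn using fun j : ℕ => exists_mem_cone_le hX hX0 (Nat.one_div_pos_of_nat (n := j))
  have hlim : Tendsto W atTop (𝓝 X) := by
    rw [tendsto_iff_norm_sub_tendsto_zero]
    refine squeeze_zero (fun _ => norm_nonneg _) (fun j => ?_)
      (tendsto_one_div_add_atTop_nhds_zero_nat (𝕜 := ℝ))
    rw [norm_sub_rev]
    exact hWn j
  have hmem : ∀ (r : 𝓜(ℂ, A)) {Z : 𝓜(ℂ, A)}, Z ∈ coeIdeal A → r * Z * r ∈ coeIdeal A :=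
    fun r _ hZ => mul_mem_coeIdeal_right (mul_mem_coeIdeal_left r hZ) r
  have hpos : ∀ {r Z : 𝓜(ℂ, A)}, star r = r → 0 ≤ Z → 0 ≤ r * Z * r := fun {r _} hr hZ => by
    have := star_left_conjugate_nonneg hZ r
    rwa [hr] at this
  have hev : ∀ {r : 𝓜(ℂ, A)}, star r = r → ∀ K < weight φ (r * X * r),
      ∀ᶠ j in atTop, K < weight φ (r * W j * r) := fun {r} hr K hK =>
    hφ.eventually_lt_weight (fun j => hmem r (cone_subset_coeIdeal (hW j)))
      (fun j => hpos hr (nonneg_of_mem_cone (hW j))) (hmem r hX) (hpos hr hX0)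
      ((hlim.const_mul r).mul_const r) hK
  refine add_le_of_forall_eventually (l := atTop) (hev hs₀) (hev hs₁)
    (Eventually.of_forall fun j => ?_)
  rw [hφ.weight_conj_add_conj hy hyφ h₀ h₁ hs₀ hs₁ hsum (hW j)]
  exact hφ.weight_mono (cone_subset_coeIdeal (hW j)) (nonneg_of_mem_cone (hW j)) hX (hWX j)

/-- Jensen's inequality for the functional `m ↦ φ(r m r)`, which is bounded and centralized by `y`
because `r` lies in the Pedersen ideal. -/
theorem IsCStarIntegral.weight_conj_calculus_le (hφ : IsCStarIntegral φ) (hy : IsAbelianTuple y)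
    (hyφ : ∀ i, y i ∈ unboundedCentralizer φ) {r : 𝓜(ℂ, A)} (hr : r ∈ cone A)
    (hrg : r ∈ generated fun i => (y i : 𝓜(ℂ, A))) {S : Set (Fin n → ℝ)}
    {f : (Fin n → ℝ) → ℝ} (hf : ContinuousOn f S) (hconv : ConvexOn ℝ S f)
    (hS : jointSpectrum (fun i => (y i : 𝓜(ℂ, A))) ⊆ S) (hf0 : ∀ s ∈ S, 0 ≤ f s) {F : 𝓜(ℂ, A)}
    (hF0 : 0 ≤ F)
    (hF : ∀ q, (∀ s ∈ S, affine q s ≤ f s) → affineValue q (fun i => (y i : 𝓜(ℂ, A))) ≤ F) :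
    weight φ (r * calculus (fun i => (y i : 𝓜(ℂ, A))) f * r) ≤ weight φ (r * F * r) := by
  have hY := isAbelianTuple_coe hy
  have hrs := Submodule.subset_span (R := ℂ) hr
  have hsr : star r = r := (IsSelfAdjoint.of_nonneg (nonneg_of_mem_cone hr)).star_eq
  have hrr : r * r ∈ Submodule.span ℂ (cone A) := mul_mem_span_cone_left r hrs
  obtain ⟨ψ, hψ⟩ := hφ.exists_clm_mul_right hrr
  have hcone : ∀ m : 𝓜(ℂ, A), 0 ≤ m → r * m * r ∈ cone A := fun m hm => by
    have := (mul_mem_squareIdeal_left (CFC.sqrt m) (mem_squareIdeal_of_mem_cone hr)).2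
    rw [star_mul, (IsSelfAdjoint.of_nonneg (CFC.sqrt_nonneg m)).star_eq, hsr, mul_assoc,
      ← mul_assoc (CFC.sqrt m), CFC.sqrt_mul_sqrt_self m hm, ← mul_assoc] at this
    exact this
  have hψr : ∀ m : 𝓜(ℂ, A), 0 ≤ m → ψ m = ((weight φ (r * m * r)).toReal : ℂ) := fun m hm => by
    rw [← hφ.linearWeight_of_mem_cone (hcone m hm),
      hφ.linearWeight_mul_comm hy hyφ hrg (mul_mem_span_cone_right hrs m), hψ, mul_assoc]
  have key := apply_calculus_le (ψ := ψ) (fun m hm => ?_) hY (fun i m => ?_) hf hconv hS hF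
  · have hc := hY.calculus_nonneg (hf.mono hS) fun s hs => hf0 s (hS hs)
    rw [hψr _ hc, hψr _ hF0, Complex.real_le_real] at key
    rwa [ENNReal.toReal_le_toReal (hφ.weight_lt_top (hcone _ hc)).ne
      (hφ.weight_lt_top (hcone _ hF0)).ne] at key
  · rw [hψr m hm]
    exact Complex.zero_le_real.mpr ENNReal.toReal_nonneg
  · have hyg := mem_generated (fun i => (y i : 𝓜(ℂ, A))) i
    have hcomm : r * r * (y i : 𝓜(ℂ, A)) = y i * (r * r) :=
      hY.commute_of_mem (mul_mem hrg hrg) hyg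
    rw [hψ, hψ, ← mul_assoc, hφ.linearWeight_mul_comm hy hyφ hyg (mul_mem_span_cone_right hrr m),
      ← mul_assoc, ← hcomm, mul_assoc, mul_assoc]

end Centralizer

/-! ### Jensen's inequality for unbounded functionals -/

section Unbounded

/-- A continuous partition of `ℝⁿ`, quadratic in the sense that the squares add up to `1`, into a
neighbourhood of `0` and the complement of a smaller one. -/
theorem exists_partition (n : ℕ) {ρ : ℝ} (hρ : 0 < ρ) : ∃ κ₀ κ₁ : (Fin n → ℝ) → ℝ,
    Continuous κ₀ ∧ Continuous κ₁ ∧ (∀ s, κ₀ s * κ₀ s + κ₁ s * κ₁ s = 1) ∧ (∀ s, 0 ≤ κ₁ s) ∧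
    (∀ s, ∑ i, s i * s i < ρ → κ₁ s = 0) ∧ ∀ s, 2 * ρ ≤ ∑ i, s i * s i → κ₀ s = 0 := by
  set κ : (Fin n → ℝ) → ℝ := fun s => max 0 (min 1 ((∑ i, s i * s i - ρ) / ρ)) with hκ
  have hκc : Continuous κ := by fun_prop
  have h0 : ∀ s, 0 ≤ κ s := fun s => le_max_left _ _
  have h1 : ∀ s, κ s ≤ 1 := fun s => max_le zero_le_one (min_le_left _ _)
  refine ⟨fun s => √(1 - κ s * κ s), κ, by fun_prop, hκc, fun s => ?_, h0, fun s hs => ?_,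
    fun s hs => ?_⟩
  · rw [Real.mul_self_sqrt (by nlinarith [h0 s, h1 s])]
    ring
  · refine max_eq_left ((min_le_right _ _).trans ?_)
    exact div_nonpos_of_nonpos_of_nonneg (by linarith) hρ.le
  · have : κ s = 1 := by
      have h2 : 1 ≤ (∑ i, s i * s i - ρ) / ρ := by
        rw [le_div_iff₀ hρ]; linarith
      rw [hκ]
      simp only [min_eq_left h2]
      exact max_eq_right zero_le_one
    simp [this]

theorem exists_pos_of_eventually_nhdsWithin_zero {n : ℕ} {K : Set (Fin n → ℝ)}
    {P : (Fin n → ℝ) → Prop} (h : ∀ᶠ s in 𝓝[K] 0, P s) :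
    ∃ ρ : ℝ, 0 < ρ ∧ ∀ s ∈ K, ∑ i, s i * s i < 2 * ρ → P s := by
  obtain ⟨η, hη, hball⟩ := Metric.mem_nhdsWithin_iff.mp h
  refine ⟨η * η / 2, by positivity, fun s hs hlt => hball ⟨?_, hs⟩⟩
  rw [mem_ball_zero_iff, pi_norm_lt_iff hη]
  intro i
  have h1 : s i * s i ≤ ∑ i, s i * s i :=
    Finset.single_le_sum (f := fun i => s i * s i) (fun i _ => mul_self_nonneg _)
      (Finset.mem_univ i)
  rw [Real.norm_eq_abs]
  exact abs_lt_of_sq_lt_sq (by nlinarith) hη.le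

variable {A : Type*} [NonUnitalCStarAlgebra A] [PartialOrder A] [StarOrderedRing A]
  {φ : A → ℝ≥0∞} {n : ℕ} {y : Fin n → A} {X F c : 𝓜(ℂ, A)}

theorem weight_le_unboundedExtend (φ : A → ℝ≥0∞) (hX : X ∈ coeIdeal A) (hX0 : 0 ≤ X) (hXF : X ≤ F) :
    weight φ X ≤ unboundedExtend φ F := by
  obtain ⟨x, rfl⟩ := mem_coeIdeal.mp hX
  obtain ⟨d, hd⟩ := CStarAlgebra.nonneg_iff_eq_star_mul_self.mp (sub_nonneg.mpr hXF)
  rw [weight_coe, unboundedExtend]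
  exact le_iSup₂ (f := fun (c : A) (_ : c ∈ {c : A | 0 ≤ c ∧
    ∃ d : 𝓜(ℂ, A), F - (c : 𝓜(ℂ, A)) = star d * d}) => φ c) x ⟨nonneg_of_coe_nonneg hX0, d, hd⟩

/-- The elements `F^{1/2} v² F^{1/2} ≤ F` of `A`, for `v` in an approximate unit, bound the value at
`F` from below.  The values of `φ` at them split along `r₀` and `r₁`, and the two parts
asymptotically dominate the values at `c₀` and `c₁`. -/
theorem IsCStarIntegral.weight_add_weight_le_unboundedExtend (hφ : IsCStarIntegral φ)
    (hy : IsAbelianTuple y)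
    (hyφ : ∀ i, y i ∈ unboundedCentralizer φ) {r₀ r₁ : 𝓜(ℂ, A)}
    (h₀ : r₀ ∈ generated fun i => (y i : 𝓜(ℂ, A)))
    (h₁ : r₁ ∈ generated fun i => (y i : 𝓜(ℂ, A))) (hs₀ : star r₀ = r₀) (hs₁ : star r₁ = r₁)
    (hsum : r₀ * r₀ + r₁ * r₁ = 1) (hF0 : 0 ≤ F) {c₀ c₁ : 𝓜(ℂ, A)} (hc₀ : c₀ ∈ coeIdeal A)
    (h0c₀ : 0 ≤ c₀) (hcF₀ : c₀ ≤ r₀ * F * r₀) (hc₁ : c₁ ∈ coeIdeal A)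
    (h0c₁ : 0 ≤ c₁) (hcF₁ : c₁ ≤ r₁ * F * r₁) :
    weight φ c₀ + weight φ c₁ ≤ unboundedExtend φ F := by
  set G := CFC.sqrt F with hG
  have hGF : G * G = F := CFC.sqrt_mul_sqrt_self F hF0
  have hGs : star G = G := (IsSelfAdjoint.of_nonneg (CFC.sqrt_nonneg F)).star_eq
  have e : ∀ {r : 𝓜(ℂ, A)}, star r = r → ∀ m, star (G * r) * m * (G * r) = r * (G * m * G) * r :=
    fun {r} hr m => by
      rw [star_mul, hr, hGs]
      simp only [mul_assoc]
  have e1 : ∀ {r : 𝓜(ℂ, A)}, star r = r → r * F * r = star (G * r) * (G * r) := fun {r} hr => by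
    rw [← mul_one (star (G * r)), e hr, mul_one, hGF]
  have hl := CStarAlgebra.increasingApproximateUnit A
  rw [e1 hs₀] at hcF₀
  rw [e1 hs₁] at hcF₁
  refine add_le_of_forall_eventually (l := CStarAlgebra.approximateUnit A)
    (fun K hK => hφ.eventually_lt_weight_conj_sq hl hc₀ h0c₀ hcF₀ hK)
    (fun K hK => hφ.eventually_lt_weight_conj_sq hl hc₁ h0c₁ hcF₁ hK) ?_
  filter_upwards [hl.eventually_norm, hl.eventually_star_eq] with v hv hvs
  rw [e hs₀, e hs₁]
  have hvs' : star (v : 𝓜(ℂ, A)) = v := by rw [← coe_star, hvs]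
  have hvv : 0 ≤ (v : 𝓜(ℂ, A)) * v := by
    have := star_mul_self_nonneg (v : 𝓜(ℂ, A))
    rwa [hvs'] at this
  have hvv1 : (v : 𝓜(ℂ, A)) * v ≤ 1 := by
    rw [← CStarAlgebra.norm_le_one_iff_of_nonneg _ hvv]
    refine (norm_mul_le _ _).trans (mul_le_one₀ ?_ (norm_nonneg _) ?_) <;> rwa [norm_coe]
  have hm : G * ((v : 𝓜(ℂ, A)) * v) * G ∈ coeIdeal A :=
    mul_mem_coeIdeal_right (mul_mem_coeIdeal_left _ (mul_mem_coeIdeal_left _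
      (coe_mem_coeIdeal v))) _
  have h0 : 0 ≤ G * ((v : 𝓜(ℂ, A)) * v) * G := by
    have := star_left_conjugate_nonneg hvv G
    rwa [hGs] at this
  have hle : G * ((v : 𝓜(ℂ, A)) * v) * G ≤ F := by
    have := star_left_conjugate_le_conjugate hvv1 G
    rwa [hGs, mul_one, hGF] at this
  exact (hφ.weight_conj_add_conj_le hy hyφ h₀ h₁ hs₀ hs₁ hsum hm h0).trans
    (weight_le_unboundedExtend φ hm h0 hle)

theorem IsAbelianTuple.calculus_partition {B : Type*} [CStarAlgebra B] {x : Fin n → B}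
    (hx : IsAbelianTuple x) {κ₀ κ₁ : (Fin n → ℝ) → ℝ} (hκ₀ : Continuous κ₀) (hκ₁ : Continuous κ₁)
    (hsum : ∀ s, κ₀ s * κ₀ s + κ₁ s * κ₁ s = 1) :
    calculus x κ₀ * calculus x κ₀ + calculus x κ₁ * calculus x κ₁ = 1 := by
  have m0 : Continuous fun s => κ₀ s * κ₀ s := hκ₀.mul hκ₀
  have m1 : Continuous fun s => κ₁ s * κ₁ s := hκ₁.mul hκ₁
  rw [← hx.calculus_mul hκ₀.continuousOn hκ₀.continuousOn,
    ← hx.calculus_mul hκ₁.continuousOn hκ₁.continuousOn,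
    ← hx.calculus_add m0.continuousOn m1.continuousOn]
  simp only [hsum]
  rw [hx.calculus_const, Complex.ofReal_one, one_smul]

theorem IsAbelianTuple.calculus_conj {B : Type*} [CStarAlgebra B] {x : Fin n → B}
    (hx : IsAbelianTuple x) {κ g : (Fin n → ℝ) → ℝ} (hκ : ContinuousOn κ (jointSpectrum x))
    (hg : ContinuousOn g (jointSpectrum x)) :
    calculus x κ * calculus x g * calculus x κ = calculus x fun s => κ s * g s * κ s := by
  have m0 : ContinuousOn (fun s => κ s * g s) (jointSpectrum x) := hκ.mul hg
  rw [hx.calculus_mul m0 hκ, hx.calculus_mul hκ hg]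

/-- The comparison away from the point `0` of the joint spectrum: `κ(y)` lies in the Pedersen ideal,
so `m ↦ φ(κ(y) m κ(y))` is a bounded functional. -/
theorem IsCStarIntegral.weight_cutoff_le (hφ : IsCStarIntegral φ) (hy : IsAbelianTuple y)
    (hyφ : ∀ i, y i ∈ unboundedCentralizer φ)
    {S : Set (Fin n → ℝ)} {f : (Fin n → ℝ) → ℝ} (hf : ContinuousOn f S) (hconv : ConvexOn ℝ S f)
    (hS : jointSpectrum (fun i => (y i : 𝓜(ℂ, A))) ⊆ S) (hf0 : ∀ s ∈ S, 0 ≤ f s) (hF0 : 0 ≤ F)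
    (hF : ∀ q, (∀ s ∈ S, affine q s ≤ f s) → affineValue q (fun i => (y i : 𝓜(ℂ, A))) ≤ F)
    {κ : (Fin n → ℝ) → ℝ} (hκ : Continuous κ) (hκ0 : ∀ s, 0 ≤ κ s) {ρ : ℝ} (hρ : 0 < ρ)
    (hv : ∀ s, ∑ i, s i * s i < ρ → κ s = 0) (hc : c ∈ coeIdeal A) (hc0 : 0 ≤ c)
    (hcf : c ≤ calculus (fun i => (y i : 𝓜(ℂ, A))) f) :
    weight φ (calculus (fun i => (y i : 𝓜(ℂ, A))) κ * c * calculus (fun i => (y i : 𝓜(ℂ, A))) κ)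
      ≤ weight φ (calculus (fun i => (y i : 𝓜(ℂ, A))) κ * F *
        calculus (fun i => (y i : 𝓜(ℂ, A))) κ) := by
  have hr := calculus_mem_cone hy hκ hκ0 hρ hv
  have hrs : IsSelfAdjoint (calculus (fun i => (y i : 𝓜(ℂ, A))) κ) :=
    (isAbelianTuple_coe hy).star_calculus hκ.continuousOn
  exact (hφ.weight_mono (mul_mem_coeIdeal_right (mul_mem_coeIdeal_left _ hc) _)
    (hrs.conjugate_nonneg hc0) (mul_mem_coeIdeal_left _ (cone_subset_coeIdeal hr))
    (hrs.conjugate_le_conjugate hcf)).trans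
    (hφ.weight_conj_calculus_le hy hyφ hr (calculus_mem _ _) hf hconv hS hf0 hF0 hF)

/-- If `f(0) > 0`, then some affine minorant of `f` dominates `t f` near `0`.  Cut `t w` into a part
away from `0`, to which the comparison there applies, and a part near `0`, which lies below the
corresponding part of `F` already in the operator order. -/
theorem IsCStarIntegral.weight_smul_le_of_pos (hφ : IsCStarIntegral φ) (hy : IsAbelianTuple y)
    (hyφ : ∀ i, y i ∈ unboundedCentralizer φ)
    {S : Set (Fin n → ℝ)} {f : (Fin n → ℝ) → ℝ} (hf : ContinuousOn f S) (hconv : ConvexOn ℝ S f)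
    (hS : jointSpectrum (fun i => (y i : 𝓜(ℂ, A))) ⊆ S) (hf0 : ∀ s ∈ S, 0 ≤ f s) (hF0 : 0 ≤ F)
    (hF : ∀ q, (∀ s ∈ S, affine q s ≤ f s) → affineValue q (fun i => (y i : 𝓜(ℂ, A))) ≤ F)
    (h0K : (0 : Fin n → ℝ) ∈ jointSpectrum fun i => (y i : 𝓜(ℂ, A))) (hf00 : 0 < f 0)
    {t : ℝ} (ht0 : 0 ≤ t) (ht1 : t < 1) {w : 𝓜(ℂ, A)} (hw : w ∈ cone A)
    (hwf : w ≤ calculus (fun i => (y i : 𝓜(ℂ, A))) f) :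
    weight φ (t • w) ≤ unboundedExtend φ F := by
  have hY := isAbelianTuple_coe hy
  set Y : Fin n → 𝓜(ℂ, A) := fun i => y i with hYdef
  have hfK := hf.mono hS
  have hfY0 : 0 ≤ calculus Y f := hY.calculus_nonneg hfK fun s hs => hf0 s (hS hs)
  obtain ⟨q, hq, hq0⟩ := exists_affine_minorant hf hconv (hS h0K)
    (show 0 < (1 - t) * f 0 / 2 by have := sub_pos.mpr ht1; positivity)
  have hnear : ∀ᶠ s in 𝓝[jointSpectrum Y] 0, t * f s < affine q s := by
    have h1 : ContinuousWithinAt (fun s => t * f s) (jointSpectrum Y) 0 :=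
      (hfK 0 h0K).const_mul t
    have h2 : ContinuousWithinAt (affine q) (jointSpectrum Y) 0 :=
      (continuous_affine q).continuousWithinAt
    refine h1.eventually_lt h2 ?_
    rw [hq0]
    nlinarith
  obtain ⟨ρ, hρ, hρf⟩ := exists_pos_of_eventually_nhdsWithin_zero hnear
  obtain ⟨κ₀, κ₁, hκ₀, hκ₁, hsum, hpos₁, hv₁, hv₀⟩ := exists_partition n hρ
  have hs₀ := hY.star_calculus hκ₀.continuousOn
  have hs₁ := hY.star_calculus hκ₁.continuousOn
  have hr₁ := calculus_mem_cone hy hκ₁ hpos₁ hρ hv₁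
  have hw0 := nonneg_of_mem_cone hw
  have htw := smul_mem_cone ht0 hw
  have htw0 := nonneg_of_mem_cone htw
  have htwf : t • w ≤ t • calculus Y f := smul_le_smul_of_nonneg_left hwf ht0
  have htf : t • calculus Y f = calculus Y fun s => t * f s := by
    rw [hY.calculus_mul (f := fun _ => t) continuousOn_const hfK, hY.calculus_const,
      smul_mul_assoc, one_mul, Complex.coe_smul]
  have hle₀ : calculus Y κ₀ * (t • w) * calculus Y κ₀ ≤ calculus Y κ₀ * F * calculus Y κ₀ := by
    refine (IsSelfAdjoint.conjugate_le_conjugate htwf hs₀).trans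
      (le_trans ?_ (IsSelfAdjoint.conjugate_le_conjugate (hF q hq) hs₀))
    have ht : ContinuousOn (fun s => t * f s) (jointSpectrum Y) := continuousOn_const.mul hfK
    have hq' := (continuous_affine q).continuousOn (s := jointSpectrum Y)
    rw [htf, ← hY.calculus_affine, hY.calculus_conj hκ₀.continuousOn ht,
      hY.calculus_conj hκ₀.continuousOn hq']
    refine hY.calculus_mono ((hκ₀.continuousOn.mul ht).mul hκ₀.continuousOn)
      ((hκ₀.continuousOn.mul hq').mul hκ₀.continuousOn) fun s hs => ?_
    rcases lt_or_ge (∑ i, s i * s i) (2 * ρ) with h | h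
    · have := hρf s hs h
      nlinarith [mul_self_nonneg (κ₀ s)]
    · rw [hv₀ s h]; simp
  have hle₁ : weight φ (calculus Y κ₁ * (t • w) * calculus Y κ₁)
      ≤ weight φ (calculus Y κ₁ * F * calculus Y κ₁) := by
    refine hφ.weight_cutoff_le hy hyφ hf hconv hS hf0 hF0 hF hκ₁ hpos₁ hρ hv₁
      (cone_subset_coeIdeal htw) htw0 (htwf.trans ?_)
    conv_rhs => rw [← one_smul ℝ (calculus Y f)]
    exact smul_le_smul_of_nonneg_right ht1.le hfY0
  rw [← hφ.weight_conj_add_conj hy hyφ (calculus_mem _ κ₀) (calculus_mem _ κ₁) hs₀ hs₁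
    (hY.calculus_partition hκ₀ hκ₁ hsum) htw]
  refine (add_le_add le_rfl hle₁).trans ?_
  exact hφ.weight_add_weight_le_unboundedExtend hy hyφ (calculus_mem _ κ₀) (calculus_mem _ κ₁)
    hs₀ hs₁ (hY.calculus_partition hκ₀ hκ₁ hsum) hF0
    (mul_mem_coeIdeal_right (mul_mem_coeIdeal_left _ (cone_subset_coeIdeal htw)) _)
    (IsSelfAdjoint.conjugate_nonneg htw0 hs₀) hle₀
    (mul_mem_coeIdeal_left _ (cone_subset_coeIdeal hr₁))
    (IsSelfAdjoint.conjugate_nonneg hF0 hs₁) le_rfl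

/-- If `f` is small near `0`, then `c ≤ f(y)` is the norm limit of its parts away from `0`. -/
theorem IsCStarIntegral.weight_le_of_eventually_lt (hφ : IsCStarIntegral φ) (hy : IsAbelianTuple y)
    (hyφ : ∀ i, y i ∈ unboundedCentralizer φ)
    {S : Set (Fin n → ℝ)} {f : (Fin n → ℝ) → ℝ} (hf : ContinuousOn f S) (hconv : ConvexOn ℝ S f)
    (hS : jointSpectrum (fun i => (y i : 𝓜(ℂ, A))) ⊆ S) (hf0 : ∀ s ∈ S, 0 ≤ f s) (hF0 : 0 ≤ F)
    (hF : ∀ q, (∀ s ∈ S, affine q s ≤ f s) → affineValue q (fun i => (y i : 𝓜(ℂ, A))) ≤ F)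
    (hsmall : ∀ ε : ℝ, 0 < ε →
      ∀ᶠ s in 𝓝[jointSpectrum fun i => (y i : 𝓜(ℂ, A))] 0, f s < ε)
    (hc : c ∈ coeIdeal A) (hc0 : 0 ≤ c)
    (hcf : c ≤ calculus (fun i => (y i : 𝓜(ℂ, A))) f) :
    weight φ c ≤ unboundedExtend φ F := by
  have hY := isAbelianTuple_coe hy
  set Y : Fin n → 𝓜(ℂ, A) := fun i => y i with hYdef
  have hfK := hf.mono hS
  obtain ⟨S', hS', hS0, hSc⟩ := exists_sqrt_mem_coeIdeal hc hc0
  have hSs : star S' = S' := (IsSelfAdjoint.of_nonneg hS0).star_eq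
  have key : ∀ j : ℕ, ∃ r : 𝓜(ℂ, A), star r = r ∧ ‖S' * r - S'‖ ≤ √(1 / ((j : ℝ) + 1)) ∧
      weight φ (r * c * r) ≤ unboundedExtend φ F := by
    intro j
    have hε : (0 : ℝ) < 1 / ((j : ℝ) + 1) := by positivity
    obtain ⟨ρ, hρ, hρf⟩ := exists_pos_of_eventually_nhdsWithin_zero (hsmall _ hε)
    obtain ⟨κ₀, κ₁, hκ₀, hκ₁, hsum, hpos₁, hv₁, hv₀⟩ := exists_partition n hρ
    have hs₀ := hY.star_calculus hκ₀.continuousOn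
    have hs₁ := hY.star_calculus hκ₁.continuousOn
    have hr₁ := calculus_mem_cone hy hκ₁ hpos₁ hρ hv₁
    refine ⟨calculus Y κ₁, hs₁, ?_, ?_⟩
    · -- `‖c^{1/2} (κ₁(y) - 1)‖² ≤ ‖(κ₁(y) - 1) f(y) (κ₁(y) - 1)‖`
      have hκ' : Continuous fun s => κ₁ s - 1 := hκ₁.sub continuous_const
      have e1 : S' * calculus Y κ₁ - S' = S' * calculus Y fun s => κ₁ s - 1 := by
        rw [hY.calculus_sub (g := fun _ => 1) hκ₁.continuousOn continuousOn_const,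
          hY.calculus_const, Complex.ofReal_one, one_smul, mul_sub, mul_one]
      rw [e1]
      refine Real.le_sqrt_of_sq_le ?_
      have hs' := hY.star_calculus (x := Y) hκ'.continuousOn
      rw [norm_sq_eq_norm_conj hSs hs' hSc]
      refine (norm_conj_le hs' hc0 hcf).trans ?_
      rw [hY.calculus_conj hκ'.continuousOn hfK]
      refine hY.norm_calculus_le ((hκ'.continuousOn.mul hfK).mul hκ'.continuousOn) hε.le
        fun s hs => ?_
      have h0 := hf0 s (hS hs)
      have h1 := hpos₁ s
      have h2 := hsum s
      have h3 : κ₁ s ≤ 1 := by nlinarith [mul_self_nonneg (κ₀ s)]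
      change |(κ₁ s - 1) * f s * (κ₁ s - 1)| ≤ _
      rw [abs_of_nonneg (by nlinarith [mul_nonneg (mul_self_nonneg (κ₁ s - 1)) h0])]
      rcases lt_or_ge (∑ i, s i * s i) (2 * ρ) with h | h
      · have h4 := hρf s hs h
        have h5 : (κ₁ s - 1) * (κ₁ s - 1) ≤ 1 := by nlinarith
        nlinarith [mul_le_mul_of_nonneg_right h5 h0]
      · have h4 : κ₁ s = 1 := by
          rw [hv₀ s h] at h2
          nlinarith
        rw [h4]
        simp only [sub_self, zero_mul]
        exact hε.le
    · refine (hφ.weight_cutoff_le hy hyφ hf hconv hS hf0 hF0 hF hκ₁ hpos₁ hρ hv₁ hc hc0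
        hcf).trans ?_
      have := hφ.weight_add_weight_le_unboundedExtend hy hyφ (calculus_mem _ κ₀)
        (calculus_mem _ κ₁) hs₀ hs₁ (hY.calculus_partition hκ₀ hκ₁ hsum) hF0 (zero_mem _) le_rfl
        (IsSelfAdjoint.conjugate_nonneg hF0 hs₀)
        (mul_mem_coeIdeal_left _ (cone_subset_coeIdeal hr₁))
        (IsSelfAdjoint.conjugate_nonneg hF0 hs₁) le_rfl
      exact le_add_self.trans this
  choose r hr hrS hrw using key
  have hlim : Tendsto (fun j => S' * r j) atTop (𝓝 S') := by
    rw [tendsto_iff_norm_sub_tendsto_zero]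
    exact squeeze_zero (fun _ => norm_nonneg _) hrS tendsto_sqrt_one_div_nat
  have hlim2 : Tendsto (fun j => r j * c * r j) atTop (𝓝 c) := by
    have := hlim.star.mul hlim
    rw [hSs, hSc] at this
    refine this.congr fun j => ?_
    rw [star_mul, hSs, hr, ← hSc]
    simp only [mul_assoc]
  exact hφ.weight_le_of_tendsto (fun j => mul_mem_coeIdeal_right (mul_mem_coeIdeal_left _ hc) _)
    (fun j => IsSelfAdjoint.conjugate_nonneg hc0 (hr j)) hc hc0 hlim2 hrw

/-- Jensen's inequality for unbounded functionals.  Whether `f` vanishes at `0` matters when `0` is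
in the joint spectrum, since `f(y)` is then not approximated by elements that have a local unit in
the algebra generated by `y`. -/
theorem unboundedExtend_calculus_le (hφ : IsCStarIntegral φ) (hy : IsAbelianTuple y)
    (hyφ : ∀ i, y i ∈ unboundedCentralizer φ) {S : Set (Fin n → ℝ)}
    {f : (Fin n → ℝ) → ℝ} (hf : ContinuousOn f S) (hconv : ConvexOn ℝ S f)
    (hS : jointSpectrum (fun i => (y i : 𝓜(ℂ, A))) ⊆ S) (hf0 : ∀ s ∈ S, 0 ≤ f s)
    (hF : ∀ q, (∀ s ∈ S, affine q s ≤ f s) → affineValue q (fun i => (y i : 𝓜(ℂ, A))) ≤ F) :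
    unboundedExtend φ (calculus (fun i => (y i : 𝓜(ℂ, A))) f) ≤ unboundedExtend φ F := by
  have hY := isAbelianTuple_coe hy
  set Y : Fin n → 𝓜(ℂ, A) := fun i => y i with hYdef
  have hfK := hf.mono hS
  have hF0 : 0 ≤ F := by
    -- the zero function is an affine minorant of `f`
    refine le_of_eq_of_le ?_ (hF (0, 0) fun s hs => ?_)
    · rw [← hY.calculus_affine]
      have : affine ((0, 0) : (Fin n → ℝ) × ℝ) = fun _ => 0 := by
        funext s; simp [affine]
      rw [this, hY.calculus_const, Complex.ofReal_zero, zero_smul]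
    · simpa [affine] using hf0 s hs
  refine iSup₂_le fun c hc => ?_
  obtain ⟨hc0', d, hd⟩ := hc
  rw [← weight_coe φ c]
  have hcm := coe_mem_coeIdeal c
  have hc0 : 0 ≤ (c : 𝓜(ℂ, A)) := coe_nonneg hc0'
  have hcf : (c : 𝓜(ℂ, A)) ≤ calculus Y f := by
    rw [← sub_nonneg, hd]; exact star_mul_self_nonneg d
  by_cases hcase : (0 : Fin n → ℝ) ∈ jointSpectrum Y ∧ 0 < f 0
  · -- `c` is the norm limit of the elements `t (c - ε)₊` with `t → 1` and `ε → 0`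
    obtain ⟨h0K, hf00⟩ := hcase
    choose W hW hWc hWn using fun j : ℕ =>
      exists_mem_cone_le hcm hc0 (Nat.one_div_pos_of_nat (n := j))
    have hlimW : Tendsto W atTop (𝓝 (c : 𝓜(ℂ, A))) := by
      rw [tendsto_iff_norm_sub_tendsto_zero]
      refine squeeze_zero (fun _ => norm_nonneg _) (fun j => ?_)
        (tendsto_one_div_add_atTop_nhds_zero_nat (𝕜 := ℝ))
      rw [norm_sub_rev]
      exact hWn j
    have hlimt : Tendsto (fun j : ℕ => 1 - 1 / ((j : ℝ) + 1)) atTop (𝓝 1) := by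
      have := (tendsto_one_div_add_atTop_nhds_zero_nat (𝕜 := ℝ)).const_sub 1
      rwa [sub_zero] at this
    have hlim : Tendsto (fun j : ℕ => (1 - 1 / ((j : ℝ) + 1)) • W j) atTop
        (𝓝 (c : 𝓜(ℂ, A))) := by
      have := hlimt.smul hlimW
      rwa [one_smul] at this
    have ht0 : ∀ j : ℕ, 0 ≤ 1 - 1 / ((j : ℝ) + 1) := fun j => by
      rw [sub_nonneg, div_le_one (by positivity)]
      linarith [(j.cast_nonneg : (0 : ℝ) ≤ j)]
    have hmc := fun j => smul_mem_cone (ht0 j) (hW j)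
    refine hφ.weight_le_of_tendsto (fun j => cone_subset_coeIdeal (hmc j))
      (fun j => nonneg_of_mem_cone (hmc j)) hcm hc0 hlim fun j =>
      hφ.weight_smul_le_of_pos hy hyφ hf hconv hS hf0 hF0 hF h0K hf00 (ht0 j) ?_ (hW j)
        ((hWc j).trans hcf)
    exact sub_lt_self 1 (by positivity)
  · have hsmall : ∀ ε : ℝ, 0 < ε → ∀ᶠ s in 𝓝[jointSpectrum Y] 0, f s < ε := by
      intro ε hε
      by_cases h0K : (0 : Fin n → ℝ) ∈ jointSpectrum Y
      · have hle : f 0 ≤ 0 := not_lt.mp fun h => hcase ⟨h0K, h⟩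
        exact (hfK 0 h0K).eventually (gt_mem_nhds (hle.trans_lt hε))
      · have h1 : (0 : Fin n → ℝ) ∉ closure (jointSpectrum Y) := by
          rwa [(isCompact_jointSpectrum Y).isClosed.closure_eq]
        rw [notMem_closure_iff_nhdsWithin_eq_bot.mp h1]
        exact eventually_bot
    exact hφ.weight_le_of_eventually_lt hy hyφ hf hconv hS hf0 hF0 hF hsmall hcm hc0 hcf

end Unbounded

end TraceJensen

theorem theorem7 {A : Type*} [NonUnitalCStarAlgebra A] [PartialOrder A] [StarOrderedRing A]
    [TopologicalSpace.SeparableSpace A]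
    {T : Type*} [MetricSpace T] [LocallyCompactSpace T] [MeasurableSpace T] [BorelSpace T]
    (μ : Measure T) [μ.Regular]
    (n : ℕ) (I : Fin n → Set ℝ) (hI : ∀ i, (I i).OrdConnected)
    -- the bounded, weak* measurable field of abelian tuples
    (x : T → Fin n → A)
    (hx_abelian : ∀ t, TraceJensen.IsAbelianTuple (x t))
    (hx_bounded : ∃ C : ℝ, ∀ t i, ‖x t i‖ ≤ C)
    (hx_meas : ∀ i, TraceJensen.WeakStarMeasurable μ (fun t => (x t i : 𝓜(ℂ, A))))
    (hx_spec : ∀ t i, spectrum ℝ (x t i : 𝓜(ℂ, A)) ⊆ I i)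
    -- the unital column field
    (a : T → 𝓜(ℂ, A)) (ha : TraceJensen.IsUnitalColumnField μ a)
    -- the integrals `y i` are elements of `A` and form an abelian tuple
    (y : Fin n → A)
    (hy : ∀ i, (y i : 𝓜(ℂ, A)) =
      TraceJensen.fieldIntegral μ (fun t => star (a t) * (x t i : 𝓜(ℂ, A)) * a t))
    (hy_abelian : TraceJensen.IsAbelianTuple y)
    -- the convex function on the box
    (f : (Fin n → ℝ) → ℝ) (hf_cont : ContinuousOn f (Set.univ.pi I))
    (hf_conv : ConvexOn ℝ (Set.univ.pi I) f) :
    -- the objects in the inequality are well defined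
    (∀ i, TraceJensen.FieldIntegrable μ
      (fun t => star (a t) * (x t i : 𝓜(ℂ, A)) * a t)) ∧
    (∀ i, spectrum ℝ (y i : 𝓜(ℂ, A)) ⊆ I i) ∧
    ((∃ C : ℝ, ∀ t, ‖TraceJensen.calculus (fun i => (x t i : 𝓜(ℂ, A))) f‖ ≤ C) →
      TraceJensen.FieldIntegrable μ (fun t =>
        star (a t) * TraceJensen.calculus (fun i => (x t i : 𝓜(ℂ, A))) f * a t)) ∧
    -- the inequality
    (TraceJensen.FieldIntegrable μ (fun t =>
        star (a t) * TraceJensen.calculus (fun i => (x t i : 𝓜(ℂ, A))) f * a t) →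
      (∀ φ : A →L[ℂ] ℂ, TraceJensen.IsPositiveFunctional φ →
        (∀ i, y i ∈ TraceJensen.centralizer φ) →
        TraceJensen.extend φ (TraceJensen.calculus (fun i => (y i : 𝓜(ℂ, A))) f) ≤
          TraceJensen.extend φ (TraceJensen.fieldIntegral μ (fun t =>
            star (a t) * TraceJensen.calculus (fun i => (x t i : 𝓜(ℂ, A))) f * a t))) ∧
      ((∀ s ∈ Set.univ.pi I, 0 ≤ f s) →
        ∀ φ : A → ℝ≥0∞, TraceJensen.IsCStarIntegral φ →
          (∀ i, y i ∈ TraceJensen.unboundedCentralizer φ) →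
          TraceJensen.unboundedExtend φ
              (TraceJensen.calculus (fun i => (y i : 𝓜(ℂ, A))) f) ≤
            TraceJensen.unboundedExtend φ (TraceJensen.fieldIntegral μ (fun t =>
              star (a t) * TraceJensen.calculus (fun i => (x t i : 𝓜(ℂ, A))) f * a t)))) := by
  open TraceJensen in
  obtain ⟨C, hC⟩ := hx_bounded
  have hX := fun t => isAbelianTuple_coe (hx_abelian t)
  have hY := isAbelianTuple_coe hy_abelian
  have hXn : ∀ t i, ‖(x t i : 𝓜(ℂ, A))‖ ≤ max C 0 := fun t i => by
    rw [norm_coe]; exact (hC t i).trans (le_max_left _ _)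
  have hC0 : 0 ≤ max C 0 := le_max_right _ _
  have hXm := fun i => (hx_meas i).strictlyMeasurable
  have hint : ∀ i, FieldIntegrable μ fun t => star (a t) * (x t i : 𝓜(ℂ, A)) * a t := fun i =>
    ha.fieldIntegrable (hXm i) hC0 fun t => hXn t i
  have hYi : ∀ i, IsFieldIntegral μ (fun t => star (a t) * (x t i : 𝓜(ℂ, A)) * a t)
      (y i : 𝓜(ℂ, A)) := fun i => by
    rw [hy i]; exact isFieldIntegral_fieldIntegral (hint i)
  have hYs : ∀ i, spectrum ℝ (y i : 𝓜(ℂ, A)) ⊆ I i := fun i =>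
    ha.spectrum_subset (hI i) (fun t => (hx_abelian t).1 i) (fun t => hx_spec t i)
      (hy_abelian.1 i) (hYi i)
  have hXI : ∀ t, jointSpectrum (fun i => (x t i : 𝓜(ℂ, A))) ⊆ Set.univ.pi I := by
    rintro t _ ⟨χ, rfl⟩ i _
    exact hx_spec t i (jointPoint_mem_spectrum (hX t) χ i)
  have hYI : jointSpectrum (fun i => (y i : 𝓜(ℂ, A))) ⊆ Set.univ.pi I := by
    rintro _ ⟨χ, rfl⟩ i _
    exact hYs i (jointPoint_mem_spectrum hY χ i)
  refine ⟨hint, hYs, ?_, fun hF => ?_⟩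
  · rintro ⟨K, hK⟩
    exact ha.fieldIntegrable (strictlyMeasurable_calculus hX hXn hC0 hXm hI hXI hf_cont)
      (le_max_right K 0) fun t => (hK t).trans (le_max_left _ _)
  have hF' := fun q => ha.affineValue_le (q := q) hX hXI hYi hf_cont
    (isFieldIntegral_fieldIntegral hF)
  refine ⟨fun φ hφ hyφ => ?_, fun hf0 φ hφ hyφ => ?_⟩
  · exact apply_calculus_le (ψ := extendCLM φ) (fun b hb => extend_nonneg hφ hb) hY
      (fun i z => extend_mul_comm (hyφ i) z) hf_cont hf_conv hYI hF'
  · exact unboundedExtend_calculus_le hφ hy_abelian hyφ hf_cont hf_conv hYI hf0 hF'
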